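/- **Maximum principle.** Let $\mathfrak g=V_1\oplus\cdots\oplus V_s$ be a stratified real Lie algebra of step $s\ge 1$ of finite dimension, that is, $[V_1,V_l]=V_{l+1}$ for $1\le l<s$, $[V_1,V_s]=\{0\}$ and $V_s\neq\{0\}$, and let $G$ be the corresponding Carnot group in exponential coordinates: bases of the layers identify $\mathfrak g$ with $\mathbb R^{N}$, $N=\sum_l \dim V_l$, and $G=\mathbb R^{N}$ carries the group law given by the Baker–Campbell–Hausdorff formula. Let $Q=\sum_{l=1}^s l\,\dim V_l$ be the homogeneous dimension, let $|\cdot|$ of a set denote a fixed bi-invariant Haar measure of $G$, let $X_1,\dots,X_m$ be the chosen basis of $V_1$, regarded as left-invariant vector fields $(X_iu)(\xi)=\frac{d}{dt}\big|_{t=0}u(\xi\exp(tX_i))$, and let $L=\sum_{i=1}^m X_i^2$ be the sub-Laplacian. Then there is a constant $C>0$, depending only on $G$, the basis and the Haar measure, such that the following holds. Let $\Omega\subset G$ be an open set with $|\Omega|<\infty$, let $f\in L^\infty(\Omega)$, and let $u\in C^2(\Omega)\cap C(\overline\Omega)$ be bounded on $\Omega$ (which is automatic if $\Omega$ is bounded),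 with $Lu=f$ almost everywhere in $\Omega$ and $u=g$ on $\partial\Omega$. Then $$\sup_\Omega|u|\;\le\;\sup_{\partial\Omega}|g|+C\,\|f\|_{L^\infty(\Omega)}\,|\Omega|^{2/Q}\,2^{(Q+2)/4}.$$ -/

import Mathlib

open MeasureTheory
open scoped ENNReal NNReal

noncomputable section

/-- The right-nested iterated commutator `[a₁, [a₂, [..., [aₙ₋₁, aₙ]]]]` of a word. -/
def iteratedBracket {𝔤 : Type*} [LieRing 𝔤] : List 𝔤 → 𝔤
  | [] => 0
  | [a] => a
  | a :: b :: w => ⁅a, iteratedBracket (b :: w)⁆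

/-- The Baker-Campbell-Hausdorff series of `x` and `y` in Dynkin's form,
`∑ₙ (-1)ⁿ⁻¹/n ∑ [x^{p₁} y^{q₁} ⋯ x^{pₙ} y^{qₙ}] / ((∑ᵢ (pᵢ + qᵢ)) ∏ᵢ pᵢ! qᵢ!)`, the inner sum being over
all `p, q` with `pᵢ + qᵢ > 0`. The sums stop at `n = s` and `pᵢ, qᵢ = s`: in a Lie algebra that is
nilpotent of step `s`, all the omitted terms vanish, since they are commutators of length `> s`. -/
def bchProduct {𝔤 : Type*} [LieRing 𝔤] [LieAlgebra ℝ 𝔤] (s : ℕ) (x y : 𝔤) : 𝔤 :=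
  ∑ n ∈ Finset.Icc 1 s, ((-1 : ℝ) ^ (n - 1) / (n : ℝ)) •
    ∑ p : Fin n → Fin (s + 1), ∑ q : Fin n → Fin (s + 1),
      if ∀ i, 0 < (p i : ℕ) + (q i : ℕ) then
        (((∑ i, ((p i : ℕ) + (q i : ℕ)) : ℕ) : ℝ) *
            ((∏ i, ((p i : ℕ).factorial * (q i : ℕ).factorial) : ℕ) : ℝ))⁻¹ •
          iteratedBracket (List.ofFn fun i =>
            List.replicate (p i : ℕ) x ++ List.replicate (q i : ℕ) y).flatten
      else 0

/-- A Carnot group of step `s` in exponential coordinates: a real Lie algebra `𝔤` with a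
stratification `𝔤 = V₁ ⊕ ⋯ ⊕ V_s`, `[V₁, V_l] = V_{l+1}` for `1 ≤ l < s`, `[V₁, V_s] = 0`, `V_s ≠ 0`,
and with a basis of every layer (`V_{l+1}` has dimension `m l`, for `l = 0, …, s - 1`).
The group is the simply connected group of `𝔤`: the coordinate space, with the
Baker-Campbell-Hausdorff product, see `CarnotGroup.mul`. -/
structure CarnotGroup (𝔤 : Type*) [LieRing 𝔤] [LieAlgebra ℝ 𝔤] (s : ℕ) (m : Fin s → ℕ) where
  /-- `layer l` is `V_l`, for `1 ≤ l ≤ s`; the values at other `l` play no role. -/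
  layer : ℕ → Submodule ℝ 𝔤
  one_le_step : 1 ≤ s
  isInternal : DirectSum.IsInternal fun l : Fin s => layer (l + 1)
  bracket_layer : ∀ l : ℕ, 1 ≤ l → l < s →
    Submodule.span ℝ {z : 𝔤 | ∃ x ∈ layer 1, ∃ y ∈ layer l, ⁅x, y⁆ = z} = layer (l + 1)
  bracket_top : ∀ x ∈ layer 1, ∀ y ∈ layer s, ⁅x, y⁆ = 0
  top_ne_bot : layer s ≠ ⊥
  /-- the basis of each layer that defines the coordinates -/
  basis : ∀ l : Fin s, Module.Basis (Fin (m l)) ℝ (layer (l + 1))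

namespace CarnotGroup

/-- The coordinates `ξ = (z₁, …, z_s)`, with `z_l` a vector of `dim V_l` reals. -/
abbrev Coord {s : ℕ} (m : Fin s → ℕ) : Type := (Σ l : Fin s, Fin (m l)) → ℝ

variable {𝔤 : Type*} [LieRing 𝔤] [LieAlgebra ℝ 𝔤] {s : ℕ} {m : Fin s → ℕ}

/-- The linear identification of the coordinate space with the Lie algebra. -/
def toLie (G : CarnotGroup 𝔤 s m) : Coord m ≃ₗ[ℝ] 𝔤 :=
  (G.isInternal.collectedBasis G.basis).equivFun.symm

/-- The group law in exponential coordinates. -/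
def mul (G : CarnotGroup 𝔤 s m) (ξ η : Coord m) : Coord m :=
  G.toLie.symm (bchProduct s (G.toLie ξ) (G.toLie η))

/-- The homogeneous dimension `Q = ∑ l · dim V_l`. -/
def homDim (_G : CarnotGroup 𝔤 s m) : ℕ := ∑ l : Fin s, ((l : ℕ) + 1) * m l

/-- The dimension of the first layer. -/
def rank (G : CarnotGroup 𝔤 s m) : ℕ := m ⟨0, G.one_le_step⟩

/-- The point `exp (t Xᵢ)`, where `X₁, X₂, …` is the chosen basis of the first layer. -/
def expX (G : CarnotGroup 𝔤 s m) (i : Fin G.rank) (t : ℝ) : Coord m :=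
  Pi.single ⟨⟨0, G.one_le_step⟩, i⟩ t

/-- The derivative along the left-invariant vector field `Xᵢ`:
`(Xᵢ u)(ξ) = d/dt u(ξ exp(t Xᵢ))` at `t = 0`. -/
def X (G : CarnotGroup 𝔤 s m) (i : Fin G.rank) (u : Coord m → ℝ) (ξ : Coord m) : ℝ :=
  deriv (fun t : ℝ => u (G.mul ξ (G.expX i t))) 0

/-- The sub-Laplacian `L = ∑ Xᵢ²`. -/
def subLaplacian (G : CarnotGroup 𝔤 s m) (u : Coord m → ℝ) (ξ : Coord m) : ℝ :=
  ∑ i : Fin G.rank, G.X i (G.X i u) ξ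

/-- `μ` is a bi-invariant Haar measure of the group. -/
structure IsHaar (G : CarnotGroup 𝔤 s m) (μ : Measure (Coord m)) : Prop where
  ne_zero : μ ≠ 0
  finite_of_isCompact : ∀ K : Set (Coord m), IsCompact K → μ K < ∞
  left_invariant : ∀ ξ : Coord m, MeasurePreserving (fun η => G.mul ξ η) μ μ
  right_invariant : ∀ ξ : Coord m, MeasurePreserving (fun η => G.mul η ξ) μ μ

end CarnotGroup

end

/-!
The Lie algebra, extended by its degree derivation, acts faithfully by nilpotent matrices, and
Dynkin's formula identifies `exp (mul ξ η)` with `exp ξ * exp η`. So the Baker–Campbell–Hausdorff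
product is a group law; dilations are automorphisms, and every point is a product of boundedly many
exponentials of elements of the first layer.

If the factors of such a product `η` have length at most `r`, then `‖v(· η) - v‖₂` is at most a
constant times `r ‖∇v‖₂`, with `∇` the horizontal gradient. Averaging over a dilated set of such
`η`, of measure comparable to that of the support of `v`, gives the Faber–Krahn inequality
`∫ v² ≤ C |{v ≠ 0}| ^ (2 / Q) ∫ |∇v|²`.

If `Lu ≥ -F` and `w = (u - k)⁺` vanishes at the boundary, then integrating
`L(w⁴) = 3 |∇(w²)|² + 4 w³ Lu` gives `3 ∫ |∇(w²)|² ≤ 4 F ∫ w³`. With Faber–Krahn for `w²` this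
yields `(h - k)⁴ φ(h) ≤ C F⁴ φ(k) ^ (1 + 8 / Q)` for `φ(k) = |{u > k}|`, and Stampacchia's iteration
makes `φ` vanish at a level that exceeds the boundary values by a multiple of `F |Ω| ^ (2 / Q)`.
The exponent `4` makes `w⁴` a `C²` function and `w²` a `C¹` function.
-/

open Finset.HasAntidiagonal (antidiagonal)

noncomputable section

/-! ### Logarithms of unipotent elements -/

theorem sum_antidiagonal_eq_sum_range_product {M : Type*} [AddCommMonoid M] (a : ℕ → ℕ → M)
    {s K L : ℕ} (hL : s + K ≤ L) (h₁ : ∀ k j, s ≤ k → a k j = 0) (h₂ : ∀ k j, K ≤ j → a k j = 0) :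
    ∑ n ∈ Finset.range L, ∑ p ∈ antidiagonal n, a p.1 p.2 =
      ∑ k ∈ Finset.range s, ∑ j ∈ Finset.range K, a k j := by
  rw [← Finset.sum_product', ← Finset.sum_fiberwise_of_maps_to
    (s := Finset.range s ×ˢ Finset.range K) (t := Finset.range L) (g := fun p : ℕ × ℕ => p.1 + p.2)]
  · refine Finset.sum_congr rfl fun n _ => (Finset.sum_subset ?_ ?_).symm
    · intro p hp
      simpa using (Finset.mem_filter.1 hp).2
    · intro p hp hp'
      simp only [Finset.HasAntidiagonal.mem_antidiagonal, Finset.mem_filter, Finset.mem_product,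
        Finset.mem_range] at hp hp'
      by_cases h : s ≤ p.1
      · exact h₁ _ _ h
      · exact h₂ _ _ (by by_contra hK; exact hp' ⟨⟨by omega, by omega⟩, hp⟩)
  · intro p hp
    simp only [Finset.mem_product, Finset.mem_range] at hp ⊢
    omega

section Ring

variable {A : Type*} [Ring A]

theorem one_add_mul_sum_neg_one_pow_smul_pow {N : A} {K : ℕ} (hN : N ^ K = 0) :
    (1 + N) * ∑ j ∈ Finset.range K, ((-1 : ℤ) ^ j) • N ^ j = 1 := by
  have geom := mul_neg_geom_sum (-N) K
  rw [neg_pow N K, hN, mul_zero, sub_zero, sub_neg_eq_add] at geom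
  refine (congrArg _ (Finset.sum_congr rfl fun j _ => ?_)).trans geom
  rw [neg_pow N j, zsmul_eq_mul]
  push_cast
  rfl

/-- `invOneAddPow k K N` is the binomial series of `(1 + N)⁻¹ ^ (k + 1)`, without the terms of
order `≥ K`. -/
def invOneAddPow (k K : ℕ) (N : A) : A :=
  ∑ j ∈ Finset.range K, ((-1 : ℤ) ^ j * ((k + j).choose k : ℤ)) • N ^ j

theorem one_add_mul_invOneAddPow_succ {N : A} {K : ℕ} (hN : N ^ K = 0) (k : ℕ) :
    (1 + N) * invOneAddPow (k + 1) K N = invOneAddPow k K N := by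
  unfold invOneAddPow
  rcases K with _ | K
  · simp
  have last_term : N * (((-1 : ℤ) ^ K * ((k + 1 + K).choose (k + 1) : ℤ)) • N ^ K) = 0 := by
    rw [mul_smul_comm, ← pow_succ', hN, smul_zero]
  rw [add_mul, one_mul, Finset.mul_sum, Finset.sum_range_succ' _ K, Finset.sum_range_succ _ K,
    Finset.sum_range_succ' (fun j => ((-1 : ℤ) ^ j * ((k + j).choose k : ℤ)) • N ^ j) K, last_term,
    add_right_comm, add_zero, ← Finset.sum_add_distrib]
  congr 1
  · refine Finset.sum_congr rfl fun j _ => ?_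
    have pascal : (k + 1 + (j + 1)).choose (k + 1) =
        (k + (j + 1)).choose k + (k + 1 + j).choose (k + 1) := by
      rw [show k + 1 + (j + 1) = (k + 1 + j) + 1 by ring, Nat.choose_succ_succ,
        show k + 1 + j = k + (j + 1) by ring]
    rw [mul_smul_comm, ← pow_succ', ← add_smul, pascal]
    congr 1
    push_cast
    ring
  · simp

theorem one_add_pow_mul_invOneAddPow {N : A} {K : ℕ} (hN : N ^ K = 0) (k : ℕ) :
    (1 + N) ^ (k + 1) * invOneAddPow k K N = 1 := by
  induction k with
  | zero => simpa [invOneAddPow] using one_add_mul_sum_neg_one_pow_smul_pow hN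
  | succ k ih => rw [pow_succ, mul_assoc, one_add_mul_invOneAddPow_succ hN, ih]

theorem mul_sum_antidiagonal_choose {N : A} {c : ℕ → A}
    (hc : ∀ k, N * c k = c (k + 1) * (1 + N) + c k * N) (n : ℕ) :
    N * ∑ p ∈ antidiagonal n, (n + 1).choose (p.1 + 1) • (c p.1 * (1 + N) ^ (p.1 + 1) * N ^ p.2) =
      ∑ p ∈ antidiagonal n, (n + 1).choose (p.1 + 1) •
        (c (p.1 + 1) * (1 + N) ^ (p.1 + 1 + 1) * N ^ p.2) +
      ∑ p ∈ antidiagonal n, (n + 1).choose (p.1 + 1) •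
        (c p.1 * (1 + N) ^ (p.1 + 1) * N ^ (p.2 + 1)) := by
  have comm (k : ℕ) : N * (1 + N) ^ k = (1 + N) ^ k * N :=
    (((Commute.one_right N).add_right (Commute.refl N)).pow_right k).eq
  rw [Finset.mul_sum, ← Finset.sum_add_distrib]
  refine Finset.sum_congr rfl fun p _ => ?_
  rw [mul_smul_comm, ← smul_add, mul_assoc, ← mul_assoc N, hc, add_mul, mul_assoc (c p.1) N,
    ← mul_assoc N, comm, pow_succ' _ (p.1 + 1), pow_succ' _ p.2]
  simp only [mul_assoc]

end Ring

/-- The truncated logarithm series `∑_{n < L} (-1)ⁿ / (n + 1) Nⁿ⁺¹` of `1 + N`. -/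
def logOneAdd {A : Type*} [Ring A] [Algebra ℝ A] (L : ℕ) (N : A) : A :=
  ∑ n ∈ Finset.range L, ((-1 : ℝ) ^ n / (n + 1 : ℝ)) • N ^ (n + 1)

section Derivative

variable {A : Type*} [NormedRing A] [NormedAlgebra ℝ A] {N : ℝ → A} {t : ℝ} {c : ℕ → A}

theorem hasDerivAt_pow_succ_of_commutator (h₀ : HasDerivAt N (c 0 * (1 + N t)) t)
    (hc : ∀ k, N t * c k = c (k + 1) * (1 + N t) + c k * N t) (n : ℕ) :
    HasDerivAt (fun τ => N τ ^ (n + 1)) (∑ p ∈ antidiagonal n,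
      (n + 1).choose (p.1 + 1) • (c p.1 * (1 + N t) ^ (p.1 + 1) * N t ^ p.2)) t := by
  induction n with
  | zero => simpa using h₀
  | succ n ih =>
    set g : ℕ → ℕ → A := fun k j => c k * (1 + N t) ^ (k + 1) * N t ^ j with hg
    have leading : ∑ p ∈ antidiagonal (n + 1), (n + 1).choose p.1 • g p.1 p.2 =
        g 0 (n + 1) + ∑ p ∈ antidiagonal n, (n + 1).choose (p.1 + 1) • g (p.1 + 1) p.2 := by
      simp [Finset.Nat.sum_antidiagonal_succ]
    have trailing : ∑ p ∈ antidiagonal (n + 1), (n + 1).choose (p.1 + 1) • g p.1 p.2 =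
        ∑ p ∈ antidiagonal n, (n + 1).choose (p.1 + 1) • g p.1 (p.2 + 1) := by
      simp [Finset.Nat.sum_antidiagonal_succ']
    have pascal : ∑ p ∈ antidiagonal (n + 1), (n + 1 + 1).choose (p.1 + 1) • g p.1 p.2 =
        ∑ p ∈ antidiagonal (n + 1), (n + 1).choose p.1 • g p.1 p.2 +
        ∑ p ∈ antidiagonal (n + 1), (n + 1).choose (p.1 + 1) • g p.1 p.2 := by
      simp only [← Finset.sum_add_distrib, ← add_smul, Nat.choose_succ_succ]
    have split : (fun τ => N τ ^ (n + 1 + 1)) = N * fun τ => N τ ^ (n + 1) := by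
      ext τ
      simp [pow_succ' _ (n + 1)]
    rw [split]
    refine (h₀.mul ih).congr_deriv ?_
    rw [pascal, leading, trailing, mul_sum_antidiagonal_choose hc, add_assoc]
    simp only [hg, zero_add, pow_one]

theorem smul_sum_antidiagonal_choose (d : ℕ → ℕ → A) (n : ℕ) :
    ((-1 : ℝ) ^ n / (n + 1 : ℝ)) • ∑ p ∈ antidiagonal n, (n + 1).choose (p.1 + 1) • d p.1 p.2 =
      ∑ p ∈ antidiagonal n,
        ((-1 : ℝ) ^ (p.1 + p.2) * ((p.1 + p.2).choose p.1 : ℝ) / (p.1 + 1 : ℝ)) • d p.1 p.2 := by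
  rw [Finset.smul_sum]
  refine Finset.sum_congr rfl fun p hp => ?_
  rw [Finset.HasAntidiagonal.mem_antidiagonal.1 hp, ← Nat.cast_smul_eq_nsmul ℝ, smul_smul]
  congr 1
  have choose_succ :
      (n + 1 : ℝ) * (n.choose p.1 : ℝ) = ((n + 1).choose (p.1 + 1) : ℝ) * (p.1 + 1 : ℝ) := by
    exact_mod_cast Nat.add_one_mul_choose_eq n p.1
  rw [div_mul_eq_mul_div, div_eq_div_iff (by positivity) (by positivity)]
  linear_combination (-(-1 : ℝ) ^ n) * choose_succ

theorem hasDerivAt_logOneAdd_of_commutator (h₀ : HasDerivAt N (c 0 * (1 + N t)) t)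
    (hc : ∀ k, N t * c k = c (k + 1) * (1 + N t) + c k * N t) {s K L : ℕ} (hN : N t ^ K = 0)
    (hcs : ∀ k, s ≤ k → c k = 0) (hL : s + K ≤ L) :
    HasDerivAt (fun τ => logOneAdd L (N τ))
      (∑ k ∈ Finset.range s, ((-1 : ℝ) ^ k / (k + 1 : ℝ)) • c k) t := by
  refine (HasDerivAt.fun_sum (u := Finset.range L) fun n _ =>
    (hasDerivAt_pow_succ_of_commutator h₀ hc n).const_smul
      ((-1 : ℝ) ^ n / (n + 1 : ℝ))).congr_deriv ?_
  simp only [smul_sum_antidiagonal_choose (fun k j => c k * (1 + N t) ^ (k + 1) * N t ^ j)]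
  rw [sum_antidiagonal_eq_sum_range_product (fun k j =>
    ((-1 : ℝ) ^ (k + j) * ((k + j).choose k : ℝ) / (k + 1 : ℝ)) •
      (c k * (1 + N t) ^ (k + 1) * N t ^ j)) hL
    (fun k j hk => by simp [hcs k hk]) (fun k j hj => by simp [pow_eq_zero_of_le hj hN])]
  refine Finset.sum_congr rfl fun k _ => ?_
  conv_rhs => rw [← mul_one (c k), ← one_add_pow_mul_invOneAddPow hN k, invOneAddPow]
  rw [Finset.mul_sum, Finset.mul_sum, Finset.smul_sum]
  refine Finset.sum_congr rfl fun j _ => ?_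
  rw [mul_smul_comm, mul_smul_comm, ← Int.cast_smul_eq_zsmul ℝ, smul_smul, mul_assoc (c k)]
  congr 1
  push_cast
  ring

theorem hasDerivAt_logOneAdd_smul (L : ℕ) (N : A) (τ : ℝ) :
    HasDerivAt (fun τ : ℝ => logOneAdd L (τ • N))
      (∑ n ∈ Finset.range L, ((-1 : ℝ) ^ n * τ ^ n) • N ^ (n + 1)) τ := by
  unfold logOneAdd
  refine HasDerivAt.fun_sum fun n _ => ?_
  have coeff : HasDerivAt (fun x : ℝ => ((-1 : ℝ) ^ n / (n + 1 : ℝ)) * x ^ (n + 1))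
      ((-1 : ℝ) ^ n * τ ^ n) τ := by
    refine ((hasDerivAt_pow (n + 1) τ).const_mul ((-1 : ℝ) ^ n / (n + 1 : ℝ))).congr_deriv ?_
    push_cast
    field_simp
  simpa only [smul_pow, smul_smul] using coeff.smul_const (N ^ (n + 1))

theorem sum_neg_one_pow_smul_mul_one_add_smul {N : A} {L : ℕ} (hN : N ^ (L + 1) = 0) (τ : ℝ) :
    (∑ n ∈ Finset.range L, ((-1 : ℝ) ^ n * τ ^ n) • N ^ (n + 1)) * (1 + τ • N) = N := by
  have factor : ∑ n ∈ Finset.range L, ((-1 : ℝ) ^ n * τ ^ n) • N ^ (n + 1) =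
      N * ∑ i ∈ Finset.range L, (-(τ • N)) ^ i := by
    rw [Finset.mul_sum]
    refine Finset.sum_congr rfl fun i _ => ?_
    rw [← neg_smul, smul_pow, mul_smul_comm, ← pow_succ', ← mul_pow, neg_one_mul]
  have last_term : N * (-(τ • N)) ^ L = 0 := by
    rw [← neg_smul, smul_pow, mul_smul_comm, ← pow_succ', hN, smul_zero]
  rw [factor, mul_assoc, ← sub_neg_eq_add, geom_sum_mul_neg, mul_sub, mul_one, last_term, sub_zero]

theorem commute_logOneAdd {M N : A} (h : Commute M N) (L : ℕ) :
    Commute M (logOneAdd L N) :=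
  Commute.sum_right _ _ _ fun _ _ => (h.pow_right _).smul_right _

theorem hasDerivAt_exp_neg_of_commute [CompleteSpace A] {F : ℝ → A} {F' : A} {τ : ℝ}
    (hF : HasDerivAt F F' τ) (hcomm : ∀ x, Commute (F τ) (F x)) :
    HasDerivAt (fun x => NormedSpace.exp (-F x)) (NormedSpace.exp (-F τ) * -F') τ := by
  let _ : NormedAlgebra ℚ A := .restrictScalars ℚ ℝ A
  have increment : HasDerivAt (fun x => NormedSpace.exp (F τ - F x)) (-F') τ := by
    have fderiv_exp : HasFDerivAt (NormedSpace.exp : A → A) (1 : A →L[ℝ] A) (F τ - F τ) := by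
      rw [sub_self]
      exact hasFDerivAt_exp_zero
    simpa [Function.comp_def] using fderiv_exp.comp_hasDerivAt τ (hF.const_sub (F τ))
  convert increment.const_mul (NormedSpace.exp (-F τ)) using 2 with x
  rw [← NormedSpace.exp_add_of_commute ((Commute.refl _).sub_right (hcomm x)).neg_left,
    neg_add_eq_sub, sub_sub_cancel_left]

theorem exp_logOneAdd [CompleteSpace A] {N : A} {L : ℕ} (hN : N ^ (L + 1) = 0) :
    NormedSpace.exp (logOneAdd L N) = 1 + N := by
  let _ : NormedAlgebra ℚ A := .restrictScalars ℚ ℝ A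
  set F : ℝ → A := fun τ => logOneAdd L (τ • N) with hF
  have comm (τ τ' : ℝ) : Commute (F τ) (F τ') :=
    commute_logOneAdd (commute_logOneAdd
      (((Commute.refl N).smul_left τ').smul_right τ) L).symm L
  set g : ℝ → A := fun τ => NormedSpace.exp (-F τ) * (1 + τ • N) with hg
  have deriv_g (τ : ℝ) : HasDerivAt g 0 τ := by
    have linear : HasDerivAt (fun x : ℝ => 1 + x • N) N τ := by
      simpa using ((hasDerivAt_id τ).smul_const N).const_add 1
    refine ((hasDerivAt_exp_neg_of_commute (hasDerivAt_logOneAdd_smul L N τ)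
      (comm τ)).mul linear).congr_deriv ?_
    rw [mul_assoc, ← mul_add, neg_mul, sum_neg_one_pow_smul_mul_one_add_smul hN, neg_add_cancel,
      mul_zero]
  have g_one : NormedSpace.exp (-logOneAdd L N) * (1 + N) = 1 := by
    simpa [hg, hF, logOneAdd] using is_const_of_deriv_eq_zero
      (fun τ => (deriv_g τ).differentiableAt) (fun τ => (deriv_g τ).deriv) 1 0
  have inverse : NormedSpace.exp (logOneAdd L N) * NormedSpace.exp (-logOneAdd L N) = 1 := by
    rw [← NormedSpace.exp_add_of_commute (Commute.refl _).neg_right, add_neg_cancel,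
      NormedSpace.exp_zero]
  calc NormedSpace.exp (logOneAdd L N)
      = NormedSpace.exp (logOneAdd L N) * (NormedSpace.exp (-logOneAdd L N) * (1 + N)) := by
        rw [g_one, mul_one]
    _ = 1 + N := by rw [← mul_assoc, inverse, one_mul]

end Derivative

/-! ### Iterated brackets and Dynkin's formula -/

section Words

variable {α : Type*} {s n : ℕ}

/-- The word `x^{p₁} y^{q₁} ⋯ x^{pₙ} y^{qₙ}`. -/
def dynkinWord (x y : α) (p q : Fin n → Fin (s + 1)) : List α :=
  (List.ofFn fun i => List.replicate (p i : ℕ) x ++ List.replicate (q i : ℕ) y).flatten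

theorem length_dynkinWord (x y : α) (p q : Fin n → Fin (s + 1)) :
    (dynkinWord x y p q).length = ∑ i, ((p i : ℕ) + (q i : ℕ)) := by
  simp [dynkinWord, List.length_flatten, List.map_ofFn, List.sum_ofFn]

theorem dynkinWord_map {β : Type*} (f : α → β) (x y : α) (p q : Fin n → Fin (s + 1)) :
    (dynkinWord x y p q).map f = dynkinWord (f x) (f y) p q := by
  simp [dynkinWord, List.map_flatten, List.map_ofFn, Function.comp_def]

theorem mem_dynkinWord {x y : α} {p q : Fin n → Fin (s + 1)} {a : α}
    (h : a ∈ dynkinWord x y p q) : a = x ∨ a = y := by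
  simp only [dynkinWord, List.mem_flatten, List.mem_ofFn] at h
  obtain ⟨l, ⟨i, rfl⟩, hl⟩ := h
  simp only [List.mem_append, List.mem_replicate] at hl
  tauto

theorem dynkinWord_cons (x y : α) (a b : Fin (s + 1)) (p q : Fin n → Fin (s + 1)) :
    dynkinWord x y (Fin.cons a p : Fin (n + 1) → Fin (s + 1)) (Fin.cons b q) =
      List.replicate (a : ℕ) x ++ (List.replicate (b : ℕ) y ++ dynkinWord x y p q) := by
  simp [dynkinWord, List.ofFn_succ]

theorem le_length_dynkinWord (x y : α) {p q : Fin n → Fin (s + 1)}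
    (h : ∀ i, 0 < (p i : ℕ) + (q i : ℕ)) : n ≤ (dynkinWord x y p q).length := by
  rw [length_dynkinWord]
  calc n = ∑ _i : Fin n, 1 := by simp
    _ ≤ _ := Finset.sum_le_sum fun i _ => h i

end Words

section IteratedBracket

variable {𝔤 : Type*} [LieRing 𝔤]

theorem iteratedBracket_cons (a : 𝔤) {w : List 𝔤} (hw : w ≠ []) :
    iteratedBracket (a :: w) = ⁅a, iteratedBracket w⁆ := by
  cases w with
  | nil => exact absurd rfl hw
  | cons b w => rfl

theorem iteratedBracket_eq_zero_of_lie_eq_zero {x y : 𝔤} (hxy : ⁅x, y⁆ = 0) (w : List 𝔤)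
    (hw : ∀ a ∈ w, a = x ∨ a = y) (h2 : 2 ≤ w.length) : iteratedBracket w = 0 := by
  induction w with
  | nil => simp at h2
  | cons a w ih =>
    have hw0 : w ≠ [] := by
      rintro rfl
      simp at h2
    rw [iteratedBracket_cons _ hw0]
    by_cases h : 2 ≤ w.length
    · rw [ih (fun b hb => hw b (List.mem_cons_of_mem _ hb)) h, lie_zero]
    · obtain ⟨b, rfl⟩ : ∃ b, w = [b] := by
        rw [← List.length_eq_one_iff]
        have := List.length_pos_iff.2 hw0
        omega
      have hyx : ⁅y, x⁆ = 0 := by rw [← lie_skew, hxy, neg_zero]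
      rcases hw a (by simp) with rfl | rfl <;> rcases hw b (by simp) with rfl | rfl <;>
        simp [iteratedBracket, hxy, hyx]

theorem iteratedBracket_append_replicate (w : List 𝔤) (n : ℕ) (y : 𝔤) :
    iteratedBracket (w ++ List.replicate (n + 2) y) = 0 := by
  induction w with
  | nil =>
    exact iteratedBracket_eq_zero_of_lie_eq_zero (lie_self y) _
      (fun a ha => .inl (List.eq_of_mem_replicate ha)) (by simp)
  | cons a w ih => rw [List.cons_append, iteratedBracket_cons _ (by simp), ih, lie_zero]

variable [LieAlgebra ℝ 𝔤]

theorem iteratedBracket_replicate_append (p : ℕ) (x : 𝔤) {w : List 𝔤} (hw : w ≠ []) :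
    iteratedBracket (List.replicate p x ++ w) =
      ((LieAlgebra.ad ℝ 𝔤 x) ^ p) (iteratedBracket w) := by
  induction p with
  | zero => simp
  | succ p ih =>
    rw [List.replicate_succ, List.cons_append, iteratedBracket_cons _ (by simp [hw]), ih, pow_succ']
    simp

theorem iteratedBracket_map_smul (t : ℝ) (w : List 𝔤) :
    iteratedBracket (w.map (t • ·)) = t ^ w.length • iteratedBracket w := by
  induction w with
  | nil => simp [iteratedBracket]
  | cons a w ih =>
    rcases eq_or_ne w [] with rfl | hw
    · simp [iteratedBracket]
    · rw [List.map_cons, iteratedBracket_cons _ (by simpa using hw), ih, iteratedBracket_cons _ hw,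
        List.length_cons, pow_succ', smul_lie, lie_smul, smul_smul]

theorem map_iteratedBracket {𝔥 : Type*} [LieRing 𝔥] [LieAlgebra ℝ 𝔥] (φ : 𝔤 →ₗ⁅ℝ⁆ 𝔥)
    (w : List 𝔤) : φ (iteratedBracket w) = iteratedBracket (w.map φ) := by
  induction w with
  | nil => simp [iteratedBracket]
  | cons a w ih =>
    rcases eq_or_ne w [] with rfl | hw
    · simp [iteratedBracket]
    · rw [List.map_cons, iteratedBracket_cons a hw, LieHom.map_lie, ih,
        iteratedBracket_cons _ (by simpa using hw)]

theorem bchProduct_eq (s : ℕ) (x y : 𝔤) :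
    bchProduct s x y = ∑ n ∈ Finset.range s, ((-1 : ℝ) ^ n / (n + 1 : ℝ)) •
      ∑ p : Fin (n + 1) → Fin (s + 1), ∑ q : Fin (n + 1) → Fin (s + 1),
        if ∀ i, 0 < (p i : ℕ) + (q i : ℕ) then
          (((dynkinWord x y p q).length : ℝ) *
            ((∏ i, ((p i : ℕ).factorial * (q i : ℕ).factorial) : ℕ) : ℝ))⁻¹ •
          iteratedBracket (dynkinWord x y p q)
        else 0 := by
  unfold bchProduct
  rw [Finset.range_eq_Ico, Finset.sum_Ico_eq_sum_range, ← Finset.Ico_succ_right_eq_Icc,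
    Finset.sum_Ico_eq_sum_range]
  simp only [Nat.succ_eq_succ, Nat.succ_eq_add_one, Nat.add_sub_cancel, Nat.sub_zero]
  refine Finset.sum_congr rfl fun n _ => ?_
  simp only [length_dynkinWord]
  rw [Nat.zero_add, Nat.add_comm 1 n]
  simp [dynkinWord]

theorem map_bchProduct {𝔥 : Type*} [LieRing 𝔥] [LieAlgebra ℝ 𝔥] (φ : 𝔤 →ₗ⁅ℝ⁆ 𝔥) (s : ℕ) (x y : 𝔤) :
    φ (bchProduct s x y) = bchProduct s (φ x) (φ y) := by
  have map_smul (c : ℝ) (z : 𝔤) : φ (c • z) = c • φ z := φ.map_smul c z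
  simp only [bchProduct_eq, map_sum, map_smul]
  refine Finset.sum_congr rfl fun n _ => congrArg _ (Finset.sum_congr rfl fun p _ =>
    Finset.sum_congr rfl fun q _ => ?_)
  split_ifs
  · rw [map_smul, map_iteratedBracket, dynkinWord_map, length_dynkinWord, length_dynkinWord]
  · exact map_zero φ

end IteratedBracket

section TruncatedExp

theorem hasDerivAt_sum_pow_div_factorial {A : Type*} [NormedAddCommGroup A] [NormedSpace ℝ A]
    (z : ℕ → A) (n : ℕ) (t : ℝ) :
    HasDerivAt (fun τ : ℝ => ∑ k ∈ Finset.range (n + 1), (τ ^ k * (k.factorial : ℝ)⁻¹) • z k)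
      (∑ k ∈ Finset.range n, (t ^ k * (k.factorial : ℝ)⁻¹) • z (k + 1)) t := by
  simp only [Finset.sum_range_succ' _ n, pow_zero]
  refine HasDerivAt.add_const _ (HasDerivAt.fun_sum fun k _ => ?_)
  refine (((hasDerivAt_pow (k + 1) t).mul_const
    (((k + 1).factorial : ℝ)⁻¹)).smul_const (z (k + 1))).congr_deriv ?_
  congr 1
  rw [Nat.factorial_succ]
  push_cast
  field_simp

variable {A : Type*} [NormedRing A] [NormedAlgebra ℝ A] [CompleteSpace A]

/-- This is `e^{t ad a} z₀ = e^{ta} z₀ e^{-ta}`, for `z k = (ad a)^k z₀`. -/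
theorem sum_pow_div_factorial_mul_exp {a : A} {z : ℕ → A}
    (hz : ∀ k, a * z k - z k * a = z (k + 1)) {n : ℕ} (hn : z (n + 1) = 0) (t : ℝ) :
    (∑ k ∈ Finset.range (n + 1), (t ^ k * (k.factorial : ℝ)⁻¹) • z k) * NormedSpace.exp (t • a) =
      NormedSpace.exp (t • a) * z 0 := by
  let _ : NormedAlgebra ℚ A := .restrictScalars ℚ ℝ A
  set S : ℝ → A := fun τ => ∑ k ∈ Finset.range (n + 1), (τ ^ k * (k.factorial : ℝ)⁻¹) • z k with hS
  have deriv_S (τ : ℝ) : HasDerivAt S (a * S τ - S τ * a) τ := by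
    refine (hasDerivAt_sum_pow_div_factorial z n τ).congr_deriv ?_
    simp only [hS, Finset.mul_sum, Finset.sum_mul, ← Finset.sum_sub_distrib, mul_smul_comm,
      smul_mul_assoc, ← smul_sub, hz]
    rw [Finset.sum_range_succ _ n, hn, smul_zero, add_zero]
  have exp_mul_exp_neg : NormedSpace.exp (t • a) * NormedSpace.exp (-t • a) = 1 := by
    rw [neg_smul, ← NormedSpace.exp_add_of_commute (Commute.refl _).neg_right, add_neg_cancel,
      NormedSpace.exp_zero]
  set g : ℝ → A := fun τ => NormedSpace.exp (-τ • a) * (S τ * NormedSpace.exp (τ • a)) with hg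
  have deriv_g (τ : ℝ) : HasDerivAt g 0 τ := by
    have deriv_exp_neg : HasDerivAt (fun τ : ℝ => NormedSpace.exp (-τ • a))
        (NormedSpace.exp (-τ • a) * (-a)) τ := by
      simpa only [smul_neg, neg_smul] using hasDerivAt_exp_smul_const (𝕂 := ℝ) (-a) τ
    refine (deriv_exp_neg.mul
      ((deriv_S τ).fun_mul (hasDerivAt_exp_smul_const' (𝕂 := ℝ) a τ))).congr_deriv ?_
    noncomm_ring
  have S_zero : S 0 = z 0 := by
    simp [hS, Finset.sum_range_succ']
  have g_eq : g t = z 0 := by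
    rw [is_const_of_deriv_eq_zero (fun τ => (deriv_g τ).differentiableAt)
      (fun τ => (deriv_g τ).deriv) t 0]
    simp [hg, S_zero]
  rw [← g_eq, ← mul_assoc, exp_mul_exp_neg, one_mul]

end TruncatedExp

section Dynkin

variable {𝔤 : Type*} [LieRing 𝔤] [LieAlgebra ℝ 𝔤]

theorem ad_pow_eq_zero_of_iteratedBracket {s : ℕ}
    (hs : ∀ w : List 𝔤, s < w.length → iteratedBracket w = 0) (x z : 𝔤) {k : ℕ} (hk : s ≤ k) :
    ((LieAlgebra.ad ℝ 𝔤 x) ^ k) z = 0 := by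
  have replicate_bracket := iteratedBracket_replicate_append k x (w := [z]) (by simp)
  rw [hs _ (by simp; omega)] at replicate_bracket
  simpa [iteratedBracket] using replicate_bracket.symm

/-- The operator `e^{t ad x}`, as a series truncated at the power `s` of `ad x`. -/
def expAd (s : ℕ) (t : ℝ) (x : 𝔤) : 𝔤 →ₗ[ℝ] 𝔤 :=
  ∑ k ∈ Finset.range (s + 1), (t ^ k * (k.factorial : ℝ)⁻¹) • (LieAlgebra.ad ℝ 𝔤 x) ^ k

theorem expAd_apply (s : ℕ) (t : ℝ) (x z : 𝔤) : expAd s t x z =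
    ∑ k ∈ Finset.range (s + 1), (t ^ k * (k.factorial : ℝ)⁻¹) • ((LieAlgebra.ad ℝ 𝔤 x) ^ k) z := by
  simp [expAd, LinearMap.sum_apply]

/-- The operator `e^{t ad x} e^{t ad y} - 1`, written as the sum of its nonconstant terms. -/
def dynkinStep (s : ℕ) (t : ℝ) (x y : 𝔤) : 𝔤 →ₗ[ℝ] 𝔤 :=
  ∑ a : Fin (s + 1), ∑ b : Fin (s + 1), if 0 < (a : ℕ) + (b : ℕ) then
    (t ^ ((a : ℕ) + (b : ℕ)) * (((a : ℕ).factorial * (b : ℕ).factorial : ℕ) : ℝ)⁻¹) •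
      ((LieAlgebra.ad ℝ 𝔤 x) ^ (a : ℕ) * (LieAlgebra.ad ℝ 𝔤 y) ^ (b : ℕ)) else 0

theorem dynkinStep_eq (s : ℕ) (t : ℝ) (x y : 𝔤) :
    dynkinStep s t x y = expAd s t x * expAd s t y - 1 := by
  have one_eq : (1 : Module.End ℝ 𝔤) =
      ∑ a : Fin (s + 1), ∑ b : Fin (s + 1), if a = 0 ∧ b = 0 then 1 else 0 := by
    simp [ite_and]
  rw [one_eq, dynkinStep, expAd, expAd, Finset.sum_mul_sum, Finset.sum_range,
    ← Finset.sum_sub_distrib]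
  refine Finset.sum_congr rfl fun a _ => ?_
  rw [Finset.sum_range, ← Finset.sum_sub_distrib]
  refine Finset.sum_congr rfl fun b _ => ?_
  by_cases h : a = 0 ∧ b = 0
  · simp [h.1, h.2]
  · have pos : 0 < (a : ℕ) + (b : ℕ) := by
      by_contra hab
      exact h ⟨Fin.val_eq_zero_iff.1 (by omega), Fin.val_eq_zero_iff.1 (by omega)⟩
    rw [if_pos pos, if_neg h, sub_zero, smul_mul_smul_comm]
    congr 1
    push_cast
    rw [mul_inv, pow_add]
    ring

/-- The terms of Dynkin's series of `t x`, `t y` with `n + 1` blocks, differentiated in `t`. -/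
def dynkinSum (s n : ℕ) (t : ℝ) (x y : 𝔤) : 𝔤 :=
  ∑ p : Fin (n + 1) → Fin (s + 1), ∑ q : Fin (n + 1) → Fin (s + 1),
    if ∀ i, 0 < (p i : ℕ) + (q i : ℕ) then
      (t ^ ((dynkinWord x y p q).length - 1) *
        ((∏ i, ((p i : ℕ).factorial * (q i : ℕ).factorial) : ℕ) : ℝ)⁻¹) •
        iteratedBracket (dynkinWord x y p q)
    else 0

theorem dynkinSum_succ (s n : ℕ) (t : ℝ) (x y : 𝔤) :
    dynkinSum s (n + 1) t x y = dynkinStep s t x y (dynkinSum s n t x y) := by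
  unfold dynkinSum
  rw [← (Fin.consEquiv fun _ : Fin (n + 1 + 1) => Fin (s + 1)).sum_comp, Fintype.sum_prod_type]
  simp only [← (Fin.consEquiv fun _ : Fin (n + 1 + 1) => Fin (s + 1)).sum_comp,
    Fintype.sum_prod_type, dynkinStep, LinearMap.sum_apply]
  refine Finset.sum_congr rfl fun a _ => ?_
  rw [Finset.sum_comm]
  refine Finset.sum_congr rfl fun b _ => ?_
  simp only [map_sum]
  refine Finset.sum_congr rfl fun p _ => Finset.sum_congr rfl fun q _ => ?_
  simp only [Fin.consEquiv, Equiv.coe_fn_mk, Fin.forall_fin_succ (n := n + 1), Fin.cons_zero,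
    Fin.cons_succ, Fin.prod_univ_succ (n := n + 1)]
  by_cases hab : 0 < (a : ℕ) + (b : ℕ)
  swap
  · simp [hab]
  by_cases hpq : ∀ i, 0 < (p i : ℕ) + (q i : ℕ)
  swap
  · rw [if_neg (fun h => hpq h.2), if_neg hpq, map_zero]
  have len := le_length_dynkinWord x y hpq
  have ne : dynkinWord x y p q ≠ [] := List.length_pos_iff.1 (by omega)
  rw [if_pos ⟨hab, hpq⟩, if_pos hab, if_pos hpq, dynkinWord_cons,
    iteratedBracket_replicate_append _ _ (by simp [ne]), iteratedBracket_replicate_append _ _ ne,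
    LinearMap.smul_apply, map_smul, smul_smul, Module.End.mul_apply]
  congr 1
  rw [List.length_append, List.length_append, List.length_replicate, List.length_replicate,
    ← add_assoc, Nat.add_sub_assoc (by omega), pow_add]
  push_cast
  rw [mul_inv ((_ : ℝ) * _)]
  ring

theorem dynkinSum_zero_term (t : ℝ) (x y : 𝔤) (p q : ℕ) :
    (if 0 < p + q then (t ^ (p + q - 1) * ((p.factorial * q.factorial : ℕ) : ℝ)⁻¹) •
      iteratedBracket (List.replicate p x ++ List.replicate q y) else 0) =
    (if p = 1 then if q = 0 then x else 0 else 0) +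
      if q = 1 then (t ^ p * (p.factorial : ℝ)⁻¹) • ((LieAlgebra.ad ℝ 𝔤 x) ^ p) y else 0 := by
  rcases q with _ | _ | q
  · rcases p with _ | _ | p
    · simp
    · simp [iteratedBracket]
    · simpa using Or.inr (iteratedBracket_append_replicate [] p x)
  · simp [iteratedBracket_replicate_append, iteratedBracket]
  · simp [iteratedBracket_append_replicate]

theorem dynkinSum_zero {s : ℕ} (hs : 1 ≤ s) (t : ℝ) (x y : 𝔤) :
    dynkinSum s 0 t x y = x + expAd s t x y := by
  calc dynkinSum s 0 t x y
      = ∑ p : Fin (s + 1), ∑ q : Fin (s + 1), if 0 < (p : ℕ) + (q : ℕ) then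
          (t ^ ((p : ℕ) + (q : ℕ) - 1) * (((p : ℕ).factorial * (q : ℕ).factorial : ℕ) : ℝ)⁻¹) •
            iteratedBracket (List.replicate (p : ℕ) x ++ List.replicate (q : ℕ) y) else 0 := by
        unfold dynkinSum
        rw [← (Equiv.funUnique (Fin 1) (Fin (s + 1))).symm.sum_comp]
        simp only [← (Equiv.funUnique (Fin 1) (Fin (s + 1))).symm.sum_comp]
        simp [dynkinWord]
    _ = ∑ p ∈ Finset.range (s + 1), ∑ q ∈ Finset.range (s + 1),
          ((if p = 1 then if q = 0 then x else 0 else 0) +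
            if q = 1 then
              (t ^ p * (p.factorial : ℝ)⁻¹) • ((LieAlgebra.ad ℝ 𝔤 x) ^ p) y else 0) := by
        simp only [dynkinSum_zero_term, Finset.sum_range]
    _ = x + expAd s t x y := by
        simp only [Finset.sum_add_distrib, Finset.sum_ite_eq', expAd_apply, Finset.mem_range]
        rw [Finset.sum_congr rfl fun p _ => if_pos (show 1 < s + 1 by omega)]
        congr 1
        rw [Finset.sum_eq_single_of_mem 1 (Finset.mem_range.2 (by omega))
          (fun p _ hp => by simp [hp])]
        simp

theorem dynkinSum_eq_zero {s : ℕ} (hs : ∀ w : List 𝔤, s < w.length → iteratedBracket w = 0)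
    {n : ℕ} (hn : s ≤ n) (t : ℝ) (x y : 𝔤) : dynkinSum s n t x y = 0 := by
  refine Finset.sum_eq_zero fun p _ => Finset.sum_eq_zero fun q _ => ?_
  split_ifs with h
  · have len := le_length_dynkinWord x y h
    rw [hs _ (by omega), smul_zero]
  · rfl

/-- A bracket of length at least two vanishes here, so the factor `1 / |w|` of the
Baker-Campbell-Hausdorff series is absent. -/
theorem bchProduct_eq_sum_dynkinSum {x y : 𝔤} (hxy : ⁅x, y⁆ = 0) (s : ℕ) :
    bchProduct s x y =
      ∑ n ∈ Finset.range s, ((-1 : ℝ) ^ n / (n + 1 : ℝ)) • dynkinSum s n 1 x y := by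
  rw [bchProduct_eq]
  refine Finset.sum_congr rfl fun n _ => congrArg _ (Finset.sum_congr rfl fun p _ =>
    Finset.sum_congr rfl fun q _ => ?_)
  split_ifs with h
  · have len := le_length_dynkinWord x y h
    rcases (by omega : 2 ≤ (dynkinWord x y p q).length ∨ (dynkinWord x y p q).length = 1) with
      two_le | eq_one
    · simp [iteratedBracket_eq_zero_of_lie_eq_zero hxy _ (fun _ => mem_dynkinWord) two_le]
    · simp [eq_one]
  · rfl

theorem bchProduct_of_lie_eq_zero {s : ℕ} (hs : 1 ≤ s) {x y : 𝔤} (hxy : ⁅x, y⁆ = 0) :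
    bchProduct s x y = x + y := by
  obtain ⟨r, rfl⟩ : ∃ r, s = r + 1 := ⟨s - 1, by omega⟩
  have expAd_eq : expAd (r + 1) 1 x y = y := by
    simp [expAd_apply, Finset.sum_range_succ', pow_succ, hxy]
  have higher (n : ℕ) : dynkinSum (r + 1) (n + 1) 1 x y = 0 := by
    refine Finset.sum_eq_zero fun p _ => Finset.sum_eq_zero fun q _ => ?_
    split_ifs with h
    · have len := le_length_dynkinWord x y h
      rw [iteratedBracket_eq_zero_of_lie_eq_zero hxy _ (fun _ => mem_dynkinWord) (by omega),
        smul_zero]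
    · rfl
  rw [bchProduct_eq_sum_dynkinSum hxy, Finset.sum_range_succ', dynkinSum_zero hs, expAd_eq]
  simp [higher]

theorem bchProduct_sub_add_mem {s : ℕ} (hs : 1 ≤ s) (I : LieIdeal ℝ 𝔤) {x y : 𝔤}
    (hxy : ⁅x, y⁆ ∈ I) : bchProduct s x y - (x + y) ∈ I := by
  let π : 𝔤 →ₗ⁅ℝ⁆ 𝔤 ⧸ I :=
    { (LieSubmodule.Quotient.mk' I : 𝔤 →ₗ[ℝ] 𝔤 ⧸ I) with
      map_lie' := rfl }
  have ker (z : 𝔤) : π z = 0 ↔ z ∈ I := LieSubmodule.Quotient.mk_eq_zero I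
  have comm : ⁅π x, π y⁆ = 0 := by rw [← π.map_lie, ker]; exact hxy
  rw [← ker, map_sub, map_bchProduct, bchProduct_of_lie_eq_zero hs comm, map_add, sub_self]

variable {A : Type*} [NormedRing A] [NormedAlgebra ℝ A]

theorem hasDerivAt_map_bchProduct (ρ : 𝔤 →ₗ[ℝ] A) (s : ℕ) (t : ℝ) (x y : 𝔤) :
    HasDerivAt (fun τ : ℝ => ρ (bchProduct s (τ • x) (τ • y)))
      (∑ n ∈ Finset.range s, ((-1 : ℝ) ^ n / (n + 1 : ℝ)) • ρ (dynkinSum s n t x y)) t := by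
  simp only [bchProduct_eq, map_sum, map_smul, dynkinSum]
  refine HasDerivAt.fun_sum fun n _ => HasDerivAt.fun_const_smul _ <| HasDerivAt.fun_sum fun p _ =>
    HasDerivAt.fun_sum fun q _ => ?_
  split_ifs with h
  · have len := le_length_dynkinWord x y h
    have homogeneous (τ : ℝ) : iteratedBracket (dynkinWord (τ • x) (τ • y) p q) =
        τ ^ (dynkinWord x y p q).length • iteratedBracket (dynkinWord x y p q) := by
      rw [← dynkinWord_map (τ • ·) x y, iteratedBracket_map_smul]
    have length_eq (τ : ℝ) : (dynkinWord (τ • x) (τ • y) p q).length =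
        (dynkinWord x y p q).length := by rw [length_dynkinWord, length_dynkinWord]
    simp only [homogeneous, length_eq, map_smul]
    refine HasDerivAt.congr_deriv (HasDerivAt.fun_const_smul (𝕜 := ℝ) _ ((hasDerivAt_pow
      (dynkinWord x y p q).length t).smul_const (ρ (iteratedBracket (dynkinWord x y p q))))) ?_
    have ne : ((dynkinWord x y p q).length : ℝ) ≠ 0 := by
      exact_mod_cast (by omega : (dynkinWord x y p q).length ≠ 0)
    rw [smul_smul, mul_inv]
    congr 1
    field_simp
  · simpa using hasDerivAt_const t (0 : A)

variable (ρ : 𝔤 →ₗ[ℝ] A) (hρ : ∀ x y, ρ ⁅x, y⁆ = ρ x * ρ y - ρ y * ρ x)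

variable [CompleteSpace A] {s : ℕ} (hs : ∀ w : List 𝔤, s < w.length → iteratedBracket w = 0)

include hρ hs

theorem map_expAd_mul_exp (t : ℝ) (x z : 𝔤) :
    ρ (expAd s t x z) * NormedSpace.exp (t • ρ x) = NormedSpace.exp (t • ρ x) * ρ z := by
  have conj := sum_pow_div_factorial_mul_exp (a := ρ x)
    (z := fun k => ρ (((LieAlgebra.ad ℝ 𝔤 x) ^ k) z))
    (fun k => by rw [pow_succ', Module.End.mul_apply, LieAlgebra.ad_apply, hρ]) (n := s)
    (by rw [ad_pow_eq_zero_of_iteratedBracket hs x z (by omega), map_zero]) t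
  simpa [expAd_apply, map_sum, map_smul] using conj

theorem hasDerivAt_exp_mul_exp_sub_one (h1s : 1 ≤ s) (x y : 𝔤) (t : ℝ) :
    HasDerivAt (fun t : ℝ => NormedSpace.exp (t • ρ x) * NormedSpace.exp (t • ρ y) - 1)
      (ρ (dynkinSum s 0 t x y) *
        (NormedSpace.exp (t • ρ x) * NormedSpace.exp (t • ρ y))) t := by
  refine (((hasDerivAt_exp_smul_const' (𝕂 := ℝ) (ρ x) t).mul
    (hasDerivAt_exp_smul_const' (𝕂 := ℝ) (ρ y) t)).sub_const 1).congr_deriv ?_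
  rw [dynkinSum_zero h1s, map_add, add_mul, ← mul_assoc (ρ (expAd s t x y)),
    map_expAd_mul_exp ρ hρ hs]
  noncomm_ring

theorem map_dynkinStep_mul_exp_mul_exp (x y z : 𝔤) (t : ℝ) :
    ρ (dynkinStep s t x y z) * (NormedSpace.exp (t • ρ x) * NormedSpace.exp (t • ρ y)) =
      NormedSpace.exp (t • ρ x) * NormedSpace.exp (t • ρ y) * ρ z -
        ρ z * (NormedSpace.exp (t • ρ x) * NormedSpace.exp (t • ρ y)) := by
  rw [dynkinStep_eq, LinearMap.sub_apply, Module.End.mul_apply, Module.End.one_apply, map_sub,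
    sub_mul, ← mul_assoc, map_expAd_mul_exp ρ hρ hs, mul_assoc, map_expAd_mul_exp ρ hρ hs,
    mul_assoc]

theorem map_bchProduct_eq_log (h1s : 1 ≤ s) {x y : 𝔤} {K L : ℕ}
    (hK : ∀ t : ℝ, (NormedSpace.exp (t • ρ x) * NormedSpace.exp (t • ρ y) - 1) ^ K = 0)
    (hL : s + K ≤ L) :
    ρ (bchProduct s x y) = logOneAdd L (NormedSpace.exp (ρ x) * NormedSpace.exp (ρ y) - 1) := by
  set N : ℝ → A := fun t => NormedSpace.exp (t • ρ x) * NormedSpace.exp (t • ρ y) - 1 with hN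
  have one_add_N (t : ℝ) : 1 + N t = NormedSpace.exp (t • ρ x) * NormedSpace.exp (t • ρ y) :=
    add_sub_cancel _ _
  have deriv_log (t : ℝ) : HasDerivAt (fun τ => logOneAdd L (N τ))
      (∑ n ∈ Finset.range s, ((-1 : ℝ) ^ n / (n + 1 : ℝ)) • ρ (dynkinSum s n t x y)) t := by
    refine hasDerivAt_logOneAdd_of_commutator (c := fun n => ρ (dynkinSum s n t x y)) ?_ ?_ (hK t)
      (fun k hk => by rw [dynkinSum_eq_zero hs hk, map_zero]) hL
    · rw [one_add_N]
      exact hasDerivAt_exp_mul_exp_sub_one ρ hρ hs h1s x y t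
    · intro k
      rw [one_add_N, dynkinSum_succ, map_dynkinStep_mul_exp_mul_exp ρ hρ hs, ← one_add_N]
      noncomm_ring
  have deriv_sub (t : ℝ) :
      HasDerivAt (fun τ => logOneAdd L (N τ) - ρ (bchProduct s (τ • x) (τ • y))) 0 t :=
    ((deriv_log t).sub (hasDerivAt_map_bchProduct ρ s t x y)).congr_deriv (sub_self _)
  have const := is_const_of_deriv_eq_zero (fun τ => (deriv_sub τ).differentiableAt)
    (fun τ => (deriv_sub τ).deriv) 1 0
  have bch_zero : bchProduct s (0 : 𝔤) 0 = 0 := by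
    rw [bchProduct_of_lie_eq_zero h1s (by simp), add_zero]
  rw [eq_comm, ← sub_eq_zero]
  simpa [hN, bch_zero, logOneAdd] using const

theorem exp_map_bchProduct (h1s : 1 ≤ s) {x y : 𝔤} {K : ℕ}
    (hK : ∀ t : ℝ, (NormedSpace.exp (t • ρ x) * NormedSpace.exp (t • ρ y) - 1) ^ K = 0) :
    NormedSpace.exp (ρ (bchProduct s x y)) = NormedSpace.exp (ρ x) * NormedSpace.exp (ρ y) := by
  rw [map_bchProduct_eq_log ρ hρ hs h1s hK le_rfl, exp_logOneAdd, add_sub_cancel]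
  exact pow_eq_zero_of_le (show K ≤ s + K + 1 by omega) (by simpa using hK 1)

end Dynkin

/-! ### The grading of the Lie algebra -/

namespace CarnotGroup

variable {𝔤 : Type*} [LieRing 𝔤] [LieAlgebra ℝ 𝔤] {s : ℕ} {m : Fin s → ℕ}
  (G : CarnotGroup 𝔤 s m)

/-- The elements of degree `k`: this is `V_k` for `1 ≤ k ≤ s` and zero for other `k`. -/
def homogeneous (k : ℕ) : Submodule ℝ 𝔤 where
  carrier := {z | ∀ j : Σ l : Fin s, Fin (m l), (j.1 : ℕ) + 1 ≠ k → G.toLie.symm z j = 0}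
  add_mem' hx hy j hj := by simp [hx j hj, hy j hj]
  zero_mem' j _ := by simp
  smul_mem' c x hx j hj := by simp [hx j hj]

/-- The sum of the layers `V_l` with `l ≥ k`. -/
def filtration (k : ℕ) : Submodule ℝ 𝔤 where
  carrier := {z | ∀ j : Σ l : Fin s, Fin (m l), (j.1 : ℕ) + 1 < k → G.toLie.symm z j = 0}
  add_mem' hx hy j hj := by simp [hx j hj, hy j hj]
  zero_mem' j _ := by simp
  smul_mem' c x hx j hj := by simp [hx j hj]

theorem homogeneous_succ (l : Fin s) : G.homogeneous (l + 1) = G.layer (l + 1) := by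
  ext z
  constructor
  · intro hz
    have expansion : z = ∑ j, G.toLie.symm z j • G.isInternal.collectedBasis G.basis j := by
      conv_lhs => rw [← G.toLie.apply_symm_apply z]
      rw [toLie, Module.Basis.equivFun_symm_apply]
    rw [expansion]
    refine Submodule.sum_mem _ fun j _ => ?_
    by_cases hj : j.1 = l
    · obtain ⟨l', i⟩ := j
      simp only at hj
      subst hj
      exact Submodule.smul_mem _ _ (G.isInternal.collectedBasis_mem G.basis ⟨l', i⟩)
    · rw [hz j (fun h => hj (Fin.ext (by omega))), zero_smul]
      exact Submodule.zero_mem _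
  · intro hz j hj
    have l_ne : l ≠ j.1 := fun h => hj (by rw [h])
    exact G.isInternal.collectedBasis_repr_of_mem_ne G.basis l_ne (a := j.2) hz

theorem homogeneous_eq_layer {k : ℕ} (h1 : 1 ≤ k) (hs : k ≤ s) : G.homogeneous k = G.layer k := by
  have := G.homogeneous_succ ⟨k - 1, by omega⟩
  simpa [Nat.sub_add_cancel h1] using this

theorem eq_zero_of_mem_homogeneous {k : ℕ} (hk : k = 0 ∨ s < k) {z : 𝔤}
    (hz : z ∈ G.homogeneous k) : z = 0 := by
  rw [← G.toLie.symm.map_eq_zero_iff]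
  ext j
  exact hz j (by have := j.1.2; omega)

theorem lie_mem_homogeneous_succ {x y : 𝔤} {k : ℕ} (hx : x ∈ G.homogeneous 1)
    (hy : y ∈ G.homogeneous k) : ⁅x, y⁆ ∈ G.homogeneous (k + 1) := by
  have h1s := G.one_le_step
  by_cases hk : k = 0 ∨ s < k
  · rw [G.eq_zero_of_mem_homogeneous hk hy, lie_zero]
    exact Submodule.zero_mem _
  · have hk1 : 1 ≤ k := by omega
    rw [G.homogeneous_eq_layer le_rfl h1s] at hx
    rw [G.homogeneous_eq_layer hk1 (by omega)] at hy
    by_cases hks : k = s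
    · subst hks
      rw [G.bracket_top x hx y hy]
      exact Submodule.zero_mem _
    · rw [G.homogeneous_eq_layer (by omega) (by omega), ← G.bracket_layer k hk1 (by omega)]
      exact Submodule.subset_span ⟨x, hx, y, hy, rfl⟩

theorem homogeneous_succ_induction {k : ℕ} (hk : 1 ≤ k) {p : 𝔤 → Prop}
    (lie : ∀ x ∈ G.homogeneous 1, ∀ y ∈ G.homogeneous k, p ⁅x, y⁆)
    (zero : p 0) (add : ∀ x y, p x → p y → p (x + y)) {z : 𝔤}
    (hz : z ∈ G.homogeneous (k + 1)) : p z := by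
  by_cases hks : s < k + 1
  · rw [G.eq_zero_of_mem_homogeneous (Or.inr hks) hz]
    exact zero
  · rw [G.homogeneous_eq_layer (by omega) (by omega), ← G.bracket_layer k hk (by omega)] at hz
    suffices closed_under_smul : ∀ c : ℝ, p (c • z) by simpa using closed_under_smul 1
    induction hz using Submodule.span_induction with
    | mem z hz =>
      obtain ⟨x, hx, y, hy, rfl⟩ := hz
      intro c
      rw [← smul_lie]
      rw [← G.homogeneous_eq_layer le_rfl G.one_le_step] at hx
      rw [← G.homogeneous_eq_layer hk (by omega)] at hy
      exact lie _ (Submodule.smul_mem _ _ hx) _ hy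
    | zero => simpa using zero
    | add x y _ _ hx hy => intro c; rw [smul_add]; exact add _ _ (hx c) (hy c)
    | smul a x _ hx => intro c; rw [smul_smul]; exact hx _

theorem lie_mem_homogeneous {i j : ℕ} {x y : 𝔤} (hx : x ∈ G.homogeneous i)
    (hy : y ∈ G.homogeneous j) : ⁅x, y⁆ ∈ G.homogeneous (i + j) := by
  induction i generalizing x y j with
  | zero =>
    rw [G.eq_zero_of_mem_homogeneous (Or.inl rfl) hx, zero_lie]
    exact Submodule.zero_mem _
  | succ i ih =>
    rcases i with _ | i
    · rw [show 0 + 1 + j = j + 1 by omega]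
      exact G.lie_mem_homogeneous_succ hx hy
    · refine G.homogeneous_succ_induction (k := i + 1) (by omega)
        (p := fun x => ⁅x, y⁆ ∈ G.homogeneous (i + 1 + 1 + j)) ?_ ?_ ?_ hx
      · intro a ha b hb
        rw [lie_lie]
        refine Submodule.sub_mem _ ?_ ?_
        · have := G.lie_mem_homogeneous_succ ha (ih hb hy)
          rwa [show i + 1 + 1 + j = i + 1 + j + 1 by omega]
        · have := ih hb (G.lie_mem_homogeneous_succ ha hy)
          rwa [show i + 1 + 1 + j = i + 1 + (j + 1) by omega]
      · simp
      · intro a b ha hb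
        rw [add_lie]
        exact Submodule.add_mem _ ha hb

/-- The linear map that acts on `V_k` as multiplication by `w k`. -/
def weightMap (w : ℕ → ℝ) : 𝔤 →ₗ[ℝ] 𝔤 :=
  G.toLie.toLinearMap ∘ₗ
    LinearMap.pi (fun j => w ((j.1 : ℕ) + 1) • LinearMap.proj (R := ℝ) (φ := fun _ => ℝ) j) ∘ₗ
      G.toLie.symm.toLinearMap

theorem toLie_symm_weightMap (w : ℕ → ℝ) (z : 𝔤) (j : Σ l : Fin s, Fin (m l)) :
    G.toLie.symm (G.weightMap w z) j = w ((j.1 : ℕ) + 1) * G.toLie.symm z j := by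
  simp [weightMap]

theorem weightMap_of_mem (w : ℕ → ℝ) {k : ℕ} {z : 𝔤} (hz : z ∈ G.homogeneous k) :
    G.weightMap w z = w k • z := by
  apply G.toLie.symm.injective
  ext j
  rw [toLie_symm_weightMap, map_smul, Pi.smul_apply, smul_eq_mul]
  by_cases h : (j.1 : ℕ) + 1 = k
  · rw [h]
  · rw [hz j h, mul_zero, mul_zero]

/-- The component of degree `k`. -/
def component (k : ℕ) : 𝔤 →ₗ[ℝ] 𝔤 := G.weightMap (Pi.single k 1)

theorem toLie_symm_component (k : ℕ) (z : 𝔤) (j : Σ l : Fin s, Fin (m l)) :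
    G.toLie.symm (G.component k z) j = if (j.1 : ℕ) + 1 = k then G.toLie.symm z j else 0 := by
  rw [component, toLie_symm_weightMap, Pi.single_apply]
  split_ifs <;> simp

theorem component_mem (k : ℕ) (z : 𝔤) : G.component k z ∈ G.homogeneous k := by
  intro j hj
  rw [toLie_symm_component, if_neg hj]

theorem sum_component (z : 𝔤) : ∑ k ∈ Finset.range (s + 1), G.component k z = z := by
  apply G.toLie.symm.injective
  ext j
  rw [map_sum, Finset.sum_apply]
  simp only [toLie_symm_component]
  rw [Finset.sum_ite_eq, if_pos (by simp)]

theorem component_eq_zero {k n : ℕ} (hkn : k < n) {z : 𝔤} (hz : z ∈ G.filtration n) :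
    G.component k z = 0 := by
  apply G.toLie.symm.injective
  ext j
  rw [toLie_symm_component]
  split_ifs with h
  · rw [hz j (by omega)]
    simp
  · simp

theorem homogeneous_induction {p : 𝔤 → Prop} (hom : ∀ k, ∀ z ∈ G.homogeneous k, p z)
    (add : ∀ x y, p x → p y → p (x + y)) (z : 𝔤) : p z := by
  rw [← G.sum_component z]
  refine Finset.sum_induction _ p add (hom 0 _ (Submodule.zero_mem _)) fun k _ =>
    hom k _ (G.component_mem k z)

theorem homogeneous_le_filtration {k n : ℕ} (h : n ≤ k) : G.homogeneous k ≤ G.filtration n :=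
  fun _ hz j hj => hz j (by omega)

theorem filtration_anti {k n : ℕ} (h : n ≤ k) : G.filtration k ≤ G.filtration n :=
  fun _ hz j hj => hz j (by omega)

theorem mem_filtration_one (z : 𝔤) : z ∈ G.filtration 1 := fun j hj => by omega

theorem eq_zero_of_mem_filtration {k : ℕ} (hk : s < k) {z : 𝔤} (hz : z ∈ G.filtration k) :
    z = 0 := by
  rw [← G.toLie.symm.map_eq_zero_iff]
  ext j
  exact hz j (by have := j.1.2; omega)

theorem lie_mem_filtration {i j : ℕ} {x y : 𝔤} (hx : x ∈ G.filtration i)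
    (hy : y ∈ G.filtration j) : ⁅x, y⁆ ∈ G.filtration (i + j) := by
  rw [← G.sum_component x, ← G.sum_component y, sum_lie_sum]
  refine Submodule.sum_mem _ fun a _ => Submodule.sum_mem _ fun b _ => ?_
  by_cases ha : a < i
  · rw [G.component_eq_zero ha hx, zero_lie]
    exact Submodule.zero_mem _
  by_cases hb : b < j
  · rw [G.component_eq_zero hb hy, lie_zero]
    exact Submodule.zero_mem _
  exact G.homogeneous_le_filtration (by omega)
    (G.lie_mem_homogeneous (G.component_mem a x) (G.component_mem b y))

theorem lie_mem_filtration_right {j : ℕ} (x : 𝔤) {y : 𝔤} (hy : y ∈ G.filtration j) :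
    ⁅x, y⁆ ∈ G.filtration (j + 1) := by
  rw [add_comm]
  exact G.lie_mem_filtration (G.mem_filtration_one x) hy

/-- The ideal whose underlying subspace is `G.filtration k`. -/
def filtrationIdeal (k : ℕ) : LieIdeal ℝ 𝔤 :=
  { G.filtration k with
    lie_mem := fun {x _} hy => G.filtration_anti (Nat.le_succ k) (G.lie_mem_filtration_right x hy) }

theorem iteratedBracket_mem_filtration (w : List 𝔤) :
    iteratedBracket w ∈ G.filtration w.length := by
  induction w with
  | nil => simp [iteratedBracket]
  | cons a w ih =>
    rcases eq_or_ne w [] with rfl | hw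
    · simpa [iteratedBracket] using G.mem_filtration_one a
    · rw [iteratedBracket_cons _ hw]
      exact G.lie_mem_filtration_right a ih

theorem iteratedBracket_eq_zero (G : CarnotGroup 𝔤 s m) (w : List 𝔤) (hw : s < w.length) :
    iteratedBracket w = 0 :=
  G.eq_zero_of_mem_filtration hw (G.iteratedBracket_mem_filtration w)

/-- The derivation that acts on `V_k` as multiplication by `k`. -/
def degreeDerivation : 𝔤 →ₗ[ℝ] 𝔤 := G.weightMap fun k => (k : ℝ)

theorem degreeDerivation_lie (x y : 𝔤) : G.degreeDerivation ⁅x, y⁆ =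
    ⁅G.degreeDerivation x, y⁆ + ⁅x, G.degreeDerivation y⁆ := by
  induction x using G.homogeneous_induction with
  | add x x' hx hx' => simp only [add_lie, map_add, hx, hx']; abel
  | hom i x hx =>
    induction y using G.homogeneous_induction with
    | add y y' hy hy' => simp only [lie_add, map_add, hy, hy']; abel
    | hom j y hy =>
      rw [degreeDerivation, G.weightMap_of_mem _ hx, G.weightMap_of_mem _ hy,
        G.weightMap_of_mem _ (G.lie_mem_homogeneous hx hy), smul_lie, lie_smul, ← add_smul]
      push_cast
      rfl

theorem degreeDerivation_injective : Function.Injective G.degreeDerivation := by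
  rw [injective_iff_map_eq_zero]
  intro z hz
  rw [← G.toLie.symm.map_eq_zero_iff]
  ext j
  have eigen : G.toLie.symm (G.degreeDerivation z) j =
      (((j.1 : ℕ) + 1 : ℕ) : ℝ) * G.toLie.symm z j := G.toLie_symm_weightMap _ z j
  rw [hz, map_zero] at eigen
  exact (mul_eq_zero.1 eigen.symm).resolve_left (by positivity)

/-- The dilation by `r`, acting as `r ^ k` on `V_k`, as an endomorphism of the Lie algebra. -/
def dilationLie (r : ℝ) : 𝔤 →ₗ⁅ℝ⁆ 𝔤 where
  toLinearMap := G.weightMap fun k => r ^ k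
  map_lie' := by
    intro x y
    change G.weightMap (fun k => r ^ k) ⁅x, y⁆ =
      ⁅G.weightMap (fun k => r ^ k) x, G.weightMap (fun k => r ^ k) y⁆
    induction x using G.homogeneous_induction with
    | add x x' hx hx' => simp only [add_lie, map_add, hx, hx']
    | hom i x hx =>
      induction y using G.homogeneous_induction with
      | add y y' hy hy' => simp only [lie_add, map_add, hy, hy']
      | hom j y hy =>
        rw [G.weightMap_of_mem _ hx, G.weightMap_of_mem _ hy,
          G.weightMap_of_mem _ (G.lie_mem_homogeneous hx hy), smul_lie, lie_smul, smul_smul,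
          ← pow_add]

theorem toLie_symm_dilationLie (r : ℝ) (z : 𝔤) (j : Σ l : Fin s, Fin (m l)) :
    G.toLie.symm (G.dilationLie r z) j = r ^ ((j.1 : ℕ) + 1) * G.toLie.symm z j :=
  G.toLie_symm_weightMap _ z j

end CarnotGroup

/-! ### A faithful representation and the group law -/

theorem exp_mul_mul_of_mul_eq_one {A : Type*} [NormedRing A] [NormedAlgebra ℝ A] [CompleteSpace A]
    {a b : A} (hab : a * b = 1) (hba : b * a = 1) (x : A) :
    NormedSpace.exp (a * x * b) = a * NormedSpace.exp x * b := by
  let _ : NormedAlgebra ℚ A := .restrictScalars ℚ ℝ A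
  exact NormedSpace.exp_units_conj ⟨a, b, hab, hba⟩ x

namespace CarnotGroup

variable {𝔤 : Type*} [LieRing 𝔤] [LieAlgebra ℝ 𝔤] {s : ℕ} {m : Fin s → ℕ}
  (G : CarnotGroup 𝔤 s m)

/-- The adjoint representation of the extension of `𝔤` by the degree derivation, restricted
to `𝔤`. It is faithful. -/
def rep : 𝔤 →ₗ[ℝ] (Coord m × ℝ →L[ℝ] Coord m × ℝ) :=
  LinearMap.toContinuousLinearMap.toLinearMap ∘ₗ
    LinearMap.mk₂ ℝ (fun x (v : Coord m × ℝ) =>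
      ((G.toLie.symm (⁅x, G.toLie v.1⁆ - v.2 • G.degreeDerivation x), 0) : Coord m × ℝ))
      (by intro x y v; ext1 <;> simp [add_lie]; abel)
      (by intro c x v; ext1 <;> simp [smul_sub, smul_comm c])
      (by intro x v w; ext1 <;> simp [add_smul]; abel)
      (by intro c x v; ext1 <;> simp [smul_sub, mul_smul])

theorem rep_apply (x : 𝔤) (v : Coord m × ℝ) :
    G.rep x v = (G.toLie.symm (⁅x, G.toLie v.1⁆ - v.2 • G.degreeDerivation x), 0) := rfl

theorem rep_lie (x y : 𝔤) : G.rep ⁅x, y⁆ = G.rep x * G.rep y - G.rep y * G.rep x := by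
  refine ContinuousLinearMap.ext fun v => ?_
  simp only [sub_apply, mul_apply_eq_comp, rep_apply]
  ext1
  · apply G.toLie.injective
    simp only [LinearEquiv.apply_symm_apply, Prod.fst_sub, map_sub, zero_smul, sub_zero, lie_sub,
      lie_smul, lie_lie, degreeDerivation_lie, smul_add]
    rw [← lie_skew (G.degreeDerivation x) y, smul_neg]
    abel
  · simp

theorem rep_injective : Function.Injective G.rep := by
  rw [injective_iff_map_eq_zero]
  intro x hx
  have degree_x : (G.rep x (0, 1)).1 = G.toLie.symm (-G.degreeDerivation x) := by
    simp [rep_apply]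
  rw [hx, zero_apply, Prod.fst_zero, eq_comm, LinearEquiv.map_eq_zero_iff, neg_eq_zero] at degree_x
  exact G.degreeDerivation_injective (by rw [degree_x, map_zero])

/-- The flag of subspaces that the representation shifts. -/
def flag (k : ℕ) : Submodule ℝ (Coord m × ℝ) where
  carrier := {v | (1 ≤ k → v.2 = 0) ∧ G.toLie v.1 ∈ G.filtration k}
  add_mem' hv hw := ⟨fun h => by simp [hv.1 h, hw.1 h], by
    simpa using Submodule.add_mem _ hv.2 hw.2⟩
  zero_mem' := ⟨fun _ => rfl, by simp⟩
  smul_mem' c v hv := ⟨fun h => by simp [hv.1 h], by simpa using Submodule.smul_mem _ c hv.2⟩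

theorem mem_flag_zero (v : Coord m × ℝ) : v ∈ G.flag 0 :=
  ⟨fun h => by omega, fun j hj => by omega⟩

theorem eq_zero_of_mem_flag {k : ℕ} (hk : s < k) {v : Coord m × ℝ} (hv : v ∈ G.flag k) :
    v = 0 := by
  ext1
  · have := G.eq_zero_of_mem_filtration hk hv.2
    rwa [LinearEquiv.map_eq_zero_iff] at this
  · exact hv.1 (by omega)

/-- The operators that shift the flag. -/
def shifts : Submodule ℝ (Coord m × ℝ →L[ℝ] Coord m × ℝ) where
  carrier := {T | ∀ k, ∀ v ∈ G.flag k, T v ∈ G.flag (k + 1)}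
  add_mem' hS hT k v hv := Submodule.add_mem _ (hS k v hv) (hT k v hv)
  zero_mem' _ _ _ := Submodule.zero_mem _
  smul_mem' c _ hT k v hv := Submodule.smul_mem _ c (hT k v hv)

variable {G} in
theorem mul_mem_shifts {S T : Coord m × ℝ →L[ℝ] Coord m × ℝ} (hS : S ∈ G.shifts)
    (hT : T ∈ G.shifts) : S * T ∈ G.shifts := by
  intro k v hv
  have shifted := hS _ _ (hT k v hv)
  exact ⟨fun _ => shifted.1 (by omega), G.filtration_anti (by omega) shifted.2⟩

theorem rep_mem_shifts (x : 𝔤) : G.rep x ∈ G.shifts := by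
  intro k v hv
  rw [rep_apply]
  refine ⟨fun _ => rfl, ?_⟩
  rw [LinearEquiv.apply_symm_apply]
  rcases k with _ | k
  · exact G.mem_filtration_one _
  · rw [hv.1 (by omega), zero_smul, sub_zero]
    exact G.lie_mem_filtration_right x hv.2

variable {G} in
theorem pow_eq_zero_of_mem_shifts {T : Coord m × ℝ →L[ℝ] Coord m × ℝ} (hT : T ∈ G.shifts) :
    T ^ (s + 1) = 0 := by
  have pow_mem_flag : ∀ k v, (T ^ k) v ∈ G.flag k := by
    intro k
    induction k with
    | zero => exact fun v => G.mem_flag_zero _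
    | succ k ih =>
      intro v
      rw [pow_succ']
      exact hT k _ (ih v)
  refine ContinuousLinearMap.ext fun v => ?_
  exact G.eq_zero_of_mem_flag (Nat.lt_succ_self s) (pow_mem_flag _ v)

variable {G} in
theorem exp_sub_one_mem_shifts {T : Coord m × ℝ →L[ℝ] Coord m × ℝ} (hT : T ∈ G.shifts) :
    NormedSpace.exp T - 1 ∈ G.shifts := by
  have expansion :
      NormedSpace.exp T = ∑ n ∈ Finset.range (s + 1), ((n.factorial : ℝ)⁻¹) • T ^ n := by
    rw [NormedSpace.exp_eq_tsum ℝ]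
    refine tsum_eq_sum fun n hn => ?_
    rw [pow_eq_zero_of_le (by simpa using hn) (pow_eq_zero_of_mem_shifts hT), smul_zero]
  rw [expansion, Finset.sum_range_succ']
  simp only [pow_zero, Nat.factorial_zero, Nat.cast_one, inv_one, one_smul, add_sub_cancel_right]
  have pow_succ_mem : ∀ n, T ^ (n + 1) ∈ G.shifts := by
    intro n
    induction n with
    | zero => simpa using hT
    | succ n ih =>
      rw [pow_succ]
      exact mul_mem_shifts ih hT
  exact Submodule.sum_mem _ fun n _ => Submodule.smul_mem _ _ (pow_succ_mem n)

theorem exp_rep_mul_exp_rep_pow (x y : 𝔤) (t : ℝ) :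
    (NormedSpace.exp (t • G.rep x) * NormedSpace.exp (t • G.rep y) - 1) ^ (s + 1) = 0 := by
  refine pow_eq_zero_of_mem_shifts (G := G) ?_
  have hx := exp_sub_one_mem_shifts (G := G) (Submodule.smul_mem _ t (G.rep_mem_shifts x))
  have hy := exp_sub_one_mem_shifts (G := G) (Submodule.smul_mem _ t (G.rep_mem_shifts y))
  have decomposition : NormedSpace.exp (t • G.rep x) * NormedSpace.exp (t • G.rep y) - 1 =
      (NormedSpace.exp (t • G.rep x) - 1) * (NormedSpace.exp (t • G.rep y) - 1) +
      (NormedSpace.exp (t • G.rep x) - 1) + (NormedSpace.exp (t • G.rep y) - 1) := by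
    simp only [mul_sub, sub_mul, mul_one, one_mul]
    abel
  rw [decomposition]
  exact Submodule.add_mem _ (Submodule.add_mem _ (mul_mem_shifts hx hy) hx) hy

theorem exp_rep_bchProduct (x y : 𝔤) : NormedSpace.exp (G.rep (bchProduct s x y)) =
    NormedSpace.exp (G.rep x) * NormedSpace.exp (G.rep y) :=
  exp_map_bchProduct G.rep G.rep_lie G.iteratedBracket_eq_zero G.one_le_step
    (G.exp_rep_mul_exp_rep_pow x y)

theorem exp_rep_injective : Function.Injective fun x => NormedSpace.exp (G.rep x) := by
  intro x y hxy
  have rep_eq_log : ∀ z : 𝔤, G.rep z = logOneAdd (s + (s + 1))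
      (NormedSpace.exp (G.rep z) * NormedSpace.exp (G.rep (0 : 𝔤)) - 1) := by
    intro z
    rw [← map_bchProduct_eq_log G.rep G.rep_lie G.iteratedBracket_eq_zero G.one_le_step
      (G.exp_rep_mul_exp_rep_pow z 0) le_rfl, bchProduct_of_lie_eq_zero G.one_le_step (by simp),
      add_zero]
  apply G.rep_injective
  dsimp only at hxy
  rw [rep_eq_log x, rep_eq_log y, hxy]

theorem bchProduct_assoc (G : CarnotGroup 𝔤 s m) (x y z : 𝔤) :
    bchProduct s (bchProduct s x y) z = bchProduct s x (bchProduct s y z) := by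
  apply G.exp_rep_injective
  simp only [exp_rep_bchProduct, mul_assoc]

theorem bchProduct_conj (G : CarnotGroup 𝔤 s m) (x y : 𝔤) :
    bchProduct s (bchProduct s x y) (-x) = expAd s 1 x y := by
  apply G.exp_rep_injective
  simp only [exp_rep_bchProduct]
  have exp_mul_exp_neg : ∀ z, NormedSpace.exp (G.rep z) * NormedSpace.exp (G.rep (-z)) = 1 := by
    intro z
    rw [← exp_rep_bchProduct, bchProduct_of_lie_eq_zero G.one_le_step (by simp), add_neg_cancel,
      map_zero, NormedSpace.exp_zero]
  have rep_conj : G.rep (expAd s 1 x y) =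
      NormedSpace.exp (G.rep x) * G.rep y * NormedSpace.exp (G.rep (-x)) := by
    have intertwining := map_expAd_mul_exp G.rep G.rep_lie G.iteratedBracket_eq_zero 1 x y
    rw [one_smul] at intertwining
    rw [← intertwining, mul_assoc, exp_mul_exp_neg, mul_one]
  have exp_neg_mul_exp := exp_mul_exp_neg (-x)
  rw [neg_neg] at exp_neg_mul_exp
  rw [rep_conj, exp_mul_mul_of_mul_eq_one (exp_mul_exp_neg x) exp_neg_mul_exp]

theorem toLie_mul (ξ η : Coord m) : G.toLie (G.mul ξ η) = bchProduct s (G.toLie ξ) (G.toLie η) := by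
  simp [mul]

theorem mul_assoc' (ξ η ζ : Coord m) : G.mul (G.mul ξ η) ζ = G.mul ξ (G.mul η ζ) := by
  apply G.toLie.injective
  simp only [toLie_mul, G.bchProduct_assoc]

theorem mul_of_lie_eq_zero {ξ η : Coord m} (h : ⁅G.toLie ξ, G.toLie η⁆ = 0) :
    G.mul ξ η = ξ + η := by
  apply G.toLie.injective
  rw [toLie_mul, bchProduct_of_lie_eq_zero G.one_le_step h, map_add]

theorem mul_zero' (ξ : Coord m) : G.mul ξ 0 = ξ := by
  rw [G.mul_of_lie_eq_zero (by simp), add_zero]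

theorem zero_mul' (ξ : Coord m) : G.mul 0 ξ = ξ := by
  rw [G.mul_of_lie_eq_zero (by simp), zero_add]

theorem mul_neg_self (ξ : Coord m) : G.mul ξ (-ξ) = 0 := by
  rw [G.mul_of_lie_eq_zero (by simp), add_neg_cancel]

theorem neg_mul_self (ξ : Coord m) : G.mul (-ξ) ξ = 0 := by
  rw [G.mul_of_lie_eq_zero (by simp), neg_add_cancel]

theorem expX_add (i : Fin G.rank) (a b : ℝ) :
    G.expX i (a + b) = G.mul (G.expX i a) (G.expX i b) := by
  have expX_eq_smul : ∀ t, G.expX i t = t • G.expX i 1 := by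
    intro t
    ext j
    simp [expX, Pi.single_apply]
  rw [G.mul_of_lie_eq_zero, expX, Pi.single_add]
  · rfl
  · rw [expX_eq_smul a, expX_eq_smul b, map_smul, map_smul, smul_lie, lie_smul, lie_self, smul_zero,
      smul_zero]

theorem expX_zero (i : Fin G.rank) : G.expX i 0 = 0 := by
  simp [expX]

theorem mul_expX_add (ξ : Coord m) (i : Fin G.rank) (a b : ℝ) :
    G.mul ξ (G.expX i (a + b)) = G.mul (G.mul ξ (G.expX i a)) (G.expX i b) := by
  rw [expX_add, mul_assoc']

end CarnotGroup

/-! ### The group is generated by the exponentials of the first layer -/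

namespace CarnotGroup

variable {𝔤 : Type*} [LieRing 𝔤] [LieAlgebra ℝ 𝔤] {s : ℕ} {m : Fin s → ℕ}
  (G : CarnotGroup 𝔤 s m)

/-- The products of `n` factors `exp (t Xᵢ)` with `|t| ≤ r`. -/
def horizontalProducts : ℕ → ℝ → Set (Coord m)
  | 0, _ => {0}
  | n + 1, r => {ζ | ∃ ξ ∈ horizontalProducts n r, ∃ i : Fin G.rank, ∃ t : ℝ, |t| ≤ r ∧
      G.mul ξ (G.expX i t) = ζ}

theorem horizontalProducts_mono {r r' : ℝ} (h : r ≤ r') (n : ℕ) :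
    G.horizontalProducts n r ⊆ G.horizontalProducts n r' := by
  induction n with
  | zero => exact subset_rfl
  | succ n ih =>
    rintro _ ⟨ξ, hξ, i, t, ht, rfl⟩
    exact ⟨ξ, ih hξ, i, t, ht.trans h, rfl⟩

theorem mul_mem_horizontalProducts {n k : ℕ} {r : ℝ} {ξ η : Coord m}
    (hξ : ξ ∈ G.horizontalProducts n r) (hη : η ∈ G.horizontalProducts k r) :
    G.mul ξ η ∈ G.horizontalProducts (n + k) r := by
  induction k generalizing η with
  | zero =>
    rw [show η = 0 from hη, mul_zero']
    exact hξ
  | succ k ih =>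
    obtain ⟨η, hη, i, t, ht, rfl⟩ := hη
    exact ⟨_, ih hη, i, t, ht, G.mul_assoc' _ _ _⟩

theorem expX_mem_horizontalProducts (i : Fin G.rank) {t r : ℝ} (h : |t| ≤ r) :
    G.expX i t ∈ G.horizontalProducts 1 r :=
  ⟨0, rfl, i, t, h, G.zero_mul' _⟩

theorem expX_neg (i : Fin G.rank) (t : ℝ) : G.expX i (-t) = -G.expX i t := by
  simp [expX, Pi.single_neg]

theorem neg_eq_of_mul_eq_zero {ξ η : Coord m} (h : G.mul ξ η = 0) : η = -ξ := by
  rw [← G.zero_mul' η, ← G.neg_mul_self ξ, mul_assoc', h, mul_zero']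

theorem neg_mul_rev (ξ η : Coord m) : -G.mul ξ η = G.mul (-η) (-ξ) := by
  symm
  apply G.neg_eq_of_mul_eq_zero
  rw [mul_assoc', ← G.mul_assoc' η, mul_neg_self, zero_mul', mul_neg_self]

theorem neg_mem_horizontalProducts {n : ℕ} {r : ℝ} {ξ : Coord m}
    (hξ : ξ ∈ G.horizontalProducts n r) : -ξ ∈ G.horizontalProducts n r := by
  induction n generalizing ξ with
  | zero =>
    rw [show ξ = 0 from hξ, neg_zero]
    rfl
  | succ n ih =>
    obtain ⟨ξ, hξ, i, t, ht, rfl⟩ := hξ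
    rw [neg_mul_rev, ← expX_neg, add_comm]
    exact G.mul_mem_horizontalProducts (G.expX_mem_horizontalProducts i (by simpa using ht)) (ih hξ)

/-- The logarithms of the elements of the subgroup generated by the horizontal exponentials. -/
def horizontallyGenerated : Set 𝔤 := {z | ∃ n r, G.toLie.symm z ∈ G.horizontalProducts n r}

variable {G}

theorem bchProduct_mem_horizontallyGenerated {x y : 𝔤} (hx : x ∈ G.horizontallyGenerated)
    (hy : y ∈ G.horizontallyGenerated) : bchProduct s x y ∈ G.horizontallyGenerated := by
  obtain ⟨n, r, hx⟩ := hx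
  obtain ⟨k, r', hy⟩ := hy
  refine ⟨n + k, max r r', ?_⟩
  have := G.mul_mem_horizontalProducts (G.horizontalProducts_mono (le_max_left r r') n hx)
    (G.horizontalProducts_mono (le_max_right r r') k hy)
  simpa [mul] using this

theorem neg_mem_horizontallyGenerated {x : 𝔤} (hx : x ∈ G.horizontallyGenerated) :
    -x ∈ G.horizontallyGenerated := by
  obtain ⟨n, r, hx⟩ := hx
  exact ⟨n, r, by simpa using G.neg_mem_horizontalProducts hx⟩

variable (G)

theorem zero_mem_horizontallyGenerated : (0 : 𝔤) ∈ G.horizontallyGenerated :=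
  ⟨0, 0, by rw [map_zero]; rfl⟩

theorem ad_pow_mem_filtration (x : 𝔤) {k : ℕ} {z : 𝔤} (hz : z ∈ G.filtration k) (j : ℕ) :
    ((LieAlgebra.ad ℝ 𝔤 x) ^ j) z ∈ G.filtration (k + j) := by
  induction j with
  | zero => simpa using hz
  | succ j ih =>
    rw [pow_succ', Module.End.mul_apply, LieAlgebra.ad_apply, ← add_assoc]
    exact G.lie_mem_filtration_right x ih

theorem expAd_sub_mem_filtration (x : 𝔤) {k : ℕ} {z : 𝔤} (hz : z ∈ G.filtration k) :
    expAd s 1 x z - (z + ⁅x, z⁆) ∈ G.filtration (k + 2) := by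
  have split_range : Finset.range (s + 1) = Finset.range (s - 1 + 1 + 1) := by
    rw [Nat.sub_add_cancel G.one_le_step]
  rw [expAd_apply, split_range, Finset.sum_range_succ', Finset.sum_range_succ']
  have cancel_low_order : ∀ a : 𝔤, a + ((1 : ℝ) ^ (0 + 1) * ((0 + 1).factorial : ℝ)⁻¹) •
      ((LieAlgebra.ad ℝ 𝔤 x) ^ (0 + 1)) z +
      ((1 : ℝ) ^ 0 * ((Nat.factorial 0 : ℕ) : ℝ)⁻¹) • ((LieAlgebra.ad ℝ 𝔤 x) ^ 0) z -
      (z + ⁅x, z⁆) = a := by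
    intro a
    simp
    abel
  rw [cancel_low_order]
  refine Submodule.sum_mem _ fun j _ => Submodule.smul_mem _ _ ?_
  exact G.filtration_anti (by omega) (G.ad_pow_mem_filtration x hz (j + 1 + 1))

variable {G}

theorem mem_filtration_of_sub_mem {k : ℕ} {h z : 𝔤} (hz : z ∈ G.filtration k)
    (hsub : h - z ∈ G.filtration (k + 1)) : h ∈ G.filtration k := by
  rw [← sub_add_cancel h z]
  exact Submodule.add_mem _ (G.filtration_anti (Nat.le_succ k) hsub) hz

theorem bchProduct_sub_add_mem_filtration {k : ℕ} {x y : 𝔤} (h : ⁅x, y⁆ ∈ G.filtration k) :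
    bchProduct s x y - (x + y) ∈ G.filtration k :=
  bchProduct_sub_add_mem G.one_le_step (G.filtrationIdeal k) h

variable (G)

/-- The elements of degree at least `k` that agree with a horizontally generated element up to
terms of degree at least `k + 1`. -/
def generatedLeadingTerms (k : ℕ) : AddSubmonoid 𝔤 where
  carrier := {z | z ∈ G.filtration k ∧ ∃ h ∈ G.horizontallyGenerated, h - z ∈ G.filtration (k + 1)}
  zero_mem' := ⟨Submodule.zero_mem _, 0, G.zero_mem_horizontallyGenerated, by simp⟩
  add_mem' := by
    rintro z z' ⟨hz, h, hh, hsub⟩ ⟨hz', h', hh', hsub'⟩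
    refine ⟨Submodule.add_mem _ hz hz', _, bchProduct_mem_horizontallyGenerated hh hh', ?_⟩
    have bch_sub_add := bchProduct_sub_add_mem_filtration
      (G.lie_mem_filtration_right h (mem_filtration_of_sub_mem hz' hsub'))
    have decomposition : bchProduct s h h' - (z + z') =
        (bchProduct s h h' - (h + h')) + ((h - z) + (h' - z')) := by abel
    rw [decomposition]
    exact Submodule.add_mem _ bch_sub_add (Submodule.add_mem _ hsub hsub')

theorem homogeneous_one_subset_generatedLeadingTerms {z : 𝔤} (hz : z ∈ G.homogeneous 1) :
    z ∈ G.generatedLeadingTerms 1 := by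
  have expansion : z = ∑ j, G.toLie (Pi.single j (G.toLie.symm z j)) := by
    rw [← map_sum, Finset.univ_sum_single, LinearEquiv.apply_symm_apply]
  rw [expansion]
  refine AddSubmonoid.sum_mem _ fun j _ => ?_
  by_cases hj : (j.1 : ℕ) = 0
  · refine ⟨G.mem_filtration_one _, _, ?_, by rw [sub_self]; exact Submodule.zero_mem _⟩
    obtain ⟨⟨l, hl⟩, i⟩ := j
    dsimp only at hj
    subst hj
    refine ⟨1, |G.toLie.symm z ⟨⟨0, hl⟩, i⟩|, ?_⟩
    rw [LinearEquiv.symm_apply_apply]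
    exact G.expX_mem_horizontalProducts i le_rfl
  · rw [hz j (by omega), Pi.single_zero, map_zero]
    exact AddSubmonoid.zero_mem _

/- The commutator of the group elements with logarithms `a` and `b` has leading term `⁅a, b⁆`: by
`bchProduct_conj` its logarithm is the product of `e^{ad a} b` and `-b`. -/
theorem commutator_sub_lie_mem_filtration (a : 𝔤) {b : 𝔤} {k : ℕ} (hb : b ∈ G.filtration k) :
    bchProduct s (bchProduct s (bchProduct s a b) (-a)) (-b) - ⁅a, b⁆ ∈ G.filtration (k + 2) := by
  rw [G.bchProduct_conj]
  set e := expAd s 1 a b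
  have e_sub : e - (b + ⁅a, b⁆) ∈ G.filtration (k + 2) := G.expAd_sub_mem_filtration a hb
  have e_sub_b : e - b ∈ G.filtration (k + 1) := by
    rw [show e - b = (e - (b + ⁅a, b⁆)) + ⁅a, b⁆ by abel]
    exact Submodule.add_mem _ (G.filtration_anti (Nat.le_succ _) e_sub)
      (G.lie_mem_filtration_right a hb)
  have lie_e_neg_b : ⁅e, -b⁆ ∈ G.filtration (k + 2) := by
    rw [show ⁅e, -b⁆ = ⁅b, e - b⁆ by rw [lie_neg, lie_skew, lie_sub, lie_self, sub_zero]]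
    exact G.lie_mem_filtration_right b e_sub_b
  rw [show bchProduct s e (-b) - ⁅a, b⁆ =
    (bchProduct s e (-b) - (e + -b)) + (e - (b + ⁅a, b⁆)) by abel]
  exact Submodule.add_mem _ (bchProduct_sub_add_mem_filtration lie_e_neg_b) e_sub

theorem lie_mem_generatedLeadingTerms {k : ℕ} {x y : 𝔤} (hx : x ∈ G.generatedLeadingTerms 1)
    (hy : y ∈ G.generatedLeadingTerms k) : ⁅x, y⁆ ∈ G.generatedLeadingTerms (k + 1) := by
  obtain ⟨-, a, ha, a_sub⟩ := hx
  obtain ⟨y_mem, b, hb, b_sub⟩ := hy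
  have b_mem := mem_filtration_of_sub_mem y_mem b_sub
  refine ⟨G.lie_mem_filtration_right x y_mem, _, bchProduct_mem_horizontallyGenerated
    (bchProduct_mem_horizontallyGenerated (bchProduct_mem_horizontallyGenerated ha hb)
      (neg_mem_horizontallyGenerated ha)) (neg_mem_horizontallyGenerated hb), ?_⟩
  rw [← sub_add_sub_cancel _ ⁅a, b⁆,
    show ⁅a, b⁆ - ⁅x, y⁆ = ⁅a - x, b⁆ + ⁅x, b - y⁆ by rw [sub_lie, lie_sub]; abel]
  refine Submodule.add_mem _ (G.commutator_sub_lie_mem_filtration a b_mem)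
    (Submodule.add_mem _ ?_ (G.lie_mem_filtration_right x b_sub))
  exact G.filtration_anti (by omega) (G.lie_mem_filtration a_sub b_mem)

theorem homogeneous_subset_generatedLeadingTerms {k : ℕ} (hk : 1 ≤ k) {z : 𝔤}
    (hz : z ∈ G.homogeneous k) : z ∈ G.generatedLeadingTerms k := by
  induction k, hk using Nat.le_induction generalizing z with
  | base => exact G.homogeneous_one_subset_generatedLeadingTerms hz
  | succ k hk ih =>
    refine G.homogeneous_succ_induction hk (fun x hx y hy => ?_) (AddSubmonoid.zero_mem _)
      (fun _ _ => AddSubmonoid.add_mem _) hz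
    exact G.lie_mem_generatedLeadingTerms (G.homogeneous_one_subset_generatedLeadingTerms hx)
      (ih hy)

theorem sub_component_mem_filtration {k : ℕ} {z : 𝔤} (hz : z ∈ G.filtration k) :
    z - G.component k z ∈ G.filtration (k + 1) := by
  intro j hj
  rw [map_sub, Pi.sub_apply, toLie_symm_component]
  split_ifs
  · rw [sub_self]
  · rw [hz j (by omega), sub_zero]

theorem exists_bchProduct_neg_mem_filtration {k : ℕ} (hk : 1 ≤ k) {z : 𝔤}
    (hz : z ∈ G.filtration k) :
    ∃ h ∈ G.horizontallyGenerated, bchProduct s (-h) z ∈ G.filtration (k + 1) := by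
  obtain ⟨-, h, hh, h_sub⟩ :=
    G.homogeneous_subset_generatedLeadingTerms hk (G.component_mem k z)
  refine ⟨h, hh, ?_⟩
  have z_sub_h : z - h ∈ G.filtration (k + 1) := by
    rw [← sub_sub_sub_cancel_right z h (G.component k z)]
    exact Submodule.sub_mem _ (G.sub_component_mem_filtration hz) h_sub
  rw [show bchProduct s (-h) z = (bchProduct s (-h) z - (-h + z)) + (z - h) by abel]
  exact Submodule.add_mem _
    (bchProduct_sub_add_mem_filtration (G.lie_mem_filtration_right _ hz)) z_sub_h

theorem mem_horizontallyGenerated (z : 𝔤) : z ∈ G.horizontallyGenerated := by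
  suffices descent : ∀ d k, 1 ≤ k → s + 1 ≤ k + d →
      ∀ z ∈ G.filtration k, z ∈ G.horizontallyGenerated from
    descent s 1 le_rfl (by omega) z (G.mem_filtration_one z)
  intro d
  induction d with
  | zero =>
    intro k _ hk z hz
    rw [G.eq_zero_of_mem_filtration (by omega) hz]
    exact G.zero_mem_horizontallyGenerated
  | succ d ih =>
    intro k one_le hk z hz
    obtain ⟨h, hh, quotient_mem⟩ := G.exists_bchProduct_neg_mem_filtration one_le hz
    have product_mem := bchProduct_mem_horizontallyGenerated hh
      (ih (k + 1) (by omega) (by omega) _ quotient_mem)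
    rwa [← G.bchProduct_assoc, bchProduct_of_lie_eq_zero G.one_le_step (x := h) (by simp),
      add_neg_cancel, bchProduct_of_lie_eq_zero G.one_le_step (by simp), zero_add] at product_mem

theorem iUnion_horizontalProducts :
    ⋃ p : ℕ × ℕ, G.horizontalProducts p.1 (p.2 : ℝ) = Set.univ := by
  refine Set.eq_univ_of_forall fun ξ => Set.mem_iUnion.2 ?_
  obtain ⟨n, r, h⟩ := G.mem_horizontallyGenerated (G.toLie ξ)
  rw [LinearEquiv.symm_apply_apply] at h
  obtain ⟨k, hk⟩ := exists_nat_ge r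
  exact ⟨(n, k), G.horizontalProducts_mono hk n h⟩

end CarnotGroup

/-! ### Smoothness, dilations and Haar measure -/

namespace CarnotGroup

variable {𝔤 : Type*} [LieRing 𝔤] [LieAlgebra ℝ 𝔤] {s : ℕ} {m : Fin s → ℕ}
  (G : CarnotGroup 𝔤 s m)

section Smooth

variable {E : Type*} [NormedAddCommGroup E] [NormedSpace ℝ E] {n : WithTop ℕ∞}

theorem contDiff_lie {f g : E → Coord m} (hf : ContDiff ℝ n f) (hg : ContDiff ℝ n g) :
    ContDiff ℝ n fun e => G.toLie.symm ⁅G.toLie (f e), G.toLie (g e)⁆ := by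
  have bilinear_expansion : ∀ ξ η : Coord m, G.toLie.symm ⁅G.toLie ξ, G.toLie η⁆ =
      ∑ i, ∑ j, (ξ i * η j) •
        G.toLie.symm ⁅G.toLie (Pi.single i 1), G.toLie (Pi.single j 1)⁆ := by
    intro ξ η
    have linear_expansion : ∀ ξ : Coord m, G.toLie ξ = ∑ j, ξ j • G.toLie (Pi.single j 1) := by
      intro ξ
      conv_lhs => rw [← Finset.univ_sum_single ξ, map_sum]
      refine Finset.sum_congr rfl fun j _ => ?_
      rw [← map_smul, ← Pi.single_smul, smul_eq_mul, mul_one]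
    rw [linear_expansion ξ, linear_expansion η, sum_lie_sum, map_sum]
    refine Finset.sum_congr rfl fun i _ => ?_
    rw [map_sum]
    refine Finset.sum_congr rfl fun j _ => ?_
    rw [smul_lie, lie_smul, smul_smul, map_smul]
  rw [contDiff_pi] at hf hg
  rw [funext fun e => bilinear_expansion (f e) (g e)]
  exact ContDiff.sum fun i _ => ContDiff.sum fun j _ => ((hf i).mul (hg j)).smul contDiff_const

theorem contDiff_iteratedBracket (w : List (E → Coord m)) (hw : ∀ f ∈ w, ContDiff ℝ n f) :
    ContDiff ℝ n fun e => G.toLie.symm (iteratedBracket (w.map fun f => G.toLie (f e))) := by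
  induction w with
  | nil => simpa [iteratedBracket] using contDiff_const
  | cons f w ih =>
    rcases eq_or_ne w [] with rfl | w_ne
    · simpa [iteratedBracket] using hw f (by simp)
    · have contDiff_bracket :=
        G.contDiff_lie (hw f (by simp)) (ih fun g hg => hw g (by simp [hg]))
      simp only [LinearEquiv.apply_symm_apply] at contDiff_bracket
      simp only [List.map_cons, iteratedBracket_cons _ (mt List.map_eq_nil_iff.1 w_ne)]
      exact contDiff_bracket

theorem contDiff_mul {f g : E → Coord m} (hf : ContDiff ℝ n f) (hg : ContDiff ℝ n g) :
    ContDiff ℝ n fun e => G.mul (f e) (g e) := by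
  simp only [mul, bchProduct_eq, length_dynkinWord, map_sum, map_smul]
  refine ContDiff.sum fun n _ => ContDiff.const_smul _ <| ContDiff.sum fun p _ =>
    ContDiff.sum fun q _ => ?_
  split_ifs
  · simp only [map_smul]
    refine ContDiff.const_smul _ ?_
    have contDiff_word := G.contDiff_iteratedBracket (dynkinWord f g p q) fun h hh => by
      rcases mem_dynkinWord hh with rfl | rfl <;> assumption
    simpa only [dynkinWord_map] using contDiff_word
  · simpa using contDiff_const

attribute [local irreducible] CarnotGroup.mul

theorem continuous_mul {X : Type*} [TopologicalSpace X] {f g : X → Coord m} (hf : Continuous f)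
    (hg : Continuous g) : Continuous fun x => G.mul (f x) (g x) := by
  have continuous_uncurried : Continuous fun p : Coord m × Coord m => G.mul p.1 p.2 :=
    (G.contDiff_mul (n := 0) contDiff_fst contDiff_snd).continuous
  exact continuous_uncurried.comp (hf.prodMk hg)

end Smooth

attribute [local irreducible] CarnotGroup.mul

/-- The dilation `(z₁, …, z_s) ↦ (r z₁, r² z₂, …, r^s z_s)`. -/
def dilation (_G : CarnotGroup 𝔤 s m) (r : ℝ) : Coord m →ₗ[ℝ] Coord m :=
  Matrix.toLin' (Matrix.diagonal fun j => r ^ ((j.1 : ℕ) + 1))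

theorem dilation_apply (r : ℝ) (ξ : Coord m) (j : Σ l : Fin s, Fin (m l)) :
    G.dilation r ξ j = r ^ ((j.1 : ℕ) + 1) * ξ j := by
  simp [dilation, Matrix.mulVec_diagonal]

theorem toLie_dilation (r : ℝ) (ξ : Coord m) :
    G.toLie (G.dilation r ξ) = G.dilationLie r (G.toLie ξ) := by
  apply G.toLie.symm.injective
  ext j
  rw [toLie_symm_dilationLie, LinearEquiv.symm_apply_apply, LinearEquiv.symm_apply_apply,
    dilation_apply]

theorem dilation_mul (r : ℝ) (ξ η : Coord m) :
    G.dilation r (G.mul ξ η) = G.mul (G.dilation r ξ) (G.dilation r η) := by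
  apply G.toLie.injective
  rw [toLie_dilation, toLie_mul, toLie_mul, map_bchProduct, toLie_dilation, toLie_dilation]

theorem dilation_expX (r : ℝ) (i : Fin G.rank) (t : ℝ) :
    G.dilation r (G.expX i t) = G.expX i (r * t) := by
  ext j
  rw [dilation_apply, expX, expX, Pi.single_apply, Pi.single_apply]
  split_ifs with h
  · subst h
    simp
  · simp

theorem dilation_dilation (r r' : ℝ) (ξ : Coord m) :
    G.dilation r (G.dilation r' ξ) = G.dilation (r * r') ξ := by
  ext j
  simp only [dilation_apply, mul_pow]
  ring

theorem dilation_one (ξ : Coord m) : G.dilation 1 ξ = ξ := by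
  ext j
  simp [dilation_apply]

theorem dilation_zero_left (ξ : Coord m) : G.dilation 0 ξ = 0 := by
  ext j
  simp [dilation_apply]

theorem det_dilation (r : ℝ) : LinearMap.det (G.dilation r) = r ^ G.homDim := by
  rw [dilation, LinearMap.det_toLin', Matrix.det_diagonal, Finset.prod_pow_eq_pow_sum, homDim,
    Fintype.sum_sigma]
  simp [mul_comm]

theorem continuous_dilation_left (ξ : Coord m) : Continuous fun r => G.dilation r ξ := by
  refine continuous_pi fun j => ?_
  simp only [dilation_apply]
  fun_prop

theorem contDiff_dilation (r : ℝ) {n : WithTop ℕ∞} : ContDiff ℝ n (G.dilation r) :=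
  (LinearMap.toContinuousLinearMap (G.dilation r)).contDiff

theorem differentiable_mul_left (ξ : Coord m) : Differentiable ℝ (G.mul ξ) :=
  (G.contDiff_mul (n := 1) contDiff_const contDiff_id).differentiable one_ne_zero

/-- The Jacobian determinant at `η` of the left translation by `ξ`. -/
def jacobian (ξ η : Coord m) : ℝ := (fderiv ℝ (G.mul ξ) η).det

theorem continuous_jacobian : Continuous fun p : Coord m × Coord m => G.jacobian p.1 p.2 := by
  have contDiff_uncurried : ContDiff ℝ 1
      (Function.uncurry fun p : Coord m × Coord m => G.mul p.1) :=
    G.contDiff_mul (contDiff_fst.comp contDiff_fst) contDiff_snd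
  exact ContinuousLinearMap.continuous_det.comp
    (ContDiff.fderiv (n := 0) contDiff_uncurried contDiff_snd (by simp)).continuous

theorem jacobian_zero_left (η : Coord m) : G.jacobian 0 η = 1 := by
  have mul_zero_eq_id : G.mul 0 = id := funext G.zero_mul'
  rw [jacobian, mul_zero_eq_id, fderiv_id]
  exact LinearMap.det_id

theorem jacobian_dilation {r : ℝ} (hr : r ≠ 0) (ξ η : Coord m) :
    G.jacobian (G.dilation r ξ) (G.dilation r η) = G.jacobian ξ η := by
  set D := LinearMap.toContinuousLinearMap (G.dilation r)
  have det_ne_zero : D.det ≠ 0 := by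
    change LinearMap.det (G.dilation r) ≠ 0
    rw [det_dilation]
    exact pow_ne_zero _ hr
  have intertwining : G.mul (G.dilation r ξ) ∘ D = D ∘ G.mul ξ :=
    funext fun η => (G.dilation_mul r ξ η).symm
  have chain_rule := congrArg (fderiv ℝ · η) intertwining
  simp only [fderiv_comp η (G.differentiable_mul_left _ _) D.differentiableAt,
    fderiv_comp η D.differentiableAt (G.differentiable_mul_left _ _),
    ContinuousLinearMap.fderiv] at chain_rule
  have det_comp : ∀ A B : Coord m →L[ℝ] Coord m, (A.comp B).det = A.det * B.det :=
    fun A B => LinearMap.det_comp _ _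
  have det_chain_rule := congrArg ContinuousLinearMap.det chain_rule
  rw [det_comp, det_comp, mul_comm] at det_chain_rule
  exact mul_left_cancel₀ det_ne_zero det_chain_rule

theorem jacobian_eq_one (ξ η : Coord m) : G.jacobian ξ η = 1 := by
  have continuous_along_dilations :
      Continuous fun r => G.jacobian (G.dilation r ξ) (G.dilation r η) :=
    G.continuous_jacobian.comp
      ((G.continuous_dilation_left ξ).prodMk (G.continuous_dilation_left η))
  have constant := continuous_along_dilations.ext_on (dense_compl_singleton 0) continuous_const
    fun r hr => G.jacobian_dilation hr ξ η
  rw [← congrFun constant 0, dilation_zero_left, jacobian_zero_left]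

theorem neg_mul_cancel_left (ξ η : Coord m) : G.mul (-ξ) (G.mul ξ η) = η := by
  rw [← mul_assoc', neg_mul_self, zero_mul']

theorem mul_neg_cancel_left (ξ η : Coord m) : G.mul ξ (G.mul (-ξ) η) = η := by
  rw [← mul_assoc', mul_neg_self, zero_mul']

theorem measurePreserving_mul_left_volume (ξ : Coord m) :
    MeasurePreserving (G.mul ξ) volume volume := by
  have measurable_mul_left : Measurable (G.mul ξ) :=
    (G.differentiable_mul_left ξ).continuous.measurable
  refine ⟨measurable_mul_left, ?_⟩
  ext S hS
  rw [Measure.map_apply measurable_mul_left hS,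
    ← Set.image_eq_preimage_of_inverse (G.mul_neg_cancel_left ξ) (G.neg_mul_cancel_left ξ),
    ← lintegral_abs_det_fderiv_eq_addHaar_image volume hS (f := G.mul (-ξ))
      (fun η _ => (G.differentiable_mul_left (-ξ) η).hasFDerivAt.hasFDerivWithinAt)
      (Function.LeftInverse.injective (G.mul_neg_cancel_left ξ)).injOn]
  simp [← jacobian.eq_def, jacobian_eq_one]

/-- The coordinate space, as a type that carries the group structure: `Coord m` itself is already
an additive group. -/
def Point (_G : CarnotGroup 𝔤 s m) : Type := Coord m

instance : TopologicalSpace G.Point := inferInstanceAs (TopologicalSpace (Coord m))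
instance : MeasurableSpace G.Point := inferInstanceAs (MeasurableSpace (Coord m))
instance : BorelSpace G.Point := inferInstanceAs (BorelSpace (Coord m))
instance : LocallyCompactSpace G.Point := inferInstanceAs (LocallyCompactSpace (Coord m))
instance : SecondCountableTopology G.Point := inferInstanceAs (SecondCountableTopology (Coord m))

instance : Group G.Point :=
  @Group.ofLeftAxioms G.Point ⟨G.mul⟩ ⟨fun ξ : Coord m => -ξ⟩ ⟨(0 : Coord m)⟩
    G.mul_assoc' G.zero_mul' G.neg_mul_self

instance : IsTopologicalGroup G.Point where
  continuous_mul := G.continuous_mul (X := Coord m × Coord m) continuous_fst continuous_snd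
  continuous_inv := continuous_neg (G := Coord m)

variable {G}

theorem IsHaar.eq_smul_volume {μ : Measure (Coord m)} (hμ : G.IsHaar μ) :
    ∃ c : ℝ≥0, c ≠ 0 ∧ μ = c • volume := by
  let μ' : Measure G.Point := μ
  let ν : Measure G.Point := (volume : Measure (Coord m))
  have : μ'.IsMulLeftInvariant := ⟨fun ξ => (hμ.left_invariant ξ).map_eq⟩
  have : ν.IsMulLeftInvariant := ⟨fun ξ => (G.measurePreserving_mul_left_volume ξ).map_eq⟩
  have : IsFiniteMeasureOnCompacts μ' := ⟨fun K hK => hμ.finite_of_isCompact K hK⟩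
  have : IsFiniteMeasureOnCompacts ν :=
    ⟨fun K hK => IsCompact.measure_lt_top (α := Coord m) (μ := volume) hK⟩
  have : ν.IsOpenPosMeasure :=
    ⟨fun U hU hne => IsOpen.measure_ne_zero (X := Coord m) volume hU hne⟩
  have : ν.IsHaarMeasure := {}
  have eq_smul : μ' = Measure.haarScalarFactor μ' ν • ν := Measure.isMulLeftInvariant_eq_smul μ' ν
  refine ⟨Measure.haarScalarFactor μ' ν, fun factor_eq_zero => hμ.ne_zero ?_, eq_smul⟩
  rw [factor_eq_zero, zero_smul] at eq_smul
  exact eq_smul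

theorem IsHaar.measure_dilation_image {μ : Measure (Coord m)} (hμ : G.IsHaar μ) {r : ℝ}
    (hr : 0 ≤ r) (S : Set (Coord m)) :
    μ (G.dilation r '' S) = ENNReal.ofReal (r ^ G.homDim) * μ S := by
  obtain ⟨c, _, rfl⟩ := hμ.eq_smul_volume
  rw [Measure.smul_apply, Measure.smul_apply, Measure.addHaar_image_linearMap, det_dilation,
    abs_of_nonneg (by positivity), ENNReal.smul_def, ENNReal.smul_def, smul_eq_mul, smul_eq_mul]
  ring

theorem IsHaar.isOpenPosMeasure {μ : Measure (Coord m)} (hμ : G.IsHaar μ) :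
    μ.IsOpenPosMeasure := by
  obtain ⟨c, hc, rfl⟩ := hμ.eq_smul_volume
  refine ⟨fun U hU hne => ?_⟩
  rw [Measure.smul_apply, ENNReal.smul_def, smul_eq_mul]
  exact mul_ne_zero (by simpa using hc) (hU.measure_ne_zero volume hne)

end CarnotGroup

/-! ### Calculus with the left-invariant vector fields -/

namespace CarnotGroup

open Filter Topology

variable {𝔤 : Type*} [LieRing 𝔤] [LieAlgebra ℝ 𝔤] {s : ℕ} {m : Fin s → ℕ}
  (G : CarnotGroup 𝔤 s m)

attribute [local irreducible] CarnotGroup.mul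

theorem contDiff_expX (i : Fin G.rank) {n : WithTop ℕ∞} : ContDiff ℝ n (G.expX i) :=
  contDiff_single (𝕜 := ℝ) (F' := fun _ => ℝ) n _

theorem contDiff_mul_expX (i : Fin G.rank) {n : WithTop ℕ∞} :
    ContDiff ℝ n fun p : Coord m × ℝ => G.mul p.1 (G.expX i p.2) :=
  G.contDiff_mul contDiff_fst ((G.contDiff_expX i).comp contDiff_snd)

theorem continuous_mul_expX (i : Fin G.rank) :
    Continuous fun p : Coord m × ℝ => G.mul p.1 (G.expX i p.2) :=
  (G.contDiff_mul_expX i (n := 0)).continuous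

/-- The coefficients of the vector field `Xᵢ`. -/
def field (i : Fin G.rank) (ξ : Coord m) : Coord m :=
  fderiv ℝ (fun p : Coord m × ℝ => G.mul p.1 (G.expX i p.2)) (ξ, 0) (0, 1)

theorem contDiff_field (i : Fin G.rank) : ContDiff ℝ 1 (G.field i) := by
  have contDiff_fderiv :=
    (G.contDiff_mul_expX i (n := 2)).fderiv_right (m := 1) (by norm_num)
  exact (contDiff_fderiv.comp (contDiff_id.prodMk contDiff_const)).clm_apply contDiff_const

theorem hasDerivAt_mul_expX (i : Fin G.rank) (ξ : Coord m) :
    HasDerivAt (fun t => G.mul ξ (G.expX i t)) (G.field i ξ) 0 := by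
  have hasFDerivAt_zero :=
    ((G.contDiff_mul_expX i (n := 1)).differentiable one_ne_zero (ξ, 0)).hasFDerivAt
  exact hasFDerivAt_zero.comp_hasDerivAt (0 : ℝ)
    ((hasDerivAt_const (0 : ℝ) ξ).prodMk (hasDerivAt_id 0))

variable {G}

theorem mul_expX_zero (ξ : Coord m) (i : Fin G.rank) : G.mul ξ (G.expX i 0) = ξ := by
  rw [expX_zero, mul_zero']

theorem tendsto_mul_expX (ξ : Coord m) (i : Fin G.rank) :
    Tendsto (fun t => G.mul ξ (G.expX i t)) (𝓝 0) (𝓝 ξ) := by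
  simpa only [mul_expX_zero] using (G.hasDerivAt_mul_expX i ξ).continuousAt.tendsto

theorem hasDerivAt_fderiv_field {u : Coord m → ℝ} {ξ : Coord m} (hu : DifferentiableAt ℝ u ξ)
    (i : Fin G.rank) :
    HasDerivAt (fun t => u (G.mul ξ (G.expX i t))) (fderiv ℝ u ξ (G.field i ξ)) 0 := by
  have hasFDerivAt_u : HasFDerivAt u (fderiv ℝ u ξ) (G.mul ξ (G.expX i 0)) := by
    rw [mul_expX_zero]
    exact hu.hasFDerivAt
  exact hasFDerivAt_u.comp_hasDerivAt (0 : ℝ) (G.hasDerivAt_mul_expX i ξ)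

theorem X_eq_fderiv {u : Coord m → ℝ} {ξ : Coord m} (hu : DifferentiableAt ℝ u ξ)
    (i : Fin G.rank) : G.X i u ξ = fderiv ℝ u ξ (G.field i ξ) :=
  (hasDerivAt_fderiv_field hu i).deriv

theorem hasDerivAt_X_zero {u : Coord m → ℝ} {ξ : Coord m} (hu : DifferentiableAt ℝ u ξ)
    (i : Fin G.rank) : HasDerivAt (fun t => u (G.mul ξ (G.expX i t))) (G.X i u ξ) 0 :=
  (hasDerivAt_fderiv_field hu i).differentiableAt.hasDerivAt

theorem hasDerivAt_X {u : Coord m → ℝ} {ξ : Coord m} {i : Fin G.rank} {t : ℝ}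
    (hu : DifferentiableAt ℝ u (G.mul ξ (G.expX i t))) :
    HasDerivAt (fun τ => u (G.mul ξ (G.expX i τ))) (G.X i u (G.mul ξ (G.expX i t))) t := by
  have hasDerivAt_zero := hasDerivAt_X_zero hu i
  rw [← sub_self t] at hasDerivAt_zero
  refine (hasDerivAt_zero.comp_sub_const t t).congr_of_eventuallyEq (.of_forall fun τ => ?_)
  dsimp only
  rw [← mul_expX_add, add_sub_cancel]

theorem X_congr {u v : Coord m → ℝ} {ξ : Coord m} (h : u =ᶠ[𝓝 ξ] v) (i : Fin G.rank) :
    G.X i u ξ = G.X i v ξ :=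
  Filter.EventuallyEq.deriv_eq ((tendsto_mul_expX ξ i).eventually h)

theorem X_eventuallyEq {u v : Coord m → ℝ} {ξ : Coord m} (h : u =ᶠ[𝓝 ξ] v) (i : Fin G.rank) :
    G.X i u =ᶠ[𝓝 ξ] G.X i v :=
  h.eventuallyEq_nhds.mono fun _ hη => X_congr hη i

theorem subLaplacian_congr {u v : Coord m → ℝ} {ξ : Coord m} (h : u =ᶠ[𝓝 ξ] v) :
    G.subLaplacian u ξ = G.subLaplacian v ξ :=
  Finset.sum_congr rfl fun i _ => X_congr (X_eventuallyEq h i) i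

theorem X_const (c : ℝ) (i : Fin G.rank) : G.X i (fun _ => c) = fun _ => 0 := by
  ext ξ
  simp [X]

theorem subLaplacian_eq_zero {u : Coord m → ℝ} {ξ : Coord m} (h : u =ᶠ[𝓝 ξ] fun _ => 0) :
    G.subLaplacian u ξ = 0 := by
  rw [subLaplacian_congr h]
  simp [subLaplacian, X_const]

theorem X_neg (u : Coord m → ℝ) (i : Fin G.rank) :
    G.X i (fun ξ => -u ξ) = fun ξ => -G.X i u ξ := by
  ext ξ
  simp [X, deriv.fun_neg]

theorem subLaplacian_neg (u : Coord m → ℝ) (ξ : Coord m) :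
    G.subLaplacian (fun ξ => -u ξ) ξ = -G.subLaplacian u ξ := by
  simp only [subLaplacian, X_neg, Finset.sum_neg_distrib]

theorem X_mul {u v : Coord m → ℝ} {ξ : Coord m} (hu : DifferentiableAt ℝ u ξ)
    (hv : DifferentiableAt ℝ v ξ) (i : Fin G.rank) :
    G.X i (fun η => u η * v η) ξ = G.X i u ξ * v ξ + u ξ * G.X i v ξ := by
  have product_rule := (hasDerivAt_X_zero hu i).mul (hasDerivAt_X_zero hv i)
  simp only [mul_expX_zero] at product_rule
  exact product_rule.deriv

theorem X_sub {u v : Coord m → ℝ} {ξ : Coord m} (hu : DifferentiableAt ℝ u ξ)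
    (hv : DifferentiableAt ℝ v ξ) (i : Fin G.rank) :
    G.X i (fun η => u η - v η) ξ = G.X i u ξ - G.X i v ξ :=
  ((hasDerivAt_X_zero hu i).sub (hasDerivAt_X_zero hv i)).deriv

theorem X_comp {u : Coord m → ℝ} {ξ : Coord m} (hu : DifferentiableAt ℝ u ξ) {θ : ℝ → ℝ}
    {θ' : ℝ} (hθ : HasDerivAt θ θ' (u ξ)) (i : Fin G.rank) :
    G.X i (fun η => θ (u η)) ξ = θ' * G.X i u ξ := by
  rw [← mul_expX_zero ξ i] at hθ
  exact (hθ.comp (0 : ℝ) (hasDerivAt_X_zero hu i)).deriv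

theorem contDiffOn_X {u : Coord m → ℝ} {Ω : Set (Coord m)} (hΩ : IsOpen Ω)
    (hu : ContDiffOn ℝ 2 u Ω) (i : Fin G.rank) : ContDiffOn ℝ 1 (G.X i u) Ω := by
  have contDiffOn_fderiv_field : ContDiffOn ℝ 1 (fun ξ => fderiv ℝ u ξ (G.field i ξ)) Ω :=
    (hu.fderiv_of_isOpen hΩ (by norm_num)).clm_apply (G.contDiff_field i).contDiffOn
  exact contDiffOn_fderiv_field.congr fun ξ hξ =>
    X_eq_fderiv ((hu.contDiffAt (hΩ.mem_nhds hξ)).differentiableAt (by norm_num)) i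

theorem contDiff_X {u : Coord m → ℝ} (hu : ContDiff ℝ 2 u) (i : Fin G.rank) :
    ContDiff ℝ 1 (G.X i u) := by
  rw [← contDiffOn_univ] at hu ⊢
  exact contDiffOn_X isOpen_univ hu i

theorem continuous_X {u : Coord m → ℝ} (hu : ContDiff ℝ 1 u) (i : Fin G.rank) :
    Continuous (G.X i u) := by
  rw [funext fun ξ => X_eq_fderiv (hu.differentiable one_ne_zero ξ) i]
  exact (hu.continuous_fderiv one_ne_zero).clm_apply (G.contDiff_field i).continuous

theorem continuous_subLaplacian {u : Coord m → ℝ} (hu : ContDiff ℝ 2 u) :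
    Continuous (G.subLaplacian u) :=
  continuous_finsetSum _ fun i _ => continuous_X (contDiff_X hu i) i

theorem X_eq_zero_of_notMem_tsupport {u : Coord m → ℝ} {ξ : Coord m} (hξ : ξ ∉ tsupport u)
    (i : Fin G.rank) : G.X i u ξ = 0 := by
  rw [X_congr (v := fun _ => 0) (notMem_tsupport_iff_eventuallyEq.1 hξ), X_const]

theorem hasCompactSupport_X {u : Coord m → ℝ} (hu : HasCompactSupport u) (i : Fin G.rank) :
    HasCompactSupport (G.X i u) :=
  HasCompactSupport.of_support_subset_isCompact hu fun _ hξ =>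
    not_imp_comm.1 (fun notMem => X_eq_zero_of_notMem_tsupport notMem i) hξ

theorem X_comp_dilation (u : Coord m → ℝ) (a : ℝ) (i : Fin G.rank) :
    G.X i (fun ξ => u (G.dilation a ξ)) = fun ξ => a * G.X i u (G.dilation a ξ) := by
  ext ξ
  simp only [X, dilation_mul, dilation_expX]
  simpa only [mul_zero, smul_eq_mul] using
    deriv_comp_mul_left a (fun t => u (G.mul (G.dilation a ξ) (G.expX i t))) 0

theorem X_const_mul (c : ℝ) (u : Coord m → ℝ) (i : Fin G.rank) :
    G.X i (fun ξ => c * u ξ) = fun ξ => c * G.X i u ξ := by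
  ext ξ
  simp [X]

theorem subLaplacian_comp_dilation (u : Coord m → ℝ) (a : ℝ) (ξ : Coord m) :
    G.subLaplacian (fun ξ => u (G.dilation a ξ)) ξ =
      a ^ 2 * G.subLaplacian u (G.dilation a ξ) := by
  simp only [subLaplacian, X_comp_dilation, X_const_mul, Finset.mul_sum]
  refine Finset.sum_congr rfl fun i _ => ?_
  ring

/-! ### Integration by parts -/

theorem IsHaar.isFiniteMeasureOnCompacts {μ : Measure (Coord m)} (hμ : G.IsHaar μ) :
    IsFiniteMeasureOnCompacts μ := ⟨fun K hK => hμ.finite_of_isCompact K hK⟩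

theorem IsHaar.sigmaFinite {μ : Measure (Coord m)} (hμ : G.IsHaar μ) : SigmaFinite μ := by
  obtain ⟨c, _, rfl⟩ := hμ.eq_smul_volume
  infer_instance

/- For `|t| < 1` the functions `ξ ↦ X φ (ξ exp(tX))` live on one compact set, the image of
`tsupport φ × [-1, 1]` under the flow. -/
theorem IsHaar.exists_integrable_bound_X {μ : Measure (Coord m)} (hμ : G.IsHaar μ)
    {φ : Coord m → ℝ} (hφ : ContDiff ℝ 1 φ) (hc : HasCompactSupport φ) (i : Fin G.rank) :
    ∃ bound : Coord m → ℝ, Integrable bound μ ∧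
      ∀ ξ, ∀ t ∈ Metric.ball (0 : ℝ) 1, ‖G.X i φ (G.mul ξ (G.expX i t))‖ ≤ bound ξ := by
  obtain ⟨B, X_le⟩ :=
    (continuous_X hφ i).bounded_above_of_compact_support (hasCompactSupport_X hc i)
  set K : Set (Coord m) := (fun p : Coord m × ℝ => G.mul p.1 (G.expX i p.2)) ''
    (tsupport φ ×ˢ Set.Icc (-1) 1)
  have isCompact_K : IsCompact K :=
    (IsCompact.prod hc isCompact_Icc).image (G.continuous_mul_expX i)
  refine ⟨K.indicator fun _ => B, (integrable_indicator_iff isCompact_K.measurableSet).2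
    (integrableOn_const (hμ.finite_of_isCompact K isCompact_K).ne), fun ξ t ht => ?_⟩
  by_cases hξ : ξ ∈ K
  · rw [Set.indicator_of_mem hξ]
    exact X_le _
  · have notMem_tsupport : G.mul ξ (G.expX i t) ∉ tsupport φ := by
      refine fun mem => hξ ⟨(G.mul ξ (G.expX i t), -t), ⟨mem, ?_⟩, ?_⟩
      · rw [Metric.mem_ball, dist_zero_right, Real.norm_eq_abs, abs_lt] at ht
        constructor <;> linarith [ht.1, ht.2]
      · dsimp only
        rw [← mul_expX_add, add_neg_cancel, mul_expX_zero]
    rw [Set.indicator_of_notMem hξ, X_eq_zero_of_notMem_tsupport notMem_tsupport, norm_zero]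

theorem IsHaar.integral_comp_mul_right {μ : Measure (Coord m)} (hμ : G.IsHaar μ)
    {φ : Coord m → ℝ} (hφ : Continuous φ) (η : Coord m) :
    ∫ ξ, φ (G.mul ξ η) ∂μ = ∫ ξ, φ ξ ∂μ := by
  have preserving := hμ.right_invariant η
  rw [← integral_map preserving.measurable.aemeasurable hφ.aestronglyMeasurable,
    preserving.map_eq]

theorem IsHaar.integral_X_eq_zero {μ : Measure (Coord m)} (hμ : G.IsHaar μ) {φ : Coord m → ℝ}
    (hφ : ContDiff ℝ 1 φ) (hc : HasCompactSupport φ) (i : Fin G.rank) :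
    ∫ ξ, G.X i φ ξ ∂μ = 0 := by
  have := hμ.isFiniteMeasureOnCompacts
  have continuous_translation : ∀ t, Continuous fun ξ => G.mul ξ (G.expX i t) := fun t =>
    (G.continuous_mul_expX i).comp (continuous_id.prodMk continuous_const)
  obtain ⟨bound, bound_integrable, X_le_bound⟩ := hμ.exists_integrable_bound_X hφ hc i
  have hasDerivAt_integral := (hasDerivAt_integral_of_dominated_loc_of_deriv_le (μ := μ)
    (F := fun t ξ => φ (G.mul ξ (G.expX i t)))
    (F' := fun t ξ => G.X i φ (G.mul ξ (G.expX i t)))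
    (Metric.ball_mem_nhds 0 one_pos)
    (.of_forall fun t => (hφ.continuous.comp (continuous_translation t)).aestronglyMeasurable)
    (by simpa only [mul_expX_zero] using hφ.continuous.integrable_of_hasCompactSupport hc)
    ((continuous_X hφ i).comp (continuous_translation 0)).aestronglyMeasurable
    (.of_forall X_le_bound) bound_integrable
    (.of_forall fun ξ t _ => hasDerivAt_X (hφ.differentiable one_ne_zero _))).2
  simp only [hμ.integral_comp_mul_right hφ.continuous, mul_expX_zero] at hasDerivAt_integral
  exact hasDerivAt_integral.unique (hasDerivAt_const (0 : ℝ) _)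

theorem IsHaar.integral_mul_subLaplacian {μ : Measure (Coord m)} (hμ : G.IsHaar μ)
    {P χ : Coord m → ℝ} (hP : ContDiff ℝ 2 P) (hχ : ContDiff ℝ 2 χ) (hc : HasCompactSupport χ) :
    ∫ ξ, χ ξ * G.subLaplacian P ξ ∂μ = ∫ ξ, P ξ * G.subLaplacian χ ξ ∂μ := by
  have := hμ.isFiniteMeasureOnCompacts
  have diff_P : Differentiable ℝ P := hP.differentiable (by norm_num)
  have diff_χ : Differentiable ℝ χ := hχ.differentiable (by norm_num)
  have integrable_left : ∀ i, Integrable (fun ξ => χ ξ * G.X i (G.X i P) ξ) μ := fun i =>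
    (hχ.continuous.mul (continuous_X (contDiff_X hP i) i)).integrable_of_hasCompactSupport
      hc.mul_right
  have integrable_right : ∀ i, Integrable (fun ξ => P ξ * G.X i (G.X i χ) ξ) μ := fun i =>
    (hP.continuous.mul (continuous_X (contDiff_X hχ i) i)).integrable_of_hasCompactSupport
      (hasCompactSupport_X (hasCompactSupport_X hc i) i).mul_left
  simp only [subLaplacian, Finset.mul_sum]
  rw [integral_finsetSum _ fun i _ => integrable_left i,
    integral_finsetSum _ fun i _ => integrable_right i]
  refine Finset.sum_congr rfl fun i _ => ?_
  rw [← sub_eq_zero, ← integral_sub (integrable_left i) (integrable_right i),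
    ← hμ.integral_X_eq_zero (φ := fun ξ => χ ξ * G.X i P ξ - P ξ * G.X i χ ξ)
    (((hχ.of_le one_le_two).mul (contDiff_X hP i)).sub
      ((hP.of_le one_le_two).mul (contDiff_X hχ i)))
    (hc.mul_right.sub (hasCompactSupport_X hc i).mul_left) i]
  refine integral_congr_ae (.of_forall fun ξ => ?_)
  have diff_XP : DifferentiableAt ℝ (G.X i P) ξ := (contDiff_X hP i).differentiable one_ne_zero ξ
  have diff_Xχ : DifferentiableAt ℝ (G.X i χ) ξ := (contDiff_X hχ i).differentiable one_ne_zero ξ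
  dsimp only
  rw [X_sub ((diff_χ ξ).fun_mul diff_XP) ((diff_P ξ).fun_mul diff_Xχ),
    X_mul (diff_χ ξ) diff_XP, X_mul (diff_P ξ) diff_Xχ]
  ring

end CarnotGroup

/-! ### The Faber–Krahn inequality -/

theorem sq_lintegral_le_measure_mul_lintegral_sq {α : Type*} [MeasurableSpace α] (μ : Measure α)
    {f : α → ℝ≥0∞} (hf : Measurable f) :
    (∫⁻ x, f x ∂μ) ^ 2 ≤ μ {x | f x ≠ 0} * ∫⁻ x, f x ^ 2 ∂μ := by
  have measurableSet_ne : MeasurableSet {x | f x ≠ 0} := hf (measurableSet_singleton 0).compl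
  have hölder := ENNReal.lintegral_mul_le_Lp_mul_Lq μ Real.HolderConjugate.two_two
    (measurable_one.indicator measurableSet_ne).aemeasurable hf.aemeasurable
  have indicator_mul : ∀ x, ({x | f x ≠ 0}.indicator (1 : α → ℝ≥0∞) * f) x = f x := fun x => by
    by_cases hx : f x = 0 <;> simp [hx]
  have indicator_sq : ∀ x, {x | f x ≠ 0}.indicator (1 : α → ℝ≥0∞) x ^ (2 : ℝ) =
      {x | f x ≠ 0}.indicator 1 x := fun x => by
    by_cases hx : f x = 0 <;> simp [hx]
  simp only [indicator_mul, indicator_sq, lintegral_indicator_one measurableSet_ne,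
    ENNReal.rpow_two] at hölder
  calc (∫⁻ x, f x ∂μ) ^ 2
      ≤ (μ {x | f x ≠ 0} ^ (1 / 2 : ℝ) * (∫⁻ x, f x ^ 2 ∂μ) ^ (1 / 2 : ℝ)) ^ 2 := by gcongr
    _ = μ {x | f x ≠ 0} * ∫⁻ x, f x ^ 2 ∂μ := by
        rw [← ENNReal.mul_rpow_of_nonneg _ _ (by norm_num), ← ENNReal.rpow_two,
          ← ENNReal.rpow_mul]
        norm_num

namespace CarnotGroup

open Filter Topology

variable {𝔤 : Type*} [LieRing 𝔤] [LieAlgebra ℝ 𝔤] {s : ℕ} {m : Fin s → ℕ}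
  {G : CarnotGroup 𝔤 s m}

attribute [local irreducible] CarnotGroup.mul

theorem ofReal_sq_sub_expX_le_lintegral {v : Coord m → ℝ} (hv : ContDiff ℝ 1 v) (ξ : Coord m)
    (i : Fin G.rank) (t : ℝ) : ENNReal.ofReal ((v (G.mul ξ (G.expX i t)) - v ξ) ^ 2) ≤
      ∫⁻ σ in Set.Ioc (0 : ℝ) 1,
        ENNReal.ofReal (t ^ 2 * G.X i v (G.mul ξ (G.expX i (t * σ))) ^ 2) := by
  set f : ℝ → ℝ := fun σ => t * G.X i v (G.mul ξ (G.expX i (t * σ))) with hf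
  have continuous_f : Continuous f :=
    continuous_const.mul ((continuous_X hv i).comp ((G.continuous_mul_expX i).comp
      (continuous_const.prodMk (continuous_const.mul continuous_id))))
  have integrable_sq : Integrable (fun σ => f σ ^ 2) (volume.restrict (Set.Ioc 0 1)) :=
    ((continuous_f.pow 2).intervalIntegrable 0 1).1
  have difference_eq : ∫ σ in Set.Ioc (0 : ℝ) 1, f σ = v (G.mul ξ (G.expX i t)) - v ξ := by
    rw [← intervalIntegral.integral_of_le zero_le_one,
      intervalIntegral.integral_eq_sub_of_hasDerivAt
        (f := fun σ => v (G.mul ξ (G.expX i (t * σ)))) (fun σ _ => ?_)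
        (continuous_f.intervalIntegrable 0 1)]
    · simp only [mul_one, mul_zero, mul_expX_zero]
    · have chain_rule := HasDerivAt.comp (h := fun σ => t * σ) σ
        (hasDerivAt_X (G := G) (ξ := ξ) (i := i) (hv.differentiable one_ne_zero _))
        ((hasDerivAt_id σ).const_mul t)
      rwa [mul_one, mul_comm] at chain_rule
  have : IsProbabilityMeasure (volume.restrict (Set.Ioc (0 : ℝ) 1)) := ⟨by simp⟩
  have jensen := (even_two.convexOn_pow (𝕜 := ℝ)).map_integral_le
    (by fun_prop) isClosed_univ (.of_forall fun _ => Set.mem_univ _)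
    (continuous_f.intervalIntegrable 0 1).1 integrable_sq
  rw [difference_eq] at jensen
  refine (ENNReal.ofReal_le_ofReal jensen).trans_eq ?_
  rw [ofReal_integral_eq_lintegral_ofReal integrable_sq (.of_forall fun σ => sq_nonneg _)]
  simp only [hf, mul_pow]

theorem continuous_mul_right (η : Coord m) : Continuous fun ξ => G.mul ξ η :=
  G.continuous_mul continuous_id continuous_const

theorem continuous_mul_left (η : Coord m) : Continuous fun ξ => G.mul η ξ :=
  G.continuous_mul continuous_const continuous_id

theorem measurable_sq_sub_mul_right {v : Coord m → ℝ} (hv : Continuous v) (η : Coord m) :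
    Measurable fun ξ => ENNReal.ofReal ((v (G.mul ξ η) - v ξ) ^ 2) :=
  (((hv.comp (continuous_mul_right η)).sub hv).pow 2).measurable.ennreal_ofReal

variable {μ : Measure (Coord m)}

theorem IsHaar.lintegral_mul_right (hμ : G.IsHaar μ) (η : Coord m) {f : Coord m → ℝ≥0∞}
    (hf : Measurable f) : ∫⁻ ξ, f (G.mul ξ η) ∂μ = ∫⁻ ξ, f ξ ∂μ :=
  (hμ.right_invariant η).lintegral_comp hf

theorem IsHaar.lintegral_mul_left (hμ : G.IsHaar μ) (η : Coord m) {f : Coord m → ℝ≥0∞}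
    (hf : Measurable f) : ∫⁻ ξ, f (G.mul η ξ) ∂μ = ∫⁻ ξ, f ξ ∂μ :=
  (hμ.left_invariant η).lintegral_comp hf

theorem IsHaar.lintegral_sq_sub_expX_le (hμ : G.IsHaar μ) {v : Coord m → ℝ} (hv : ContDiff ℝ 1 v)
    (i : Fin G.rank) (t : ℝ) :
    ∫⁻ ξ, ENNReal.ofReal ((v (G.mul ξ (G.expX i t)) - v ξ) ^ 2) ∂μ ≤
      ENNReal.ofReal (t ^ 2) * ∫⁻ ξ, ENNReal.ofReal (G.X i v ξ ^ 2) ∂μ := by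
  have := hμ.sigmaFinite
  have continuous_Xv := continuous_X hv i
  have continuous_integrand : Continuous fun p : Coord m × ℝ =>
      t ^ 2 * G.X i v (G.mul p.1 (G.expX i (t * p.2))) ^ 2 :=
    continuous_const.mul ((continuous_Xv.comp ((G.continuous_mul_expX i).comp
      (continuous_fst.prodMk (continuous_const.mul continuous_snd)))).pow 2)
  calc ∫⁻ ξ, ENNReal.ofReal ((v (G.mul ξ (G.expX i t)) - v ξ) ^ 2) ∂μ
      ≤ ∫⁻ ξ, ∫⁻ σ in Set.Ioc (0 : ℝ) 1,
          ENNReal.ofReal (t ^ 2 * G.X i v (G.mul ξ (G.expX i (t * σ))) ^ 2) ∂volume ∂μ :=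
        lintegral_mono fun ξ => ofReal_sq_sub_expX_le_lintegral hv ξ i t
    _ = ∫⁻ σ in Set.Ioc (0 : ℝ) 1, ∫⁻ ξ,
          ENNReal.ofReal (t ^ 2 * G.X i v (G.mul ξ (G.expX i (t * σ))) ^ 2) ∂μ :=
        lintegral_lintegral_swap continuous_integrand.measurable.ennreal_ofReal.aemeasurable
    _ = ∫⁻ _ in Set.Ioc (0 : ℝ) 1, ∫⁻ ξ, ENNReal.ofReal (t ^ 2 * G.X i v ξ ^ 2) ∂μ :=
        lintegral_congr fun σ => hμ.lintegral_mul_right _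
          (f := fun ξ => ENNReal.ofReal (t ^ 2 * G.X i v ξ ^ 2))
          (continuous_const.mul (continuous_Xv.pow 2)).measurable.ennreal_ofReal
    _ = ENNReal.ofReal (t ^ 2) * ∫⁻ ξ, ENNReal.ofReal (G.X i v ξ ^ 2) ∂μ := by
        rw [setLIntegral_const, Real.volume_Ioc, sub_zero, ENNReal.ofReal_one, mul_one]
        simp only [ENNReal.ofReal_mul (sq_nonneg t)]
        exact lintegral_const_mul _ (continuous_Xv.pow 2).measurable.ennreal_ofReal

theorem IsHaar.lintegral_sq_sub_mul_le (hμ : G.IsHaar μ) {v : Coord m → ℝ} (hv : Continuous v)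
    (η ζ : Coord m) :
    ∫⁻ ξ, ENNReal.ofReal ((v (G.mul ξ (G.mul η ζ)) - v ξ) ^ 2) ∂μ ≤
      2 * (∫⁻ ξ, ENNReal.ofReal ((v (G.mul ξ ζ) - v ξ) ^ 2) ∂μ +
        ∫⁻ ξ, ENNReal.ofReal ((v (G.mul ξ η) - v ξ) ^ 2) ∂μ) := by
  have pointwise : ∀ ξ, ENNReal.ofReal ((v (G.mul ξ (G.mul η ζ)) - v ξ) ^ 2) ≤
      2 * (ENNReal.ofReal ((v (G.mul (G.mul ξ η) ζ) - v (G.mul ξ η)) ^ 2) +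
        ENNReal.ofReal ((v (G.mul ξ η) - v ξ) ^ 2)) := by
    intro ξ
    rw [← ENNReal.ofReal_add (sq_nonneg _) (sq_nonneg _), ← ENNReal.ofReal_ofNat,
      ← ENNReal.ofReal_mul zero_le_two, ← mul_assoc',
      ← sub_add_sub_cancel (v (G.mul (G.mul ξ η) ζ)) (v (G.mul ξ η))]
    exact ENNReal.ofReal_le_ofReal add_sq_le
  have measurable_ζ := measurable_sq_sub_mul_right (G := G) hv ζ
  refine (lintegral_mono pointwise).trans_eq ?_
  rw [lintegral_const_mul' _ _ ENNReal.ofNat_ne_top,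
    lintegral_add_right _ (measurable_sq_sub_mul_right hv η),
    hμ.lintegral_mul_right η measurable_ζ]

variable (G) in
/-- The squared length of the horizontal gradient. -/
def gradSq (v : Coord m → ℝ) (ξ : Coord m) : ℝ := ∑ i : Fin G.rank, G.X i v ξ ^ 2

theorem gradSq_nonneg (v : Coord m → ℝ) (ξ : Coord m) : 0 ≤ G.gradSq v ξ :=
  Finset.sum_nonneg fun _ _ => sq_nonneg _

theorem continuous_gradSq {v : Coord m → ℝ} (hv : ContDiff ℝ 1 v) : Continuous (G.gradSq v) :=
  continuous_finsetSum _ fun i _ => (continuous_X hv i).pow 2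

theorem sq_X_le_gradSq (v : Coord m → ℝ) (i : Fin G.rank) (ξ : Coord m) :
    G.X i v ξ ^ 2 ≤ G.gradSq v ξ :=
  Finset.single_le_sum (f := fun i => G.X i v ξ ^ 2) (fun _ _ => sq_nonneg _) (Finset.mem_univ i)

theorem IsHaar.lintegral_sq_sub_le (hμ : G.IsHaar μ) {v : Coord m → ℝ} (hv : ContDiff ℝ 1 v)
    {n : ℕ} {r : ℝ} {η : Coord m} (hη : η ∈ G.horizontalProducts n r) :
    ∫⁻ ξ, ENNReal.ofReal ((v (G.mul ξ η) - v ξ) ^ 2) ∂μ ≤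
      ENNReal.ofReal (4 ^ n * r ^ 2) * ∫⁻ ξ, ENNReal.ofReal (G.gradSq v ξ) ∂μ := by
  induction n generalizing η with
  | zero =>
    rw [show η = 0 from hη]
    simp [mul_zero']
  | succ n ih =>
    obtain ⟨η, hη, i, t, ht, rfl⟩ := hη
    have sq_t_le : t ^ 2 ≤ r ^ 2 := sq_le_sq.2 (ht.trans (le_abs_self r))
    have one_factor := hμ.lintegral_sq_sub_expX_le hv i t
    set D := ∫⁻ ξ, ENNReal.ofReal (G.gradSq v ξ) ∂μ
    calc ∫⁻ ξ, ENNReal.ofReal ((v (G.mul ξ (G.mul η (G.expX i t))) - v ξ) ^ 2) ∂μ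
        ≤ 2 * (∫⁻ ξ, ENNReal.ofReal ((v (G.mul ξ (G.expX i t)) - v ξ) ^ 2) ∂μ +
            ∫⁻ ξ, ENNReal.ofReal ((v (G.mul ξ η) - v ξ) ^ 2) ∂μ) :=
          hμ.lintegral_sq_sub_mul_le hv.continuous η _
      _ ≤ 2 * (ENNReal.ofReal (r ^ 2) * D + ENNReal.ofReal (4 ^ n * r ^ 2) * D) := by
          gcongr
          · refine one_factor.trans ?_
            gcongr
            exact lintegral_mono fun ξ => ENNReal.ofReal_le_ofReal (sq_X_le_gradSq v i ξ)
          · exact ih hη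
      _ = ENNReal.ofReal (2 * (r ^ 2 + 4 ^ n * r ^ 2)) * D := by
          rw [← add_mul, ← ENNReal.ofReal_add (by positivity) (by positivity), ← mul_assoc,
            ENNReal.ofReal_mul zero_le_two, ENNReal.ofReal_ofNat]
      _ ≤ ENNReal.ofReal (4 ^ (n + 1) * r ^ 2) * D := by
          gcongr ENNReal.ofReal ?_ * D
          have one_le : (1 : ℝ) ≤ 4 ^ n := one_le_pow₀ (by norm_num)
          rw [pow_succ (4 : ℝ) n]
          nlinarith [sq_nonneg r]

theorem isCompact_horizontalProducts (n : ℕ) (r : ℝ) : IsCompact (G.horizontalProducts n r) := by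
  induction n with
  | zero => exact isCompact_singleton
  | succ n ih =>
    have eq_iUnion_image : G.horizontalProducts (n + 1) r = ⋃ i : Fin G.rank,
        (fun p : Coord m × ℝ => G.mul p.1 (G.expX i p.2)) ''
          (G.horizontalProducts n r ×ˢ Set.Icc (-r) r) := by
      ext ζ
      simp only [horizontalProducts, Set.mem_ofPred_eq, Set.mem_iUnion, Set.mem_image,
        Set.mem_prod, Set.mem_Icc, Prod.exists, ← abs_le]
      tauto
    rw [eq_iUnion_image]
    exact isCompact_iUnion fun i => (ih.prod isCompact_Icc).image (G.continuous_mul_expX i)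

theorem dilation_mem_horizontalProducts {a : ℝ} (ha : 0 ≤ a) {n : ℕ} {r : ℝ} {ξ : Coord m}
    (hξ : ξ ∈ G.horizontalProducts n r) : G.dilation a ξ ∈ G.horizontalProducts n (a * r) := by
  induction n generalizing ξ with
  | zero =>
    rw [show ξ = 0 from hξ, map_zero]
    rfl
  | succ n ih =>
    obtain ⟨ξ, hξ, i, t, ht, rfl⟩ := hξ
    refine ⟨_, ih hξ, i, a * t, ?_, ?_⟩
    · rw [abs_mul, abs_of_nonneg ha]
      exact mul_le_mul_of_nonneg_left ht ha
    · rw [dilation_mul, dilation_expX]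

theorem IsHaar.exists_horizontalProducts_measure_pos (hμ : G.IsHaar μ) :
    ∃ n r, 0 < μ (G.horizontalProducts n r) := by
  by_contra! null
  refine hμ.ne_zero ?_
  rw [← Measure.measure_univ_eq_zero, ← G.iUnion_horizontalProducts, measure_iUnion_null_iff]
  exact fun p => le_zero_iff.1 (null _ _)

theorem homDim_pos (G : CarnotGroup 𝔤 s m) : 0 < G.homDim := by
  by_contra! homDim_nonpos
  have homDim_eq_zero : ∑ l : Fin s, ((l : ℕ) + 1) * m l = 0 := Nat.le_zero.1 homDim_nonpos
  have one_le_step := G.one_le_step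
  have last_eq_zero : m ⟨s - 1, by omega⟩ = 0 := by
    simpa using Finset.sum_eq_zero_iff.1 homDim_eq_zero ⟨s - 1, by omega⟩ (Finset.mem_univ _)
  refine G.top_ne_bot ((Submodule.eq_bot_iff _).2 fun z hz => ?_)
  rw [← G.homogeneous_eq_layer one_le_step le_rfl] at hz
  rw [← G.toLie.symm.map_eq_zero_iff]
  ext j
  by_cases hj : (j.1 : ℕ) + 1 = s
  · have fst_eq : j.1 = ⟨s - 1, by omega⟩ := Fin.ext (by simp only; omega)
    have snd_index := j.2
    rw [fst_eq, last_eq_zero] at snd_index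
    exact snd_index.elim0
  · exact hz j hj

theorem IsHaar.exists_subset_horizontalProducts_measure_eq (hμ : G.IsHaar μ) :
    ∃ (n : ℕ) (C : ℝ), 0 < C ∧ ∀ S : ℝ, 0 < S → ∃ r : ℝ, ∃ A ⊆ G.horizontalProducts n r,
      r ^ 2 ≤ C * S ^ (2 / (G.homDim : ℝ)) ∧ MeasurableSet A ∧ μ A = ENNReal.ofReal S := by
  obtain ⟨n, r₀, measure_pos⟩ := hμ.exists_horizontalProducts_measure_pos
  set A := G.horizontalProducts n r₀
  have isCompact_A : IsCompact A := isCompact_horizontalProducts n r₀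
  have measure_ne_top : μ A ≠ ∞ := (hμ.finite_of_isCompact A isCompact_A).ne
  set a := (μ A).toReal
  have a_pos : 0 < a := ENNReal.toReal_pos measure_pos.ne' measure_ne_top
  have homDim_ne_zero : (G.homDim : ℝ) ≠ 0 := by exact_mod_cast (homDim_pos G).ne'
  refine ⟨n, (r₀ ^ 2 + 1) * (1 / a) ^ (2 / (G.homDim : ℝ)), by positivity, fun S hS => ?_⟩
  set ρ : ℝ := (S / a) ^ (1 / (G.homDim : ℝ)) with hρ
  have ρ_nonneg : 0 ≤ ρ := by positivity
  have ρ_pow_homDim : ρ ^ G.homDim = S / a := by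
    rw [hρ, ← Real.rpow_natCast, ← Real.rpow_mul (by positivity), one_div,
      inv_mul_cancel₀ homDim_ne_zero, Real.rpow_one]
  have ρ_sq : ρ ^ 2 = (1 / a) ^ (2 / (G.homDim : ℝ)) * S ^ (2 / (G.homDim : ℝ)) := by
    rw [← Real.mul_rpow (by positivity) hS.le, hρ, ← Real.rpow_natCast,
      ← Real.rpow_mul (by positivity)]
    congr 1 <;> push_cast <;> ring
  refine ⟨ρ * r₀, G.dilation ρ '' A, ?_, ?_, ?_, ?_⟩
  · rintro _ ⟨ξ, hξ, rfl⟩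
    exact dilation_mem_horizontalProducts ρ_nonneg hξ
  · rw [mul_assoc, ← ρ_sq]
    nlinarith [sq_nonneg ρ]
  · exact (isCompact_A.image (G.contDiff_dilation ρ (n := 0)).continuous).measurableSet
  · rw [hμ.measure_dilation_image ρ_nonneg, ρ_pow_homDim, ← ENNReal.ofReal_toReal measure_ne_top,
      ← ENNReal.ofReal_mul (by positivity), div_mul_cancel₀ _ a_pos.ne']

theorem IsHaar.lintegral_sq_le_add_lintegral_mul (hμ : G.IsHaar μ) {v : Coord m → ℝ}
    (hv : ContDiff ℝ 1 v) (hv0 : ∀ ξ, 0 ≤ v ξ) {n : ℕ} {r : ℝ} {η : Coord m}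
    (hη : η ∈ G.horizontalProducts n r) :
    ∫⁻ ξ, ENNReal.ofReal (v ξ ^ 2) ∂μ ≤
      ENNReal.ofReal (4 ^ n * r ^ 2) * ∫⁻ ξ, ENNReal.ofReal (G.gradSq v ξ) ∂μ +
        2 * ∫⁻ ξ, ENNReal.ofReal (v ξ) * ENNReal.ofReal (v (G.mul ξ η)) ∂μ := by
  have pointwise : ∀ ξ, ENNReal.ofReal (v ξ ^ 2) ≤ ENNReal.ofReal ((v (G.mul ξ η) - v ξ) ^ 2) +
      2 * (ENNReal.ofReal (v ξ) * ENNReal.ofReal (v (G.mul ξ η))) := by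
    intro ξ
    have product_nonneg := mul_nonneg (hv0 ξ) (hv0 (G.mul ξ η))
    rw [← ENNReal.ofReal_mul (hv0 ξ), ← ENNReal.ofReal_ofNat, ← ENNReal.ofReal_mul zero_le_two,
      ← ENNReal.ofReal_add (by positivity) (by positivity)]
    refine ENNReal.ofReal_le_ofReal ?_
    nlinarith [sq_nonneg (v (G.mul ξ η))]
  refine (lintegral_mono pointwise).trans ?_
  rw [lintegral_add_left (measurable_sq_sub_mul_right hv.continuous η),
    lintegral_const_mul' _ _ ENNReal.ofNat_ne_top]
  gcongr
  exact hμ.lintegral_sq_sub_le hv hη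

theorem IsHaar.lintegral_lintegral_mul_mul (hμ : G.IsHaar μ) {f : Coord m → ℝ≥0∞}
    (hf : Measurable f) : ∫⁻ η, ∫⁻ ξ, f ξ * f (G.mul ξ η) ∂μ ∂μ = (∫⁻ ξ, f ξ ∂μ) ^ 2 := by
  have := hμ.sigmaFinite
  have measurable_mul_swap : Measurable fun p : Coord m × Coord m => G.mul p.2 p.1 :=
    (G.continuous_mul continuous_snd continuous_fst).measurable
  calc ∫⁻ η, ∫⁻ ξ, f ξ * f (G.mul ξ η) ∂μ ∂μ
      = ∫⁻ ξ, ∫⁻ η, f ξ * f (G.mul ξ η) ∂μ ∂μ :=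
        lintegral_lintegral_swap
          ((hf.comp measurable_snd).mul (hf.comp measurable_mul_swap)).aemeasurable
    _ = ∫⁻ ξ, f ξ * ∫⁻ η, f η ∂μ ∂μ := by
        refine lintegral_congr fun ξ => ?_
        have measurable_translate : Measurable fun η => f (G.mul ξ η) :=
          hf.comp (continuous_mul_left ξ).measurable
        rw [lintegral_const_mul _ measurable_translate, hμ.lintegral_mul_left ξ hf]
    _ = (∫⁻ ξ, f ξ ∂μ) ^ 2 := by rw [lintegral_mul_const _ hf, sq]

theorem IsHaar.measure_mul_lintegral_sq_le (hμ : G.IsHaar μ) {v : Coord m → ℝ}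
    (hv : ContDiff ℝ 1 v) (hv0 : ∀ ξ, 0 ≤ v ξ) {n : ℕ} {r : ℝ} {A : Set (Coord m)}
    (hA : MeasurableSet A) (hAr : A ⊆ G.horizontalProducts n r) :
    μ A * ∫⁻ ξ, ENNReal.ofReal (v ξ ^ 2) ∂μ ≤
      μ A * (ENNReal.ofReal (4 ^ n * r ^ 2) * ∫⁻ ξ, ENNReal.ofReal (G.gradSq v ξ) ∂μ) +
        2 * (∫⁻ ξ, ENNReal.ofReal (v ξ) ∂μ) ^ 2 := by
  set E := ENNReal.ofReal (4 ^ n * r ^ 2) * ∫⁻ ξ, ENNReal.ofReal (G.gradSq v ξ) ∂μ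
  calc μ A * ∫⁻ ξ, ENNReal.ofReal (v ξ ^ 2) ∂μ
      = ∫⁻ _ in A, ∫⁻ ξ, ENNReal.ofReal (v ξ ^ 2) ∂μ ∂μ := by
        rw [setLIntegral_const, mul_comm]
    _ ≤ ∫⁻ η in A, (E + 2 * ∫⁻ ξ, ENNReal.ofReal (v ξ) * ENNReal.ofReal (v (G.mul ξ η)) ∂μ) ∂μ :=
        setLIntegral_mono' hA fun η hη => hμ.lintegral_sq_le_add_lintegral_mul hv hv0 (hAr hη)
    _ = μ A * E +
        2 * ∫⁻ η in A, ∫⁻ ξ, ENNReal.ofReal (v ξ) * ENNReal.ofReal (v (G.mul ξ η)) ∂μ ∂μ := by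
        rw [lintegral_add_left measurable_const, setLIntegral_const, mul_comm E,
          lintegral_const_mul' _ _ ENNReal.ofNat_ne_top]
    _ ≤ μ A * E + 2 * (∫⁻ ξ, ENNReal.ofReal (v ξ) ∂μ) ^ 2 := by
        rw [← hμ.lintegral_lintegral_mul_mul hv.continuous.measurable.ennreal_ofReal]
        gcongr
        exact Measure.restrict_le_self

theorem IsHaar.lintegral_sq_le_of_four_mul_measure_le (hμ : G.IsHaar μ) {v : Coord m → ℝ}
    (hv : ContDiff ℝ 1 v) (hv0 : ∀ ξ, 0 ≤ v ξ) {n : ℕ} {r : ℝ} {A : Set (Coord m)}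
    (hA : MeasurableSet A) (hAr : A ⊆ G.horizontalProducts n r) (measure_ne_zero : μ A ≠ 0)
    (measure_ne_top : μ A ≠ ∞) (four_mul_measure_le : 4 * μ {ξ | v ξ ≠ 0} ≤ μ A)
    (hfin : ∫⁻ ξ, ENNReal.ofReal (v ξ ^ 2) ∂μ ≠ ∞) :
    ∫⁻ ξ, ENNReal.ofReal (v ξ ^ 2) ∂μ ≤
      2 * (ENNReal.ofReal (4 ^ n * r ^ 2) * ∫⁻ ξ, ENNReal.ofReal (G.gradSq v ξ) ∂μ) := by
  have nash := hμ.measure_mul_lintegral_sq_le hv hv0 hA hAr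
  have cauchy_schwarz :=
    sq_lintegral_le_measure_mul_lintegral_sq μ hv.continuous.measurable.ennreal_ofReal
  have support_eq : {ξ | ENNReal.ofReal (v ξ) ≠ 0} = {ξ | v ξ ≠ 0} :=
    Set.ext fun ξ => not_congr (ENNReal.ofReal_eq_zero.trans (hv0 ξ).ge_iff_eq')
  simp only [support_eq, ← ENNReal.ofReal_pow (hv0 _)] at cauchy_schwarz
  set I := ∫⁻ ξ, ENNReal.ofReal (v ξ ^ 2) ∂μ
  set E := ENNReal.ofReal (4 ^ n * r ^ 2) * ∫⁻ ξ, ENNReal.ofReal (G.gradSq v ξ) ∂μ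
  have doubled : μ A * (I + I) ≤ μ A * (2 * E + I) := by
    calc μ A * (I + I) = 2 * (μ A * I) := by ring
      _ ≤ 2 * (μ A * E + 2 * (μ {ξ | v ξ ≠ 0} * I)) := by
        gcongr
        exact nash.trans (by gcongr)
      _ = 2 * (μ A * E) + 4 * μ {ξ | v ξ ≠ 0} * I := by ring
      _ ≤ 2 * (μ A * E) + μ A * I := by gcongr
      _ = μ A * (2 * E + I) := by ring
  exact (ENNReal.add_le_add_iff_right hfin).1
    ((ENNReal.mul_le_mul_iff_right measure_ne_zero measure_ne_top).1 doubled)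

/-- The Faber–Krahn inequality on `G` with constant `C`: a nonnegative function that vanishes off a
set of finite measure has its `L²` norm controlled by its horizontal gradient. -/
def FaberKrahnInequality (G : CarnotGroup 𝔤 s m) (μ : Measure (Coord m)) (C : ℝ) : Prop :=
  ∀ (v : Coord m → ℝ) (S : ℝ), ContDiff ℝ 1 v → (∀ ξ, 0 ≤ v ξ) → 0 < S →
    μ {ξ | v ξ ≠ 0} ≤ ENNReal.ofReal S → ∫⁻ ξ, ENNReal.ofReal (v ξ ^ 2) ∂μ ≠ ∞ →
    ∫⁻ ξ, ENNReal.ofReal (v ξ ^ 2) ∂μ ≤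
      ENNReal.ofReal (C * S ^ (2 / (G.homDim : ℝ))) * ∫⁻ ξ, ENNReal.ofReal (G.gradSq v ξ) ∂μ

theorem IsHaar.exists_faberKrahnInequality (hμ : G.IsHaar μ) :
    ∃ C : ℝ, 0 < C ∧ G.FaberKrahnInequality μ C := by
  obtain ⟨n, C, hC, exists_set⟩ := hμ.exists_subset_horizontalProducts_measure_eq
  set α := 2 / (G.homDim : ℝ)
  refine ⟨2 * (4 ^ n * (C * 4 ^ α)), by positivity, fun v S hv hv0 hS measure_le hfin => ?_⟩
  obtain ⟨r, A, hAr, sq_r_le, hA, measure_A⟩ := exists_set (4 * S) (by positivity)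
  have four_mul_measure_le : 4 * μ {ξ | v ξ ≠ 0} ≤ μ A := by
    rw [measure_A, ENNReal.ofReal_mul (by norm_num), ENNReal.ofReal_ofNat]
    gcongr
  refine (hμ.lintegral_sq_le_of_four_mul_measure_le hv hv0 hA hAr (by simp [measure_A, hS])
    (measure_A ▸ ENNReal.ofReal_ne_top) four_mul_measure_le hfin).trans ?_
  rw [← mul_assoc, ← ENNReal.ofReal_ofNat, ← ENNReal.ofReal_mul zero_le_two]
  gcongr ENNReal.ofReal ?_ * _
  rw [Real.mul_rpow (by norm_num) hS.le] at sq_r_le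
  calc 2 * (4 ^ n * r ^ 2) ≤ 2 * (4 ^ n * (C * (4 ^ α * S ^ α))) := by gcongr
    _ = 2 * (4 ^ n * (C * 4 ^ α)) * S ^ α := by ring

end CarnotGroup

open Filter Topology

/-! ### Truncations -/

theorem hasDerivAt_max_zero_pow (n : ℕ) (τ : ℝ) :
    HasDerivAt (fun τ : ℝ => max τ 0 ^ (n + 2)) ((n + 2) * max τ 0 ^ (n + 1)) τ := by
  rcases lt_trichotomy τ 0 with τ_neg | rfl | τ_pos
  · rw [max_eq_right τ_neg.le, zero_pow n.succ_ne_zero, mul_zero]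
    refine (hasDerivAt_const τ (0 : ℝ)).congr_of_eventuallyEq ?_
    filter_upwards [gt_mem_nhds τ_neg] with σ hσ
    rw [max_eq_right hσ.le, zero_pow (by omega)]
  · rw [max_self, zero_pow n.succ_ne_zero, mul_zero, hasDerivAt_iff_tendsto_slope]
    have tendsto_pow : Tendsto (fun σ : ℝ => max σ 0 ^ (n + 1)) (𝓝 0) (𝓝 0) := by
      have continuous_pow : Continuous fun σ : ℝ => max σ 0 ^ (n + 1) := by fun_prop
      simpa using continuous_pow.tendsto 0
    refine (tendsto_pow.mono_left nhdsWithin_le_nhds).congr' ?_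
    filter_upwards [self_mem_nhdsWithin] with σ (hσ : σ ≠ 0)
    rcases le_total σ 0 with σ_nonpos | σ_nonneg
    · simp [slope, max_eq_right σ_nonpos]
    · simp [slope, max_eq_left σ_nonneg, pow_succ' σ (n + 1), hσ]
  · rw [max_eq_left τ_pos.le]
    refine HasDerivAt.congr_of_eventuallyEq (by simpa using hasDerivAt_pow (n + 2) τ) ?_
    filter_upwards [lt_mem_nhds τ_pos] with σ hσ
    rw [max_eq_left hσ.le]

theorem contDiff_max_zero_pow (n : ℕ) : ContDiff ℝ n fun τ : ℝ => max τ 0 ^ (n + 1) := by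
  induction n with
  | zero =>
    rw [Nat.cast_zero, contDiff_zero]
    fun_prop
  | succ n ih =>
    push_cast
    rw [contDiff_succ_iff_deriv, funext fun τ => (hasDerivAt_max_zero_pow n τ).deriv]
    exact ⟨fun τ => (hasDerivAt_max_zero_pow n τ).differentiableAt,
      fun h => absurd h (by simp), contDiff_const.mul ih⟩

namespace CarnotGroup

variable {𝔤 : Type*} [LieRing 𝔤] [LieAlgebra ℝ 𝔤] {s : ℕ} {m : Fin s → ℕ}
  {G : CarnotGroup 𝔤 s m}

attribute [local irreducible] CarnotGroup.mul

/-- The function `(u - k)⁺`, extended by zero outside `Ω`. -/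
def excess (Ω : Set (Coord m)) (u : Coord m → ℝ) (k : ℝ) : Coord m → ℝ :=
  Ω.indicator fun ξ => max (u ξ - k) 0

section

variable {Ω : Set (Coord m)} {u : Coord m → ℝ} {k : ℝ}

theorem excess_of_mem {ξ : Coord m} (hξ : ξ ∈ Ω) : excess Ω u k ξ = max (u ξ - k) 0 :=
  Set.indicator_of_mem hξ _

theorem excess_of_notMem {ξ : Coord m} (hξ : ξ ∉ Ω) : excess Ω u k ξ = 0 :=
  Set.indicator_of_notMem hξ _

theorem excess_nonneg (ξ : Coord m) : 0 ≤ excess Ω u k ξ :=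
  Set.indicator_nonneg (fun _ _ => le_max_right _ _) ξ

theorem excess_eq_zero {ξ : Coord m} (hξ : ξ ∉ {ξ ∈ Ω | k < u ξ}) : excess Ω u k ξ = 0 := by
  by_cases ξ_mem : ξ ∈ Ω
  · rw [excess_of_mem ξ_mem, max_eq_right]
    exact sub_nonpos.2 (not_lt.1 fun k_lt => hξ ⟨ξ_mem, k_lt⟩)
  · exact excess_of_notMem ξ_mem

theorem excess_pow_eventuallyEq (hΩ : IsOpen Ω) {ξ : Coord m} (hξ : ξ ∈ Ω) (p : ℕ) :
    (fun ξ => excess Ω u k ξ ^ p) =ᶠ[𝓝 ξ] fun η => max (u η - k) 0 ^ p := by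
  filter_upwards [hΩ.mem_nhds hξ] with η hη
  rw [excess_of_mem hη]

theorem excess_pow_eventuallyEq_zero (hΩ : IsOpen Ω) (hu : ContinuousOn u (closure Ω))
    (hk : ∀ ξ ∈ frontier Ω, u ξ < k) {ξ : Coord m} (hξ : ξ ∉ Ω) {p : ℕ} (hp : p ≠ 0) :
    (fun ξ => excess Ω u k ξ ^ p) =ᶠ[𝓝 ξ] fun _ => 0 := by
  suffices eventually_zero : ∀ᶠ η in 𝓝 ξ, excess Ω u k η = 0 from
    eventually_zero.mono fun η hη => by simp only [hη, zero_pow hp]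
  by_cases mem_closure : ξ ∈ closure Ω
  · have mem_frontier : ξ ∈ frontier Ω := ⟨mem_closure, by rwa [hΩ.interior_eq]⟩
    filter_upwards [eventually_nhdsWithin_iff.1
      ((hu ξ mem_closure).eventually_lt_const (hk ξ mem_frontier))] with η u_lt
    exact excess_eq_zero fun hη => (u_lt (subset_closure hη.1)).not_gt hη.2
  · filter_upwards [isClosed_closure.isOpen_compl.mem_nhds mem_closure] with η hη
    exact excess_of_notMem fun η_mem => hη (subset_closure η_mem)

theorem contDiff_excess_pow {n p : ℕ} (hΩ : IsOpen Ω) (hun : ContDiffOn ℝ n u Ω)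
    (hu : ContinuousOn u (closure Ω)) (hk : ∀ ξ ∈ frontier Ω, u ξ < k) (hp : n < p) :
    ContDiff ℝ n fun ξ => excess Ω u k ξ ^ p := by
  obtain ⟨p, rfl⟩ : ∃ q, p = q + 1 := ⟨p - 1, by omega⟩
  refine contDiff_iff_contDiffAt.2 fun ξ => ?_
  by_cases hξ : ξ ∈ Ω
  · have contDiff_pow : ContDiff ℝ n fun τ : ℝ => max τ 0 ^ (p + 1) :=
      (contDiff_max_zero_pow p).of_le (by exact_mod_cast Nat.le_of_lt_succ hp)
    exact (contDiff_pow.contDiffAt.comp ξ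
      ((hun.contDiffAt (hΩ.mem_nhds hξ)).sub contDiffAt_const)).congr_of_eventuallyEq
        (excess_pow_eventuallyEq hΩ hξ (p + 1))
  · exact contDiffAt_const.congr_of_eventuallyEq
      (excess_pow_eventuallyEq_zero hΩ hu hk hξ p.succ_ne_zero)

theorem X_excess_pow (hΩ : IsOpen Ω) (n : ℕ) {ξ : Coord m} (hξ : ξ ∈ Ω)
    (hu : DifferentiableAt ℝ u ξ) (i : Fin G.rank) :
    G.X i (fun ξ => excess Ω u k ξ ^ (n + 2)) ξ =
      (n + 2) * max (u ξ - k) 0 ^ (n + 1) * G.X i u ξ := by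
  rw [X_congr (excess_pow_eventuallyEq hΩ hξ (n + 2))]
  exact X_comp hu (θ := fun τ => max (τ - k) 0 ^ (n + 2))
    ((hasDerivAt_max_zero_pow n (u ξ - k)).comp_sub_const (u ξ) k) i

theorem X_X_excess_pow_four (hΩ : IsOpen Ω) (hu : ContDiffOn ℝ 2 u Ω) {ξ : Coord m} (hξ : ξ ∈ Ω)
    (i : Fin G.rank) :
    G.X i (G.X i fun ξ => excess Ω u k ξ ^ 4) ξ =
      12 * max (u ξ - k) 0 ^ 2 * G.X i u ξ ^ 2 +
        4 * max (u ξ - k) 0 ^ 3 * G.X i (G.X i u) ξ := by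
  have differentiableAt_of_mem : ∀ η ∈ Ω, DifferentiableAt ℝ u η := fun η hη =>
    (hu.contDiffAt (hΩ.mem_nhds hη)).differentiableAt two_ne_zero
  have X_pow_four : G.X i (fun ξ => excess Ω u k ξ ^ 4) =ᶠ[𝓝 ξ]
      fun η => 4 * max (u η - k) 0 ^ 3 * G.X i u η := by
    filter_upwards [hΩ.mem_nhds hξ] with η hη
    rw [X_excess_pow hΩ 2 hη (differentiableAt_of_mem η hη) i]
    norm_num
  have differentiableAt_X : DifferentiableAt ℝ (G.X i u) ξ :=
    ((contDiffOn_X hΩ hu i).contDiffAt (hΩ.mem_nhds hξ)).differentiableAt one_ne_zero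
  have hasDerivAt_cube : HasDerivAt (fun τ : ℝ => 4 * max (τ - k) 0 ^ 3)
      (12 * max (u ξ - k) 0 ^ 2) (u ξ) := by
    refine (((hasDerivAt_max_zero_pow 1 (u ξ - k)).comp_sub_const (u ξ) k).const_mul
      4).congr_deriv ?_
    push_cast
    ring
  have differentiableAt_cube : DifferentiableAt ℝ (fun η => 4 * max (u η - k) 0 ^ 3) ξ :=
    DifferentiableAt.comp (g := fun τ : ℝ => 4 * max (τ - k) 0 ^ 3) ξ
      hasDerivAt_cube.differentiableAt (differentiableAt_of_mem ξ hξ)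
  rw [X_congr X_pow_four, X_mul differentiableAt_cube differentiableAt_X,
    X_comp (differentiableAt_of_mem ξ hξ) hasDerivAt_cube]
  ring

theorem subLaplacian_excess_pow_four (hΩ : IsOpen Ω) (hu : ContDiffOn ℝ 2 u Ω) {ξ : Coord m}
    (hξ : ξ ∈ Ω) :
    G.subLaplacian (fun ξ => excess Ω u k ξ ^ 4) ξ =
      3 * G.gradSq (fun ξ => excess Ω u k ξ ^ 2) ξ +
        4 * excess Ω u k ξ ^ 3 * G.subLaplacian u ξ := by
  have X_sq : ∀ i : Fin G.rank, G.X i (fun ξ => excess Ω u k ξ ^ 2) ξ =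
      2 * max (u ξ - k) 0 * G.X i u ξ := fun i => by
    simpa using X_excess_pow hΩ 0 hξ
      ((hu.contDiffAt (hΩ.mem_nhds hξ)).differentiableAt two_ne_zero) i
  simp only [subLaplacian, gradSq, X_X_excess_pow_four hΩ hu hξ, X_sq, excess_of_mem hξ,
    Finset.mul_sum, ← Finset.sum_add_distrib]
  exact Finset.sum_congr rfl fun i _ => by ring

theorem gradSq_excess_sq_of_notMem (hΩ : IsOpen Ω) (hu : ContinuousOn u (closure Ω))
    (hk : ∀ ξ ∈ frontier Ω, u ξ < k) {ξ : Coord m} (hξ : ξ ∉ Ω) :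
    G.gradSq (fun ξ => excess Ω u k ξ ^ 2) ξ = 0 := by
  simp only [gradSq, X_congr (excess_pow_eventuallyEq_zero hΩ hu hk hξ two_ne_zero), X_const]
  simp

end

end CarnotGroup

/-! ### The energy estimate -/

namespace CarnotGroup

variable {𝔤 : Type*} [LieRing 𝔤] [LieAlgebra ℝ 𝔤] {s : ℕ} {m : Fin s → ℕ}
  {G : CarnotGroup 𝔤 s m}

attribute [local irreducible] CarnotGroup.mul

theorem exists_cutoff (G : CarnotGroup 𝔤 s m) : ∃ (χ : Coord m → ℝ) (B : ℝ),
    ContDiff ℝ 2 χ ∧ HasCompactSupport χ ∧ (∀ ξ, χ ξ ∈ Set.Icc 0 1) ∧ χ 0 = 1 ∧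
      ∀ ξ, |G.subLaplacian χ ξ| ≤ B := by
  let χ : ContDiffBump (0 : Coord m) := ⟨1, 2, one_pos, one_lt_two⟩
  have hasCompactSupport_subLaplacian : HasCompactSupport (G.subLaplacian χ) :=
    .of_support_subset_isCompact χ.hasCompactSupport fun ξ hξ => not_imp_comm.1
      (fun ξ_notMem => subLaplacian_eq_zero (notMem_tsupport_iff_eventuallyEq.1 ξ_notMem)) hξ
  obtain ⟨B, hB⟩ := hasCompactSupport_subLaplacian.exists_bound_of_continuous
    (continuous_subLaplacian χ.contDiff)
  exact ⟨χ, B, χ.contDiff, χ.hasCompactSupport, fun ξ => ⟨χ.nonneg, χ.le_one⟩,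
    χ.one_of_mem_closedBall (by simp [χ]), hB⟩

theorem hasCompactSupport_comp_dilation {χ : Coord m → ℝ} (hχ : HasCompactSupport χ) {a : ℝ}
    (ha : 0 < a) : HasCompactSupport fun ξ => χ (G.dilation a ξ) :=
  .of_support_subset_isCompact (hχ.isCompact.image (G.contDiff_dilation a⁻¹ (n := 0)).continuous)
    fun ξ hξ => ⟨G.dilation a ξ, subset_tsupport _ hξ, by
      rw [dilation_dilation, inv_mul_cancel₀ ha.ne', dilation_one]⟩

/-- `u` is a classical subsolution of `Lu = -F` on the open set `Ω`, continuous up to the boundary;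
the differential inequality is only required almost everywhere. -/
structure IsSubsolution (G : CarnotGroup 𝔤 s m) (μ : Measure (Coord m)) (Ω : Set (Coord m)) (F : ℝ)
    (u : Coord m → ℝ) : Prop where
  isOpen : IsOpen Ω
  contDiffOn : ContDiffOn ℝ 2 u Ω
  continuousOn_closure : ContinuousOn u (closure Ω)
  neg_le_subLaplacian : ∀ᵐ ξ ∂(μ.restrict Ω), -F ≤ G.subLaplacian u ξ

variable {μ : Measure (Coord m)} {Ω : Set (Coord m)} {u : Coord m → ℝ} {k F : ℝ}

namespace IsSubsolution

theorem isOpen_superlevel (hu : G.IsSubsolution μ Ω F u) (k : ℝ) : IsOpen {ξ ∈ Ω | k < u ξ} :=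
  hu.contDiffOn.continuousOn.isOpen_inter_preimage hu.isOpen isOpen_Ioi

theorem continuous_excess (hu : G.IsSubsolution μ Ω F u) (hk : ∀ ξ ∈ frontier Ω, u ξ < k) :
    Continuous (excess Ω u k) := by
  simpa using (contDiff_excess_pow (n := 0) hu.isOpen (hu.contDiffOn.of_le zero_le)
    hu.continuousOn_closure hk one_pos).continuous

theorem contDiff_excess_sq (hu : G.IsSubsolution μ Ω F u) (hk : ∀ ξ ∈ frontier Ω, u ξ < k) :
    ContDiff ℝ 1 fun ξ => excess Ω u k ξ ^ 2 := by
  exact_mod_cast contDiff_excess_pow (n := 1) hu.isOpen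
    (hu.contDiffOn.of_le (by exact_mod_cast one_le_two)) hu.continuousOn_closure hk one_lt_two

theorem integrable_excess_pow (hu : G.IsSubsolution μ Ω F u) (hΩ : μ Ω < ∞)
    (bddAbove : BddAbove (u '' Ω)) (hk : ∀ ξ ∈ frontier Ω, u ξ < k) {p : ℕ} (hp : p ≠ 0) :
    Integrable (fun ξ => excess Ω u k ξ ^ p) μ := by
  obtain ⟨M, hM⟩ := bddAbove
  have integrable_bound : Integrable (Ω.indicator fun _ => max (M - k) 0 ^ p) μ :=
    (integrable_indicator_iff hu.isOpen.measurableSet).2 (integrableOn_const hΩ.ne)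
  refine integrable_bound.mono' ((hu.continuous_excess hk).pow p).aestronglyMeasurable
    (.of_forall fun ξ => ?_)
  rw [Real.norm_of_nonneg (pow_nonneg (excess_nonneg ξ) p)]
  by_cases hξ : ξ ∈ Ω
  · rw [Set.indicator_of_mem hξ, excess_of_mem hξ]
    have u_le : u ξ ≤ M := hM (Set.mem_image_of_mem u hξ)
    gcongr
  · rw [Set.indicator_of_notMem hξ, excess_of_notMem hξ, zero_pow hp]

theorem ae_mul_gradSq_excess_sq_le (hu : G.IsSubsolution μ Ω F u)
    (hk : ∀ ξ ∈ frontier Ω, u ξ < k) (hF : 0 ≤ F) : ∀ᵐ ξ ∂μ, ∀ c ∈ Set.Icc (0 : ℝ) 1,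
      c * (3 * G.gradSq (fun ξ => excess Ω u k ξ ^ 2) ξ) ≤
        c * G.subLaplacian (fun ξ => excess Ω u k ξ ^ 4) ξ + 4 * F * excess Ω u k ξ ^ 3 := by
  filter_upwards [(ae_restrict_iff' hu.isOpen.measurableSet).1 hu.neg_le_subLaplacian]
    with ξ neg_le c ⟨c_nonneg, c_le_one⟩
  by_cases hξ : ξ ∈ Ω
  · have neg_le_mul : -F ≤ c * G.subLaplacian u ξ :=
      calc -F ≤ c * -F := by nlinarith
        _ ≤ c * G.subLaplacian u ξ := by gcongr; exact neg_le hξ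
    have mul_nonneg : 0 ≤ excess Ω u k ξ ^ 3 * (F + c * G.subLaplacian u ξ) :=
      mul_nonneg (pow_nonneg (excess_nonneg ξ) 3) (by linarith)
    rw [subLaplacian_excess_pow_four hu.isOpen hu.contDiffOn hξ]
    linear_combination 4 * mul_nonneg
  · rw [gradSq_excess_sq_of_notMem hu.isOpen hu.continuousOn_closure hk hξ, excess_of_notMem hξ,
      subLaplacian_eq_zero (excess_pow_eventuallyEq_zero hu.isOpen hu.continuousOn_closure hk hξ
        four_ne_zero)]
    simp

theorem integral_cutoff_mul_gradSq_excess_sq_le (hu : G.IsSubsolution μ Ω F u) (hμ : G.IsHaar μ)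
    (hΩ : μ Ω < ∞) (bddAbove : BddAbove (u '' Ω)) (hk : ∀ ξ ∈ frontier Ω, u ξ < k) (hF : 0 ≤ F)
    {χ : Coord m → ℝ} {B : ℝ} (hχ : ContDiff ℝ 2 χ) (hχc : HasCompactSupport χ)
    (hχ01 : ∀ ξ, χ ξ ∈ Set.Icc 0 1) (hB : ∀ ξ, |G.subLaplacian χ ξ| ≤ B) :
    ∫ ξ, χ ξ * (3 * G.gradSq (fun ξ => excess Ω u k ξ ^ 2) ξ) ∂μ ≤
      B * ∫ ξ, excess Ω u k ξ ^ 4 ∂μ + 4 * F * ∫ ξ, excess Ω u k ξ ^ 3 ∂μ := by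
  have := hμ.isFiniteMeasureOnCompacts
  set w := excess Ω u k
  have contDiff_pow_four : ContDiff ℝ 2 fun ξ => w ξ ^ 4 :=
    contDiff_excess_pow (n := 2) hu.isOpen hu.contDiffOn hu.continuousOn_closure hk (by norm_num)
  have integrable_left : Integrable (fun ξ => χ ξ * (3 * G.gradSq (fun ξ => w ξ ^ 2) ξ)) μ :=
    (hχ.continuous.mul (continuous_const.mul
      (continuous_gradSq (hu.contDiff_excess_sq hk)))).integrable_of_hasCompactSupport hχc.mul_right
  have integrable_subLaplacian : Integrable (fun ξ => χ ξ * G.subLaplacian (w · ^ 4) ξ) μ :=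
    (hχ.continuous.mul
      (continuous_subLaplacian contDiff_pow_four)).integrable_of_hasCompactSupport hχc.mul_right
  have integrable_cube : Integrable (fun ξ => 4 * F * w ξ ^ 3) μ :=
    (hu.integrable_excess_pow hΩ bddAbove hk three_ne_zero).const_mul _
  have integrable_pow_four := hu.integrable_excess_pow hΩ bddAbove hk four_ne_zero
  calc ∫ ξ, χ ξ * (3 * G.gradSq (fun ξ => w ξ ^ 2) ξ) ∂μ
      ≤ ∫ ξ, (χ ξ * G.subLaplacian (w · ^ 4) ξ + 4 * F * w ξ ^ 3) ∂μ :=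
        integral_mono_ae integrable_left (integrable_subLaplacian.add integrable_cube)
          ((hu.ae_mul_gradSq_excess_sq_le hk hF).mono fun ξ hξ => hξ _ (hχ01 ξ))
    _ = ∫ ξ, w ξ ^ 4 * G.subLaplacian χ ξ ∂μ + 4 * F * ∫ ξ, w ξ ^ 3 ∂μ := by
        rw [integral_add integrable_subLaplacian integrable_cube, integral_const_mul,
          hμ.integral_mul_subLaplacian contDiff_pow_four hχ hχc]
    _ ≤ ∫ ξ, w ξ ^ 4 * B ∂μ + 4 * F * ∫ ξ, w ξ ^ 3 ∂μ := by
        gcongr ?_ + _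
        refine integral_mono (integrable_pow_four.mul_bdd
          (continuous_subLaplacian hχ).aestronglyMeasurable (.of_forall hB))
          (integrable_pow_four.mul_const B) fun ξ => ?_
        exact mul_le_mul_of_nonneg_left ((le_abs_self _).trans (hB ξ))
          (pow_nonneg (excess_nonneg ξ) 4)
    _ = _ := by rw [integral_mul_const, mul_comm B]

theorem lintegral_dilated_cutoff_mul_gradSq_excess_sq_le (hu : G.IsSubsolution μ Ω F u)
    (hμ : G.IsHaar μ) (hΩ : μ Ω < ∞) (bddAbove : BddAbove (u '' Ω))
    (hk : ∀ ξ ∈ frontier Ω, u ξ < k) (hF : 0 ≤ F) {χ : Coord m → ℝ} {B : ℝ} (hχ : ContDiff ℝ 2 χ)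
    (hχc : HasCompactSupport χ) (hχ01 : ∀ ξ, χ ξ ∈ Set.Icc 0 1)
    (hB : ∀ ξ, |G.subLaplacian χ ξ| ≤ B) {a : ℝ} (ha : 0 < a) :
    ∫⁻ ξ, ENNReal.ofReal (χ (G.dilation a ξ) *
        (3 * G.gradSq (fun ξ => excess Ω u k ξ ^ 2) ξ)) ∂μ ≤
      ENNReal.ofReal (a ^ 2 * B * ∫ ξ, excess Ω u k ξ ^ 4 ∂μ +
        4 * F * ∫ ξ, excess Ω u k ξ ^ 3 ∂μ) := by
  have := hμ.isFiniteMeasureOnCompacts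
  have contDiff_dilated : ContDiff ℝ 2 fun ξ => χ (G.dilation a ξ) :=
    hχ.comp (G.contDiff_dilation a)
  have hasCompactSupport_dilated := hasCompactSupport_comp_dilation (G := G) hχc ha
  have abs_subLaplacian_le : ∀ ξ, |G.subLaplacian (fun ξ => χ (G.dilation a ξ)) ξ| ≤ a ^ 2 * B :=
    fun ξ => by
      rw [subLaplacian_comp_dilation, abs_mul, abs_of_nonneg (sq_nonneg a)]
      exact mul_le_mul_of_nonneg_left (hB _) (sq_nonneg a)
  rw [← ofReal_integral_eq_lintegral_ofReal]
  · exact ENNReal.ofReal_le_ofReal (hu.integral_cutoff_mul_gradSq_excess_sq_le hμ hΩ bddAbove hk hF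
      contDiff_dilated hasCompactSupport_dilated (fun _ => hχ01 _) abs_subLaplacian_le)
  · exact (contDiff_dilated.continuous.mul (continuous_const.mul
      (continuous_gradSq (hu.contDiff_excess_sq hk)))).integrable_of_hasCompactSupport
        hasCompactSupport_dilated.mul_right
  · exact .of_forall fun ξ => mul_nonneg (hχ01 _).1 (mul_nonneg (by norm_num) (gradSq_nonneg _ ξ))

theorem lintegral_gradSq_excess_sq_le (hu : G.IsSubsolution μ Ω F u) (hμ : G.IsHaar μ)
    (hΩ : μ Ω < ∞) (bddAbove : BddAbove (u '' Ω)) (hk : ∀ ξ ∈ frontier Ω, u ξ < k) (hF : 0 ≤ F) :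
    ∫⁻ ξ, ENNReal.ofReal (3 * G.gradSq (fun ξ => excess Ω u k ξ ^ 2) ξ) ∂μ ≤
      ENNReal.ofReal (4 * F * ∫ ξ, excess Ω u k ξ ^ 3 ∂μ) := by
  obtain ⟨χ, B, hχ, hχc, hχ01, χ_zero, hB⟩ := exists_cutoff G
  set D := fun ξ => 3 * G.gradSq (fun ξ => excess Ω u k ξ ^ 2) ξ
  have continuous_D : Continuous D :=
    continuous_const.mul (continuous_gradSq (hu.contDiff_excess_sq hk))
  set a : ℕ → ℝ := fun n => 1 / ((n : ℝ) + 1)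
  have tendsto_a : Tendsto a atTop (𝓝 0) := tendsto_one_div_add_atTop_nhds_zero_nat
  have tendsto_integrand : ∀ ξ, Tendsto (fun n => ENNReal.ofReal (χ (G.dilation (a n) ξ) * D ξ))
      atTop (𝓝 (ENNReal.ofReal (D ξ))) := fun ξ => by
    have continuous_at : Continuous fun r => ENNReal.ofReal (χ (G.dilation r ξ) * D ξ) :=
      ENNReal.continuous_ofReal.comp
        ((hχ.continuous.comp (G.continuous_dilation_left ξ)).mul continuous_const)
    simpa [Function.comp_def, dilation_zero_left, χ_zero] using
      (continuous_at.tendsto 0).comp tendsto_a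
  set I₃ := 4 * F * ∫ ξ, excess Ω u k ξ ^ 3 ∂μ
  set I₄ := ∫ ξ, excess Ω u k ξ ^ 4 ∂μ
  have tendsto_bound : Tendsto (fun n => ENNReal.ofReal (a n ^ 2 * B * I₄ + I₃)) atTop
      (𝓝 (ENNReal.ofReal I₃)) := by
    have continuous_bound : Continuous fun r : ℝ => ENNReal.ofReal (r ^ 2 * B * I₄ + I₃) :=
      ENNReal.continuous_ofReal.comp (by fun_prop)
    simpa [Function.comp_def] using (continuous_bound.tendsto 0).comp tendsto_a
  calc ∫⁻ ξ, ENNReal.ofReal (D ξ) ∂μ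
      = ∫⁻ ξ, liminf (fun n => ENNReal.ofReal (χ (G.dilation (a n) ξ) * D ξ)) atTop ∂μ :=
        lintegral_congr fun ξ => (tendsto_integrand ξ).liminf_eq.symm
    _ ≤ liminf (fun n => ∫⁻ ξ, ENNReal.ofReal (χ (G.dilation (a n) ξ) * D ξ) ∂μ) atTop :=
        lintegral_liminf_le fun n => ((hχ.comp
          (G.contDiff_dilation (a n))).continuous.mul continuous_D).measurable.ennreal_ofReal
    _ ≤ liminf (fun n => ENNReal.ofReal (a n ^ 2 * B * I₄ + I₃)) atTop :=
        liminf_le_liminf (.of_forall fun n =>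
          hu.lintegral_dilated_cutoff_mul_gradSq_excess_sq_le hμ hΩ bddAbove hk hF hχ hχc hχ01 hB
            Nat.one_div_pos_of_nat)
    _ = ENNReal.ofReal I₃ := tendsto_bound.liminf_eq

end IsSubsolution

end CarnotGroup

/-! ### De Giorgi–Stampacchia iteration -/

-- The levels `k₀ + d (1 - 2⁻ʲ)` make `φ` decay geometrically, at the ratio `t` for which the powers
-- of `2` produced by the level gaps are absorbed.
theorem le_mul_pow_of_superlevel_decay {φ : ℝ → ℝ} {A α β k₀ d t : ℝ} (φ_nonneg : ∀ k, 0 ≤ φ k)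
    (hA : 0 ≤ A) (hβ : 1 < β) (hd : 0 < d) (ht : 0 < t) (ht_rpow : t ^ (β - 1) = (1 / 2) ^ α)
    (decay : ∀ k h, k₀ ≤ k → k < h → (h - k) ^ α * φ h ≤ A * φ k ^ β)
    (hAd : A * φ k₀ ^ (β - 1) ≤ d ^ α * t ^ β) (j : ℕ) :
    φ (k₀ + d * (1 - (1 / 2) ^ j)) ≤ φ k₀ * t ^ j := by
  induction j with
  | zero => simp
  | succ j ih =>
    have gap : k₀ + d * (1 - (1 / 2) ^ (j + 1)) - (k₀ + d * (1 - (1 / 2) ^ j)) =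
        d * (1 / 2) ^ (j + 1) := by ring
    have gap_pos : 0 < d * (1 / 2 : ℝ) ^ (j + 1) := by positivity
    have half_pow_le : (1 / 2 : ℝ) ^ j ≤ 1 := pow_le_one₀ (by norm_num) (by norm_num)
    have step := decay (k₀ + d * (1 - (1 / 2) ^ j)) (k₀ + d * (1 - (1 / 2) ^ (j + 1)))
      (by nlinarith) (by linarith)
    rw [gap] at step
    have gap_rpow : (d * (1 / 2 : ℝ) ^ (j + 1)) ^ α = d ^ α * (t ^ (j + 1)) ^ (β - 1) := by
      rw [Real.mul_rpow hd.le (by positivity), ← Real.rpow_pow_comm (by norm_num), ← ht_rpow,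
        Real.rpow_pow_comm ht.le]
    have φ_rpow : φ k₀ ^ β = φ k₀ * φ k₀ ^ (β - 1) := by
      rw [← Real.rpow_one_add' (φ_nonneg k₀) (by linarith), add_sub_cancel]
    have t_rpow : t ^ β * (t ^ j) ^ β = t ^ (j + 1) * (t ^ (j + 1)) ^ (β - 1) := by
      rw [← Real.mul_rpow ht.le (by positivity), ← pow_succ',
        ← Real.rpow_one_add' (by positivity) (by linarith), add_sub_cancel]
    refine le_of_mul_le_mul_left ?_ (Real.rpow_pos_of_pos gap_pos α)
    calc _ ≤ A * φ (k₀ + d * (1 - (1 / 2) ^ j)) ^ β := step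
      _ ≤ A * (φ k₀ * t ^ j) ^ β := by gcongr; exact φ_nonneg _
      _ = A * φ k₀ ^ (β - 1) * (φ k₀ * (t ^ j) ^ β) := by
        rw [Real.mul_rpow (φ_nonneg k₀) (by positivity), φ_rpow]
        ring
      _ ≤ d ^ α * t ^ β * (φ k₀ * (t ^ j) ^ β) := by
        gcongr
        exact mul_nonneg (φ_nonneg k₀) (by positivity)
      _ = (d * (1 / 2) ^ (j + 1)) ^ α * (φ k₀ * t ^ (j + 1)) := by
        rw [gap_rpow]
        linear_combination d ^ α * φ k₀ * t_rpow

theorem eq_zero_of_superlevel_decay {φ : ℝ → ℝ} {A α β k₀ d : ℝ} (hφ : Antitone φ)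
    (φ_nonneg : ∀ k, 0 ≤ φ k) (hA : 0 ≤ A) (hα : 0 < α) (hβ : 1 < β) (hd : 0 < d)
    (decay : ∀ k h, k₀ ≤ k → k < h → (h - k) ^ α * φ h ≤ A * φ k ^ β)
    (hAd : A * φ k₀ ^ (β - 1) * 2 ^ (α * β / (β - 1)) ≤ d ^ α) : φ (k₀ + d) = 0 := by
  have β_sub_pos : 0 < β - 1 := sub_pos.2 hβ
  set t : ℝ := (1 / 2) ^ (α / (β - 1))
  have t_pos : 0 < t := by positivity
  have t_lt_one : t < 1 := Real.rpow_lt_one (by norm_num) (by norm_num) (by positivity)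
  have t_rpow_sub : t ^ (β - 1) = (1 / 2) ^ α := by
    rw [← Real.rpow_mul (by norm_num), div_mul_cancel₀ _ β_sub_pos.ne']
  have two_rpow_mul : 2 ^ (α * β / (β - 1)) * t ^ β = 1 := by
    rw [← Real.rpow_mul (by norm_num), div_mul_eq_mul_div, ← Real.mul_rpow (by norm_num)
      (by norm_num)]
    norm_num
  have le_d : A * φ k₀ ^ (β - 1) ≤ d ^ α * t ^ β := by
    calc A * φ k₀ ^ (β - 1)
        = A * φ k₀ ^ (β - 1) * 2 ^ (α * β / (β - 1)) * t ^ β := by rw [mul_assoc, two_rpow_mul,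
          mul_one]
      _ ≤ d ^ α * t ^ β := by gcongr
  have tendsto_zero : Tendsto (fun j : ℕ => φ k₀ * t ^ j) atTop (𝓝 0) := by
    simpa using (tendsto_pow_atTop_nhds_zero_of_lt_one t_pos.le t_lt_one).const_mul (φ k₀)
  refine le_antisymm (ge_of_tendsto' tendsto_zero fun j => ?_) (φ_nonneg _)
  calc φ (k₀ + d) ≤ φ (k₀ + d * (1 - (1 / 2) ^ j)) := hφ <| by
        have : 0 ≤ d * (1 / 2) ^ j := by positivity
        linarith
    _ ≤ φ k₀ * t ^ j := le_mul_pow_of_superlevel_decay φ_nonneg hA hβ hd t_pos t_rpow_sub decay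
        le_d j

theorem four_mul_mul_pow_three_le {D w : ℝ} (hD : 0 ≤ D) (hw : 0 ≤ w) :
    4 * (D * w ^ 3) ≤ 3 * w ^ 4 + D ^ 4 := by
  have remainder_nonneg : 0 ≤ (D - w) ^ 2 * (D ^ 2 + 2 * D * w + 3 * w ^ 2) := by positivity
  linear_combination remainder_nonneg

theorem integral_pow_four_le {α : Type*} [MeasurableSpace α] {μ : Measure α} {w : α → ℝ}
    {A : Set α} {D : ℝ} (hA : MeasurableSet A) (measure_ne_top : μ A ≠ ∞) (hw : ∀ x, 0 ≤ w x)
    (eq_zero : ∀ x ∉ A, w x = 0) (integrable_pow_three : Integrable (fun x => w x ^ 3) μ)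
    (integrable_pow_four : Integrable (fun x => w x ^ 4) μ) (hD : 0 ≤ D)
    (le_mul : ∫ x, w x ^ 4 ∂μ ≤ D * ∫ x, w x ^ 3 ∂μ) :
    ∫ x, w x ^ 4 ∂μ ≤ D ^ 4 * μ.real A := by
  have integrable_indicator : Integrable (A.indicator fun _ => D ^ 4) μ :=
    (integrable_indicator_iff hA).2 (integrableOn_const measure_ne_top)
  have young : ∫ x, 4 * (D * w x ^ 3) ∂μ ≤
      ∫ x, (3 * w x ^ 4 + A.indicator (fun _ => D ^ 4) x) ∂μ := by
    refine integral_mono ((integrable_pow_three.const_mul D).const_mul 4)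
      ((integrable_pow_four.const_mul 3).add integrable_indicator) fun x => ?_
    by_cases hx : x ∈ A
    · simpa only [Set.indicator_of_mem hx] using four_mul_mul_pow_three_le hD (hw x)
    · simp [Set.indicator_of_notMem hx, eq_zero x hx]
  rw [integral_add (integrable_pow_four.const_mul 3) integrable_indicator, integral_const_mul,
    integral_const_mul, integral_const_mul, integral_indicator_const _ hA, smul_eq_mul] at young
  linarith

/-! ### The maximum principle -/

theorem ofReal_toReal_add_mul_toReal_mul_rpow {a b x : ℝ≥0∞} {c p : ℝ} (ha : a ≠ ∞) (hb : b ≠ ∞)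
    (hx : x ≠ ∞) (hc : 0 ≤ c) (hp : 0 ≤ p) :
    ENNReal.ofReal (a.toReal + c * b.toReal * x.toReal ^ p) = a + c.toNNReal * b * x ^ p := by
  rw [ENNReal.ofReal_add ENNReal.toReal_nonneg (by positivity), ENNReal.ofReal_mul (by positivity),
    ENNReal.ofReal_mul hc, ← ENNReal.ofReal_rpow_of_nonneg ENNReal.toReal_nonneg hp,
    ENNReal.ofReal_toReal ha, ENNReal.ofReal_toReal hb, ENNReal.ofReal_toReal hx, ENNReal.ofReal]

namespace CarnotGroup

variable {𝔤 : Type*} [LieRing 𝔤] [LieAlgebra ℝ 𝔤] {s : ℕ} {m : Fin s → ℕ}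
  {G : CarnotGroup 𝔤 s m} {μ : Measure (Coord m)} {Ω : Set (Coord m)} {u : Coord m → ℝ} {k F C : ℝ}

attribute [local irreducible] CarnotGroup.mul

theorem measure_superlevel_ne_top (hΩ : μ Ω < ∞) : μ {ξ ∈ Ω | k < u ξ} ≠ ∞ :=
  measure_ne_top_of_subset (Set.sep_subset _ _) hΩ.ne

theorem antitone_measureReal_superlevel (hΩ : μ Ω < ∞) :
    Antitone fun k => μ.real {ξ ∈ Ω | k < u ξ} := fun _ _ hkh =>
  measureReal_mono (fun _ hξ => ⟨hξ.1, hkh.trans_lt hξ.2⟩) (measure_superlevel_ne_top hΩ)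

namespace IsSubsolution

theorem ofReal_integral_excess_pow_four_le (hu : G.IsSubsolution μ Ω F u)
    (faberKrahn : G.FaberKrahnInequality μ C) (hΩ : μ Ω < ∞) (bddAbove : BddAbove (u '' Ω))
    (hk : ∀ ξ ∈ frontier Ω, u ξ < k) (measure_pos : 0 < μ.real {ξ ∈ Ω | k < u ξ}) :
    ENNReal.ofReal (∫ ξ, excess Ω u k ξ ^ 4 ∂μ) ≤
      ENNReal.ofReal (C * μ.real {ξ ∈ Ω | k < u ξ} ^ (2 / (G.homDim : ℝ))) *
        ∫⁻ ξ, ENNReal.ofReal (G.gradSq (fun ξ => excess Ω u k ξ ^ 2) ξ) ∂μ := by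
  have measure_le : μ {ξ | excess Ω u k ξ ^ 2 ≠ 0} ≤
      ENNReal.ofReal (μ.real {ξ ∈ Ω | k < u ξ}) := by
    rw [ofReal_measureReal (measure_superlevel_ne_top hΩ)]
    refine measure_mono fun ξ => not_imp_comm.1 fun hξ => ?_
    rw [excess_eq_zero hξ, zero_pow two_ne_zero]
  have lintegral_eq : ∫⁻ ξ, ENNReal.ofReal ((excess Ω u k ξ ^ 2) ^ 2) ∂μ =
      ENNReal.ofReal (∫ ξ, excess Ω u k ξ ^ 4 ∂μ) := by
    rw [ofReal_integral_eq_lintegral_ofReal (hu.integrable_excess_pow hΩ bddAbove hk four_ne_zero)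
      (.of_forall fun ξ => pow_nonneg (excess_nonneg ξ) 4)]
    simp only [← pow_mul]
  rw [← lintegral_eq]
  exact faberKrahn _ _ (hu.contDiff_excess_sq hk) (fun ξ => sq_nonneg _) measure_pos measure_le
    (lintegral_eq ▸ ENNReal.ofReal_ne_top)

theorem integral_excess_pow_four_le_mul_integral_pow_three (hu : G.IsSubsolution μ Ω F u)
    (hμ : G.IsHaar μ) (hC : 0 ≤ C) (faberKrahn : G.FaberKrahnInequality μ C) (hΩ : μ Ω < ∞)
    (bddAbove : BddAbove (u '' Ω)) (hk : ∀ ξ ∈ frontier Ω, u ξ < k) (hF : 0 ≤ F)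
    (measure_pos : 0 < μ.real {ξ ∈ Ω | k < u ξ}) :
    ∫ ξ, excess Ω u k ξ ^ 4 ∂μ ≤
      4 / 3 * C * F * μ.real {ξ ∈ Ω | k < u ξ} ^ (2 / (G.homDim : ℝ)) *
        ∫ ξ, excess Ω u k ξ ^ 3 ∂μ := by
  set I₃ := ∫ ξ, excess Ω u k ξ ^ 3 ∂μ
  set I₄ := ∫ ξ, excess Ω u k ξ ^ 4 ∂μ
  set T := μ.real {ξ ∈ Ω | k < u ξ} ^ (2 / (G.homDim : ℝ))
  set E := ∫⁻ ξ, ENNReal.ofReal (G.gradSq (fun ξ => excess Ω u k ξ ^ 2) ξ) ∂μ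
  have energy : ENNReal.ofReal 3 * E ≤ ENNReal.ofReal (4 * F * I₃) := by
    rw [← lintegral_const_mul _
      (continuous_gradSq (hu.contDiff_excess_sq hk)).measurable.ennreal_ofReal]
    simpa only [← ENNReal.ofReal_mul zero_le_three] using
      hu.lintegral_gradSq_excess_sq_le hμ hΩ bddAbove hk hF
  have I₃_nonneg : 0 ≤ I₃ := integral_nonneg fun ξ => pow_nonneg (excess_nonneg ξ) 3
  have three_mul_le : 3 * I₄ ≤ C * T * (4 * F * I₃) := by
    rw [← ENNReal.ofReal_le_ofReal_iff (by positivity), ENNReal.ofReal_mul zero_le_three,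
      ENNReal.ofReal_mul (p := C * T) (by positivity)]
    calc ENNReal.ofReal 3 * ENNReal.ofReal I₄
        ≤ ENNReal.ofReal 3 * (ENNReal.ofReal (C * T) * E) := by
          gcongr
          exact hu.ofReal_integral_excess_pow_four_le faberKrahn hΩ bddAbove hk measure_pos
      _ = ENNReal.ofReal (C * T) * (ENNReal.ofReal 3 * E) := by ring
      _ ≤ _ := by gcongr
  linarith

theorem pow_four_mul_superlevel_le_integral (hu : G.IsSubsolution μ Ω F u) (hΩ : μ Ω < ∞)
    (bddAbove : BddAbove (u '' Ω)) (hk : ∀ ξ ∈ frontier Ω, u ξ < k) {h : ℝ} (hkh : k ≤ h) :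
    (h - k) ^ 4 * μ.real {ξ ∈ Ω | h < u ξ} ≤ ∫ ξ, excess Ω u k ξ ^ 4 ∂μ := by
  have integrable_pow_four := hu.integrable_excess_pow hΩ bddAbove hk four_ne_zero
  have pow_four_nonneg : ∀ ξ, 0 ≤ excess Ω u k ξ ^ 4 := fun ξ => pow_nonneg (excess_nonneg ξ) 4
  refine (setIntegral_ge_of_const_le_real (hu.isOpen_superlevel h).measurableSet
    (measure_ne_top_of_subset (Set.sep_subset _ _) hΩ.ne) (fun ξ hξ => ?_)
    integrable_pow_four.integrableOn).trans
    (setIntegral_le_integral integrable_pow_four (.of_forall pow_four_nonneg))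
  rw [excess_of_mem hξ.1]
  exact pow_le_pow_left₀ (sub_nonneg.2 hkh) (le_max_of_le_left (sub_le_sub_right hξ.2.le k)) 4

theorem superlevel_decay (hu : G.IsSubsolution μ Ω F u) (hμ : G.IsHaar μ) (hC : 0 ≤ C)
    (faberKrahn : G.FaberKrahnInequality μ C) (hΩ : μ Ω < ∞) (bddAbove : BddAbove (u '' Ω))
    (hk : ∀ ξ ∈ frontier Ω, u ξ < k) (hF : 0 ≤ F) {h : ℝ} (hkh : k ≤ h) :
    (h - k) ^ 4 * μ.real {ξ ∈ Ω | h < u ξ} ≤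
      (4 / 3 * C * F) ^ 4 * μ.real {ξ ∈ Ω | k < u ξ} ^ (1 + 8 / (G.homDim : ℝ)) := by
  set φ : ℝ → ℝ := fun k => μ.real {ξ ∈ Ω | k < u ξ}
  change (h - k) ^ 4 * φ h ≤ (4 / 3 * C * F) ^ 4 * φ k ^ (1 + 8 / (G.homDim : ℝ))
  have φ_nonneg : ∀ k, 0 ≤ φ k := fun k => measureReal_nonneg
  rcases (φ_nonneg k).eq_or_lt' with φ_eq_zero | φ_pos
  · have φ_h_eq_zero : φ h = 0 :=
      le_antisymm ((antitone_measureReal_superlevel hΩ hkh).trans_eq φ_eq_zero) (φ_nonneg h)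
    rw [φ_h_eq_zero, mul_zero]
    exact mul_nonneg (by positivity) (Real.rpow_nonneg (φ_nonneg k) _)
  calc (h - k) ^ 4 * φ h ≤ ∫ ξ, excess Ω u k ξ ^ 4 ∂μ :=
        hu.pow_four_mul_superlevel_le_integral hΩ bddAbove hk hkh
    _ ≤ (4 / 3 * C * F * φ k ^ (2 / (G.homDim : ℝ))) ^ 4 * φ k :=
        integral_pow_four_le (hu.isOpen_superlevel k).measurableSet (measure_superlevel_ne_top hΩ)
          excess_nonneg (fun ξ => excess_eq_zero)
          (hu.integrable_excess_pow hΩ bddAbove hk three_ne_zero)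
          (hu.integrable_excess_pow hΩ bddAbove hk four_ne_zero) (by positivity)
          (hu.integral_excess_pow_four_le_mul_integral_pow_three hμ hC faberKrahn hΩ bddAbove hk
            hF φ_pos)
    _ = _ := by
        rw [mul_pow, mul_assoc, ← Real.rpow_mul_natCast φ_pos.le, ← Real.rpow_add_one φ_pos.ne']
        ring_nf

theorem measureReal_superlevel_add_eq_zero (hu : G.IsSubsolution μ Ω F u) (hμ : G.IsHaar μ)
    (hC : 0 ≤ C) (faberKrahn : G.FaberKrahnInequality μ C) (hΩ : μ Ω < ∞)
    (bddAbove : BddAbove (u '' Ω)) (hk : ∀ ξ ∈ frontier Ω, u ξ < k) (hF : 0 ≤ F) {d : ℝ}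
    (hd : 0 < d) (le_d : (4 / 3 * C * F) ^ 4 * μ.real Ω ^ (8 / (G.homDim : ℝ)) *
      2 ^ (4 + (G.homDim : ℝ) / 2) ≤ d ^ 4) : μ.real {ξ ∈ Ω | k + d < u ξ} = 0 := by
  have homDim_pos : 0 < (G.homDim : ℝ) := by exact_mod_cast homDim_pos G
  refine eq_zero_of_superlevel_decay (φ := fun k => μ.real {ξ ∈ Ω | k < u ξ})
    (A := (4 / 3 * C * F) ^ 4) (α := 4) (β := 1 + 8 / (G.homDim : ℝ))
    (antitone_measureReal_superlevel hΩ) (fun k => measureReal_nonneg) (by positivity)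
    (by norm_num) (lt_add_of_pos_right 1 (by positivity)) hd (fun k' h hk' hkh => ?_) ?_
  · exact_mod_cast hu.superlevel_decay hμ hC faberKrahn hΩ bddAbove
      (fun ξ hξ => (hk ξ hξ).trans_le hk') hF hkh.le
  · have exponent_eq :
        4 * (1 + 8 / (G.homDim : ℝ)) / (8 / (G.homDim : ℝ)) = 4 + (G.homDim : ℝ) / 2 := by
      field_simp
      ring
    rw [add_sub_cancel_left, exponent_eq, Real.rpow_ofNat]
    refine le_trans ?_ le_d
    gcongr
    · exact hΩ.ne
    · exact Set.sep_subset _ _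

theorem le_add_of_lt_on_frontier (hu : G.IsSubsolution μ Ω F u) (hμ : G.IsHaar μ) (hC : 0 < C)
    (faberKrahn : G.FaberKrahnInequality μ C) (hΩ : μ Ω < ∞) (bddAbove : BddAbove (u '' Ω))
    (hk : ∀ ξ ∈ frontier Ω, u ξ < k) (hF : 0 < F) {ξ : Coord m} (hξ : ξ ∈ Ω) :
    u ξ ≤ k + 4 / 3 * C * 2 ^ (1 + (G.homDim : ℝ) / 8) * F *
      μ.real Ω ^ (2 / (G.homDim : ℝ)) := by
  have := hμ.isOpenPosMeasure
  set d := 4 / 3 * C * 2 ^ (1 + (G.homDim : ℝ) / 8) * F * μ.real Ω ^ (2 / (G.homDim : ℝ)) with d_eq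
  have measure_pos : 0 < μ.real Ω := ENNReal.toReal_pos (hu.isOpen.measure_ne_zero μ ⟨ξ, hξ⟩) hΩ.ne
  have two_rpow_pow :
      ((2 : ℝ) ^ (1 + (G.homDim : ℝ) / 8)) ^ 4 = 2 ^ (4 + (G.homDim : ℝ) / 2) := by
    rw [← Real.rpow_mul_natCast zero_le_two]
    ring_nf
  have measure_rpow_pow :
      (μ.real Ω ^ (2 / (G.homDim : ℝ))) ^ 4 = μ.real Ω ^ (8 / (G.homDim : ℝ)) := by
    rw [← Real.rpow_mul_natCast measure_pos.le]
    ring_nf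
  have d_pow_four : (4 / 3 * C * F) ^ 4 * μ.real Ω ^ (8 / (G.homDim : ℝ)) *
      2 ^ (4 + (G.homDim : ℝ) / 2) = d ^ 4 := by
    rw [← two_rpow_pow, ← measure_rpow_pow, d_eq]
    ring
  by_contra! lt_u
  exact (hu.isOpen_superlevel (k + d)).measure_ne_zero μ ⟨ξ, hξ, lt_u⟩
    ((measureReal_eq_zero_iff (measure_superlevel_ne_top hΩ)).1
      (hu.measureReal_superlevel_add_eq_zero hμ hC.le faberKrahn hΩ bddAbove hk hF.le
        (by positivity) d_pow_four.le))

theorem mono {F' : ℝ} (hu : G.IsSubsolution μ Ω F u) (hF : F ≤ F') : G.IsSubsolution μ Ω F' u where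
  isOpen := hu.isOpen
  contDiffOn := hu.contDiffOn
  continuousOn_closure := hu.continuousOn_closure
  neg_le_subLaplacian := hu.neg_le_subLaplacian.mono fun _ => (neg_le_neg hF).trans

theorem le_add_of_le_on_frontier (hu : G.IsSubsolution μ Ω F u) (hμ : G.IsHaar μ) (hC : 0 < C)
    (faberKrahn : G.FaberKrahnInequality μ C) (hΩ : μ Ω < ∞) (bddAbove : BddAbove (u '' Ω))
    (hk : ∀ ξ ∈ frontier Ω, u ξ ≤ k) (hF : 0 ≤ F) {ξ : Coord m} (hξ : ξ ∈ Ω) :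
    u ξ ≤ k + 4 / 3 * C * 2 ^ (1 + (G.homDim : ℝ) / 8) * F *
      μ.real Ω ^ (2 / (G.homDim : ℝ)) := by
  set C' := 4 / 3 * C * 2 ^ (1 + (G.homDim : ℝ) / 8)
  set T := μ.real Ω ^ (2 / (G.homDim : ℝ))
  have continuous_bound : Continuous fun ε : ℝ => k + ε + C' * (F + ε) * T := by fun_prop
  have tendsto_bound : Tendsto (fun ε : ℝ => k + ε + C' * (F + ε) * T) (𝓝[>] 0)
      (𝓝 (k + C' * F * T)) := by
    simpa using (continuous_bound.tendsto 0).mono_left nhdsWithin_le_nhds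
  refine ge_of_tendsto tendsto_bound (eventually_mem_nhdsWithin.mono fun ε hε => ?_)
  have ε_pos : 0 < ε := hε
  exact (hu.mono (le_add_of_nonneg_right ε_pos.le)).le_add_of_lt_on_frontier hμ hC faberKrahn hΩ
    bddAbove (fun η hη => (hk η hη).trans_lt (lt_add_of_pos_right k ε_pos))
    (add_pos_of_nonneg_of_pos hF ε_pos) hξ

end IsSubsolution

theorem isSubsolution_of_subLaplacian_eq {f : Coord m → ℝ} (hΩ : IsOpen Ω)
    (hf : MemLp f ∞ (μ.restrict Ω)) (contDiffOn : ContDiffOn ℝ 2 u Ω)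
    (continuousOn : ContinuousOn u (closure Ω))
    (subLaplacian_eq : ∀ᵐ ξ ∂(μ.restrict Ω), G.subLaplacian u ξ = f ξ) :
    G.IsSubsolution μ Ω (eLpNorm f ∞ (μ.restrict Ω)).toReal u where
  isOpen := hΩ
  contDiffOn := contDiffOn
  continuousOn_closure := continuousOn
  neg_le_subLaplacian := by
    filter_upwards [subLaplacian_eq, ae_le_eLpNormEssSup (f := f) (μ := μ.restrict Ω)]
      with ξ hξ enorm_le
    rw [← eLpNorm_exponent_top] at enorm_le
    refine neg_le_of_abs_le ?_
    rw [hξ, ← Real.norm_eq_abs, ← toReal_enorm]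
    exact ENNReal.toReal_mono hf.eLpNorm_ne_top enorm_le

theorem IsHaar.exists_abs_le_add (hμ : G.IsHaar μ) : ∃ C : ℝ, 0 < C ∧
    ∀ (Ω : Set (Coord m)) (u f : Coord m → ℝ) (k : ℝ), IsOpen Ω → μ Ω < ∞ →
      MemLp f ∞ (μ.restrict Ω) → ContDiffOn ℝ 2 u Ω → ContinuousOn u (closure Ω) →
      BddAbove ((fun ξ => |u ξ|) '' Ω) → (∀ᵐ ξ ∂(μ.restrict Ω), G.subLaplacian u ξ = f ξ) →
      (∀ ξ ∈ frontier Ω, |u ξ| ≤ k) → ∀ ξ ∈ Ω,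
      |u ξ| ≤ k + C * (eLpNorm f ∞ (μ.restrict Ω)).toReal * μ.real Ω ^ (2 / (G.homDim : ℝ)) := by
  obtain ⟨C, hC, faberKrahn⟩ := hμ.exists_faberKrahnInequality
  refine ⟨4 / 3 * C * 2 ^ (1 + (G.homDim : ℝ) / 8), by positivity, ?_⟩
  rintro Ω u f k hΩ hΩμ hf contDiffOn continuousOn ⟨M, hM⟩ subLaplacian_eq hk ξ hξ
  have abs_le : ∀ ξ ∈ Ω, |u ξ| ≤ M := fun ξ hξ => hM ⟨ξ, hξ, rfl⟩
  have neg_subLaplacian_eq : ∀ᵐ ξ ∂(μ.restrict Ω), G.subLaplacian (fun ξ => -u ξ) ξ = (-f) ξ :=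
    subLaplacian_eq.mono fun ξ hξ => by rw [subLaplacian_neg, hξ, Pi.neg_apply]
  have isSubsolution := isSubsolution_of_subLaplacian_eq hΩ hf contDiffOn continuousOn
    subLaplacian_eq
  have isSubsolution_neg := isSubsolution_of_subLaplacian_eq hΩ hf.neg contDiffOn.neg
    continuousOn.neg neg_subLaplacian_eq
  rw [eLpNorm_neg] at isSubsolution_neg
  refine abs_le'.2 ⟨?_, ?_⟩
  · exact isSubsolution.le_add_of_le_on_frontier hμ hC faberKrahn hΩμ
      ⟨M, Set.forall_mem_image.2 fun η hη => (le_abs_self _).trans (abs_le η hη)⟩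
      (fun η hη => (le_abs_self _).trans (hk η hη)) ENNReal.toReal_nonneg hξ
  · exact isSubsolution_neg.le_add_of_le_on_frontier hμ hC faberKrahn hΩμ
      ⟨M, Set.forall_mem_image.2 fun η hη => (neg_le_abs _).trans (abs_le η hη)⟩
      (fun η hη => (neg_le_abs _).trans (hk η hη)) ENNReal.toReal_nonneg hξ

end CarnotGroup

end

theorem lemma2p5 {𝔤 : Type*} [LieRing 𝔤] [LieAlgebra ℝ 𝔤] {s : ℕ} {m : Fin s → ℕ}
    (G : CarnotGroup 𝔤 s m) (μ : Measure (CarnotGroup.Coord m)) (hμ : G.IsHaar μ) :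
    ∃ C : ℝ≥0, 0 < C ∧
      ∀ (Ω : Set (CarnotGroup.Coord m)) (u f g : CarnotGroup.Coord m → ℝ),
        IsOpen Ω → μ Ω < ∞ →
        MemLp f ∞ (μ.restrict Ω) →
        ContDiffOn ℝ 2 u Ω → ContinuousOn u (closure Ω) →
        BddAbove ((fun ξ => |u ξ|) '' Ω) →
        (∀ᵐ ξ ∂(μ.restrict Ω), G.subLaplacian u ξ = f ξ) →
        (∀ ξ ∈ frontier Ω, u ξ = g ξ) →
        (⨆ ξ ∈ Ω, ENNReal.ofReal |u ξ|) ≤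
          (⨆ ξ ∈ frontier Ω, ENNReal.ofReal |g ξ|) +
            (C : ℝ≥0∞) * eLpNorm f ∞ (μ.restrict Ω) * μ Ω ^ (2 / (G.homDim : ℝ)) *
              (2 : ℝ≥0∞) ^ (((G.homDim : ℝ) + 2) / 4) := by
  obtain ⟨C, hC, abs_le_add⟩ := hμ.exists_abs_le_add
  refine ⟨C.toNNReal, Real.toNNReal_pos.2 hC, ?_⟩
  intro Ω u f g hΩ hΩμ hf contDiffOn continuousOn bddAbove subLaplacian_eq u_eq_g
  set k := ⨆ ξ ∈ frontier Ω, ENNReal.ofReal |g ξ|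
  rcases eq_or_ne k ∞ with k_eq_top | k_ne_top
  · simp only [k_eq_top, top_add, le_top]
  have abs_le_on_frontier : ∀ ξ ∈ frontier Ω, |u ξ| ≤ k.toReal := fun ξ hξ => by
    rw [u_eq_g ξ hξ, ← ENNReal.ofReal_le_iff_le_toReal k_ne_top]
    exact le_iSup₂ (f := fun ξ (_ : ξ ∈ frontier Ω) => ENNReal.ofReal |g ξ|) ξ hξ
  refine iSup₂_le fun ξ hξ => ?_
  calc ENNReal.ofReal |u ξ|
      ≤ ENNReal.ofReal (k.toReal + C * (eLpNorm f ∞ (μ.restrict Ω)).toReal *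
          μ.real Ω ^ (2 / (G.homDim : ℝ))) :=
        ENNReal.ofReal_le_ofReal (abs_le_add Ω u f k.toReal hΩ hΩμ hf contDiffOn continuousOn
          bddAbove subLaplacian_eq abs_le_on_frontier ξ hξ)
    _ = k + C.toNNReal * eLpNorm f ∞ (μ.restrict Ω) * μ Ω ^ (2 / (G.homDim : ℝ)) :=
        ofReal_toReal_add_mul_toReal_mul_rpow k_ne_top hf.eLpNorm_ne_top hΩμ.ne hC.le
          (by positivity)
    _ ≤ _ := add_le_add_right
        (le_mul_of_one_le_right' (ENNReal.one_le_rpow one_le_two (by positivity))) k
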